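/- Let $p\neq 2$ be a prime and let $f_6\in\mathbb Z[x,y,z]$ be a form of degree $6$ whose reduction modulo $p$ defines a nonsingular plane curve. For a ring $R$ let $S_R$ be the surface $w^2=f_6(x,y,z)$ in $\mathbb P_R(1,1,1,3)$; put $S_p=S_{\mathbb F_p}$ and $S_{p^2}=S_{\mathbb Z/p^2}$. (Thus $S_{\mathbb Q}$ is a $K3$ surface of degree $2$ with good reduction $S_p$.) Let $\ell\in\mathbb Z[x,y,z]$ be a linear form, nonzero modulo $p$, such that the line $\ell=0$ over $\mathbb F_p$ is tritangent to the branch curve $f_6=0$ of $S_p$, i.e. over $\overline{\mathbb F}_p$ the restriction of $f_6$ to the line is the square of a cubic form. Suppose that the pull-back of this line to $S_p$ is reducible over $\mathbb F_p$, and let $l$ be one of its irreducible components, with its reduced structure. Then there are forms $f_3,f_5\in\mathbb Z[x,y,z]$ of degrees $3$ and $5$ with $f_6\equiv f_3^2+\ell f_5 \pmod p$. For any such $f_3,f_5$ put $$G:=(f_6-f_3^2-\ell f_5)/p .$$ Then the affine open sets $\{\ell\ne0\}$, $\{f_3\neq 0\}$, $\{f_5\neq0\}$ cover $S_p$; there is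 a sign $\varepsilon\in\{1,-1\}$ such that $l$ is given by $\ell=0$, $w=-\varepsilon f_3$; and there is an isomorphism $$\Phi\colon\ \mathbb Z[x,y,z]_6/(p,\ell,f_3,f_5)_6\ \xrightarrow{\ \cong\ }\ H^2(S_p,\mathscr O_{S_p}),$$ which sends the class of a sextic form $q$ to the class of the Čech cocycle $\varepsilon\,\dfrac{q\,w}{2\,\ell f_3f_5}$ for this covering (in the given order). Under this isomorphism, the obstruction to lifting the invertible sheaf $\mathscr O(l)$ from $S_p$ to $S_{p^2}$ is the class of $-G$ modulo $(p,\ell,f_3,f_5)$: $$\mathrm{ob}(\mathscr O(l))=\Phi\bigl((-G)\bmod (p,\ell,f_3,f_5)\bigr).$$ Here $\mathrm{ob}\colon \mathrm{Pic}(S_p)\to H^2(S_p,\mathscr O_{S_p})$ is the connecting homomorphism of $0\to\mathscr O_{S_p}\to\mathscr O_{S_{p^2}}^*\to\mathscr O_{S_p}^*\to 0$, whose first map is $x\mapsto 1+px$. -/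

import Mathlib

open AlgebraicGeometry CategoryTheory TopologicalSpace MvPolynomial
open scoped DirectSum

noncomputable section

/-! ### Quotient of a graded algebra by a homogeneous ideal -/

section QuotientGrading

variable {R A : Type} [CommRing R] [CommRing A] [Algebra R A]

/-- The image grading on `A ⧸ I`. -/
def quotientGrading (𝒜 : ℕ → Submodule R A) (I : Ideal A) (n : ℕ) : Submodule R (A ⧸ I) :=
  (𝒜 n).map (Ideal.Quotient.mkₐ R I).toLinearMap

variable (𝒜 : ℕ → Submodule R A) [GradedAlgebra 𝒜] (I : Ideal A)

/-- The projection from the `n`-th piece of `A` to the `n`-th piece of `A ⧸ I`. -/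
def quotientGradingProj (n : ℕ) : 𝒜 n →+ quotientGrading 𝒜 I n where
  toFun x := ⟨Ideal.Quotient.mk I x, ⟨x, x.2, rfl⟩⟩
  map_zero' := by ext; simp
  map_add' x y := by ext; simp

/-- The map `A → ⨁ (A ⧸ I)ₙ`. -/
def quotientDecomposeAux : A →+ ⨁ n, quotientGrading 𝒜 I n :=
  (DirectSum.map (quotientGradingProj 𝒜 I)).comp
    (DirectSum.decomposeAddEquiv 𝒜).toAddMonoidHom

theorem quotientDecomposeAux_of_mem {n : ℕ} {x : A} (hx : x ∈ 𝒜 n) :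
    quotientDecomposeAux 𝒜 I x =
      DirectSum.of (fun n => quotientGrading 𝒜 I n) n
        ⟨Ideal.Quotient.mk I x, ⟨x, hx, rfl⟩⟩ := by
  simp only [quotientDecomposeAux, AddMonoidHom.comp_apply, AddEquiv.toAddMonoidHom_eq_coe,
    AddMonoidHom.coe_coe, DirectSum.decomposeAddEquiv_apply, DirectSum.decompose_of_mem 𝒜 hx,
    DirectSum.map_of]
  rfl

theorem quotientDecomposeAux_eq_zero (hI : I.IsHomogeneous 𝒜) {x : A} (hx : x ∈ I) :
    quotientDecomposeAux 𝒜 I x = 0 := by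
  apply DFinsupp.ext
  intro n
  apply Subtype.ext
  have h : quotientDecomposeAux 𝒜 I x n =
      quotientGradingProj 𝒜 I n (DirectSum.decompose 𝒜 x n) := by
    simp [quotientDecomposeAux]
  rw [h]
  exact Ideal.Quotient.eq_zero_iff_mem.mpr (hI n hx)

/-- The quotient of a graded ring by a homogeneous ideal is graded. -/
@[reducible]
def quotientGradedRing (hI : I.IsHomogeneous 𝒜) : GradedRing (quotientGrading 𝒜 I) where
  one_mem := ⟨1, SetLike.GradedOne.one_mem, by simp⟩
  mul_mem := by
    rintro i j _ _ ⟨a, ha, rfl⟩ ⟨b, hb, rfl⟩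
    exact ⟨a * b, SetLike.GradedMul.mul_mem ha hb, by simp⟩
  toDecomposition := DirectSum.Decomposition.ofAddHom _
    (QuotientAddGroup.lift I.toAddSubgroup (quotientDecomposeAux 𝒜 I)
      (fun _ hx => AddMonoidHom.mem_ker.mpr (quotientDecomposeAux_eq_zero 𝒜 I hI hx)))
    (by
      ext x
      obtain ⟨x, rfl⟩ := Ideal.Quotient.mk_surjective x
      change DirectSum.coeAddMonoidHom (quotientGrading 𝒜 I) (quotientDecomposeAux 𝒜 I x) =
        Ideal.Quotient.mk I x
      induction x using DirectSum.Decomposition.inductionOn 𝒜 with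
      | zero => simp
      | homogeneous m =>
        rw [quotientDecomposeAux_of_mem 𝒜 I m.2]
        simp
      | add a b ha hb => simp only [map_add, ha, hb])
    (by
      ext n x : 2
      obtain ⟨_, x, hx, rfl⟩ := x
      refine (congrArg _ (DirectSum.coeAddMonoidHom_of (quotientGrading 𝒜 I) n _)).trans ?_
      exact quotientDecomposeAux_of_mem 𝒜 I hx)

end QuotientGrading

/-! ### The double cover `w² = f` of the plane over a ring `R` -/

/-- Integral ternary forms of degree `d`. -/
abbrev Form (d : ℕ) : Type := homogeneousSubmodule (Fin 3) ℤ d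

namespace DoublePlane

/-- The weights of `x, y, z, w`. -/
abbrev wt : Fin 4 → ℕ := ![1, 1, 1, 3]

instance weightedGrading (R : Type) [CommRing R] :
    GradedAlgebra (weightedHomogeneousSubmodule R wt) := weightedGradedAlgebra R wt

/-- An integral ternary polynomial, read in `R[x, y, z] ⊆ R[x, y, z, w]`. -/
def toPoly (R : Type) [CommRing R] : MvPolynomial (Fin 3) ℤ →+* MvPolynomial (Fin 4) R :=
  (rename Fin.castSucc : MvPolynomial (Fin 3) R →ₐ[R] MvPolynomial (Fin 4) R).toRingHom.comp
    (MvPolynomial.map (Int.castRingHom R))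

theorem toPoly_mem (R : Type) [CommRing R] {d : ℕ} (q : Form d) :
    toPoly R q ∈ weightedHomogeneousSubmodule R wt d := by
  rw [mem_weightedHomogeneousSubmodule]
  intro m hm
  obtain ⟨u, rfl, hu⟩ := coeff_rename_ne_zero _ _ _ hm
  have hq : (q : MvPolynomial (Fin 3) ℤ).coeff u ≠ 0 := by
    intro h
    apply hu
    rw [coeff_map, h, map_zero]
  have h := q.2 hq
  rw [← h]
  rw [Finsupp.weight_apply, Finsupp.sum_mapDomain_index (by simp) (by intros; simp [add_mul]),
    Finsupp.weight_apply]
  refine Finsupp.sum_congr fun i _ => ?_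
  fin_cases i <;> simp [wt]

/-- The ideal `(w² - f)` of `R[x, y, z, w]`. -/
def relIdeal (R : Type) [CommRing R] (f : Form 6) : Ideal (MvPolynomial (Fin 4) R) :=
  Ideal.span {X 3 ^ 2 - toPoly R f}

theorem relIdeal_isHomogeneous (R : Type) [CommRing R] (f : Form 6) :
    (relIdeal R f).IsHomogeneous (weightedHomogeneousSubmodule R wt) := by
  apply Ideal.homogeneous_span
  rintro _ rfl
  refine ⟨6, ?_⟩
  refine Submodule.sub_mem _ ?_ (toPoly_mem R f)
  exact (isWeightedHomogeneous_X R wt 3).pow 2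

/-- The weighted homogeneous coordinate ring `R[x, y, z, w] / (w² - f)`. -/
abbrev CoordRing (R : Type) [CommRing R] (f : Form 6) : Type :=
  MvPolynomial (Fin 4) R ⧸ relIdeal R f

/-- Its grading: `x, y, z` have degree `1` and `w` has degree `3`. -/
abbrev grading (R : Type) [CommRing R] (f : Form 6) : ℕ → Submodule R (CoordRing R f) :=
  quotientGrading (weightedHomogeneousSubmodule R wt) (relIdeal R f)

instance gradedRing (R : Type) [CommRing R] (f : Form 6) : GradedRing (grading R f) :=
  quotientGradedRing _ _ (relIdeal_isHomogeneous R f)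

/-- The surface `w² = f(x, y, z)` over `R`, in the weighted projective space `ℙ(1, 1, 1, 3)`. -/
abbrev surface (R : Type) [CommRing R] (f : Form 6) : Scheme.{0} := Proj (grading R f)

/-- The class in the coordinate ring of an integral polynomial in `x, y, z`. -/
def coe (R : Type) [CommRing R] (f : Form 6) : MvPolynomial (Fin 3) ℤ →+* CoordRing R f :=
  (Ideal.Quotient.mk (relIdeal R f)).comp (toPoly R)

/-- The coordinate `w`. -/
def w (R : Type) [CommRing R] (f : Form 6) : CoordRing R f :=
  Ideal.Quotient.mk (relIdeal R f) (X 3)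

theorem coe_mem (R : Type) [CommRing R] (f : Form 6) {d : ℕ} (q : Form d) :
    coe R f q ∈ grading R f d :=
  ⟨_, toPoly_mem R q, rfl⟩

theorem w_mem (R : Type) [CommRing R] (f : Form 6) : w R f ∈ grading R f 3 :=
  ⟨_, isWeightedHomogeneous_X R wt 3, rfl⟩

/-- Reduction of coefficients along `φ : R → T`, as a homomorphism of graded rings. -/
def coeffMap {R T : Type} [CommRing R] [CommRing T] (φ : R →+* T) (f : Form 6) :
    GradedRingHom (grading R f) (grading T f) where
  toRingHom := Ideal.quotientMap (relIdeal T f) (MvPolynomial.map φ) (by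
    rw [relIdeal, Ideal.span_le, Set.singleton_subset_iff]
    apply Ideal.subset_span
    simp only [Set.mem_singleton_iff, map_sub, map_pow, map_X, toPoly, RingHom.comp_apply,
      AlgHom.toRingHom_eq_coe, RingHom.coe_coe, map_rename, map_map]
    rw [Subsingleton.elim (φ.comp (Int.castRingHom R)) (Int.castRingHom T)])
  map_mem := by
    rintro i _ ⟨a, ha, rfl⟩
    refine ⟨MvPolynomial.map φ a, ?_, rfl⟩
    intro m hm
    apply ha
    intro h
    apply hm
    rw [coeff_map, h, map_zero]

theorem irrelevant_le {R T : Type} [CommRing R] [CommRing T] (φ : R →+* T)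
    (hφ : Function.Surjective φ) (f : Form 6) :
    HomogeneousIdeal.irrelevant (grading T f) ≤
      (HomogeneousIdeal.irrelevant (grading R f)).map (coeffMap φ f) := by
  rw [HomogeneousIdeal.irrelevant_le]
  rintro i hi _ ⟨a, ha, rfl⟩
  obtain ⟨b, rfl⟩ := MvPolynomial.map_surjective φ hφ a
  have hb : MvPolynomial.map φ (weightedHomogeneousComponent wt i b) = MvPolynomial.map φ b := by
    rw [← weightedHomogeneousComponent_eq_self (w := wt) (n := i) (p := MvPolynomial.map φ b) ha]
    ext m
    classical
    simp only [coeff_map, coeff_weightedHomogeneousComponent]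
    split_ifs <;> simp
  have hmem : Ideal.Quotient.mk (relIdeal R f) (weightedHomogeneousComponent wt i b) ∈
      HomogeneousIdeal.irrelevant (grading R f) :=
    HomogeneousIdeal.mem_irrelevant_of_mem _ hi
      ⟨_, weightedHomogeneousComponent_isWeightedHomogeneous i b, rfl⟩
  have := Ideal.mem_map_of_mem (coeffMap φ f) hmem
  change Ideal.Quotient.mk (relIdeal T f) (MvPolynomial.map φ b) ∈ _
  rw [← hb]
  exact this

/-- For surjective `φ : R → T`, the closed immersion of the surface over `T` in the surface
over `R`; for `R = ℤ/p²` and `T = 𝔽_p` this is the inclusion `S_p ⊂ S_{p²}`. -/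
def incl {R T : Type} [CommRing R] [CommRing T] (φ : R →+* T) (hφ : Function.Surjective φ)
    (f : Form 6) : surface T f ⟶ surface R f :=
  Proj.map (coeffMap φ f) (irrelevant_le φ hφ f)

end DoublePlane

/-! ### Čech cohomology of the structure sheaf in degree two -/

namespace Cech

variable (X : Scheme.{0})

/-- Restriction of functions to a smaller open set. -/
def res {U V : X.Opens} (h : V ≤ U) : Γ(X, U) →+* Γ(X, V) := (X.presheaf.map (homOfLE h).op).hom

variable {ι : Type} (U : ι → X.Opens)

/-- Čech 1-cochains of `𝒪_X` for the family `U`. -/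
abbrev C1 : Type := ∀ a b, Γ(X, U a ⊓ U b)

/-- Čech 2-cochains. -/
abbrev C2 : Type := ∀ a b c, Γ(X, U a ⊓ U b ⊓ U c)

/-- Čech 3-cochains. -/
abbrev C3 : Type := ∀ a b c d, Γ(X, U a ⊓ U b ⊓ U c ⊓ U d)

/-- `(dβ)_{abc} = β_{bc} - β_{ac} + β_{ab}`. -/
def d1 : C1 X U →+ C2 X U where
  toFun β a b c :=
    res X (le_inf (inf_le_left.trans inf_le_right) inf_le_right) (β b c)
      - res X (le_inf (inf_le_left.trans inf_le_left) inf_le_right) (β a c)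
      + res X inf_le_left (β a b)
  map_zero' := by funext a b c; simp
  map_add' β γ := by funext a b c; simp only [Pi.add_apply, map_add]; ring

/-- `(dz)_{abce} = z_{bce} - z_{ace} + z_{abe} - z_{abc}`. -/
def d2 : C2 X U →+ C3 X U where
  toFun z a b c e :=
    res X (le_inf (le_inf (inf_le_left.trans (inf_le_left.trans inf_le_right))
        (inf_le_left.trans inf_le_right)) inf_le_right) (z b c e)
      - res X (le_inf (le_inf (inf_le_left.trans (inf_le_left.trans inf_le_left))
        (inf_le_left.trans inf_le_right)) inf_le_right) (z a c e)
      + res X (le_inf (inf_le_left.trans inf_le_left) inf_le_right) (z a b e)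
      - res X inf_le_left (z a b c)
  map_zero' := by funext a b c e; simp
  map_add' y z := by funext a b c e; simp only [Pi.add_apply, map_add]; ring

/-- The affine open subsets of `X`, as a covering of `X` indexed by itself. -/
abbrev aff : X.affineOpens → X.Opens := Subtype.val

/-- `H²(X, 𝒪_X)` of a separated scheme `X`, as Čech cohomology for the covering of `X` by all its
affine open subsets. -/
abbrev H2 : Type := (d2 X (aff X)).ker ⧸ (d1 X (aff X)).range.addSubgroupOf (d2 X (aff X)).ker

variable {X}

/-- The cochain `z` is a cocycle with class `θ`. -/
def Represents (z : C2 X (aff X)) (θ : H2 X) : Prop :=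
  ∃ hz : z ∈ (d2 X (aff X)).ker, QuotientAddGroup.mk ⟨z, hz⟩ = θ

end Cech

/-! ### The obstruction to lifting the invertible sheaf of a divisor -/

/-- Let `i : X ⟶ Y` be the inclusion of the locus `p = 0` in a flat `ℤ/p²`-scheme, and `I` the ideal
sheaf of an effective Cartier divisor `D` on `X`. A lifting datum consists of open sets `V a` of
`Y` whose traces `U a = i⁻¹ (V a)` form an affine open covering of `X`; local equations `s a` of
`D` on `U a`, so that `(s a)⁻¹` is a local generator of `𝒪(D)`; units `g a b` of `Y` on
`V a ∩ V b` lifting the transition functions `s a / s b = (s b)⁻¹ / (s a)⁻¹` of `𝒪(D)`; and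
functions `c a b e` on the triple intersections with `g a b * g b e = g a e * (1 + p * c a b e)`. -/
structure LiftingDatum {X Y : Scheme.{0}} (i : X ⟶ Y) (p : ℕ) (I : X.IdealSheafData) where
  /-- the index set of the covering -/
  ι : Type
  /-- the open sets of `Y` -/
  V : ι → Y.Opens
  affine : ∀ a, IsAffineOpen (i ⁻¹ᵁ V a)
  cover : ⨆ a, i ⁻¹ᵁ V a = ⊤
  /-- the local equations -/
  s : ∀ a, Γ(X, i ⁻¹ᵁ V a)
  span_s : ∀ a, Ideal.span {s a} = I.ideal ⟨i ⁻¹ᵁ V a, affine a⟩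
  regular : ∀ a, s a ∈ nonZeroDivisors Γ(X, i ⁻¹ᵁ V a)
  /-- the lifted transition functions -/
  g : ∀ a b, (Γ(Y, V a ⊓ V b))ˣ
  g_lifts : ∀ a b,
    (i.appLE (V a ⊓ V b) (i ⁻¹ᵁ V a ⊓ i ⁻¹ᵁ V b) le_rfl).hom (g a b) * Cech.res X inf_le_right (s b)
      = Cech.res X inf_le_left (s a)
  /-- the failure of the cocycle condition, divided by `p` -/
  c : Cech.C2 Y V
  c_spec : ∀ a b e,
    Cech.res Y (inf_le_left : V a ⊓ V b ⊓ V e ≤ V a ⊓ V b) (g a b)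
        * Cech.res Y (le_inf (inf_le_left.trans inf_le_right) inf_le_right :
            V a ⊓ V b ⊓ V e ≤ V b ⊓ V e) (g b e)
      = Cech.res Y (le_inf (inf_le_left.trans inf_le_left) inf_le_right :
            V a ⊓ V b ⊓ V e ≤ V a ⊓ V e) (g a e)
        * (1 + (p : Γ(Y, V a ⊓ V b ⊓ V e)) * c a b e)

/-- The covering `U a = i⁻¹ (V a)` of `X` by affine open sets. -/
def LiftingDatum.U {X Y : Scheme.{0}} {i : X ⟶ Y} {p : ℕ} {I : X.IdealSheafData}
    (D : LiftingDatum i p I) (a : D.ι) : X.affineOpens := ⟨i ⁻¹ᵁ D.V a, D.affine a⟩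

/-- `θ ∈ H²(X, 𝒪_X)` is the obstruction to lifting `𝒪(D)` from `X` to `Y`, that is, the image of
its class under the connecting homomorphism `Pic X = H¹(X, 𝒪_X^*) → H²(X, 𝒪_X)` of
`0 → 𝒪_X → 𝒪_Y^* → 𝒪_X^* → 0`, the first map being `x ↦ 1 + p x`: for some lifting datum, the
restriction of `θ` to the covering `U` is the class of the cocycle `c` restricted to `X`. -/
def IsObstruction {X Y : Scheme.{0}} (i : X ⟶ Y) (p : ℕ) (I : X.IdealSheafData)
    (θ : Cech.H2 X) : Prop :=
  ∃ (D : LiftingDatum i p I) (z : Cech.C2 X (Cech.aff X))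
    (β : Cech.C1 X (fun a => (D.U a : X.Opens))),
    Cech.Represents z θ ∧
    ∀ a b e, z (D.U a) (D.U b) (D.U e) =
      (i.appLE (D.V a ⊓ D.V b ⊓ D.V e) (D.U a ⊓ D.U b ⊓ D.U e) le_rfl).hom (D.c a b e)
        + Cech.d1 X (fun a => (D.U a : X.Opens)) β a b e

/-- `Z` is an irreducible component of the closed set `F`. -/
def IsComponentOf {X : Scheme.{0}} (Z F : Closeds X) : Prop :=
  Maximal (fun T : Closeds X => IsIrreducible (T : Set X) ∧ T ≤ F) Z

/-- For homogeneous elements `a, b` of the same degree, the function `a / b` on an open subset of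
`Proj` where `b` does not vanish. -/
def projFraction {A : Type} [CommRing A] {σ : Type} [SetLike σ A] [AddSubgroupClass σ A] (𝒜 : ℕ → σ)
    [GradedRing 𝒜] {n : ℕ} (a b : 𝒜 n) {U : (Proj 𝒜).Opens}
    (h : U ≤ Proj.basicOpen 𝒜 (b : A)) : Γ(Proj 𝒜, U) :=
  Cech.res (Proj 𝒜) h ((Proj.awayToSection 𝒜 (b : A)).hom
    (HomogeneousLocalization.mk ⟨n, a, b, Submonoid.mem_powers _⟩))

/-! ### Plane sextics modulo `p` and their tritangent lines -/

namespace DoublePlane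

/-- The reduction of `f` modulo `p` defines a nonsingular plane curve. For `p ≠ 2` this means that
the double cover `w² = f` is nonsingular modulo `p`. -/
def NonsingularMod (p : ℕ) [Fact p.Prime] (f : Form 6) : Prop :=
  ∀ v : Fin 3 → AlgebraicClosure (ZMod p), v ≠ 0 → aeval v (f : MvPolynomial (Fin 3) ℤ) = 0 →
    ∃ j, aeval v (pderiv j (f : MvPolynomial (Fin 3) ℤ)) ≠ 0

/-- `ℓ = 0` is a line modulo `p` which meets the curve `f = 0` with even multiplicity everywhere:
over an algebraic closure, the restriction of `f` to the line is the square of a cubic form. -/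
def IsTritangentMod (p : ℕ) [Fact p.Prime] (f : Form 6) (l : Form 1) : Prop :=
  MvPolynomial.map (Int.castRingHom (ZMod p)) (l : MvPolynomial (Fin 3) ℤ) ≠ 0 ∧
  ∃ g ∈ homogeneousSubmodule (Fin 3) (AlgebraicClosure (ZMod p)) 3,
    MvPolynomial.map (Int.castRingHom (AlgebraicClosure (ZMod p))) (l : MvPolynomial (Fin 3) ℤ) ∣
      MvPolynomial.map (Int.castRingHom (AlgebraicClosure (ZMod p))) (f : MvPolynomial (Fin 3) ℤ)
        - g ^ 2

/-- The closed subset of the surface over `R` where two elements of the coordinate ring vanish. -/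
def vanish (R : Type) [CommRing R] (f : Form 6) (a b : CoordRing R f) : Closeds (surface R f) :=
  (Proj.basicOpen (grading R f) a ⊔ Proj.basicOpen (grading R f) b).compl

/-- The forms of degree six in the ideal `(p, ℓ, f₃, f₅)` of `ℤ[x, y, z]`. -/
def sexticIdeal (p : ℕ) (l : Form 1) (f₃ : Form 3) (f₅ : Form 5) : AddSubgroup (Form 6) :=
  (Ideal.span {(p : MvPolynomial (Fin 3) ℤ), (l : MvPolynomial (Fin 3) ℤ),
    (f₃ : MvPolynomial (Fin 3) ℤ), (f₅ : MvPolynomial (Fin 3) ℤ)}).toAddSubgroup.comap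
      (homogeneousSubmodule (Fin 3) ℤ 6).subtype.toAddMonoidHom

/-- The affine open subset of the surface over `R` where the form `q` does not vanish. -/
def openOf (R : Type) [CommRing R] (f : Form 6) {d : ℕ} (hd : 0 < d) (q : Form d) :
    (surface R f).affineOpens :=
  ⟨Proj.basicOpen (grading R f) (coe R f q),
    Proj.isAffineOpen_basicOpen _ _ (coe_mem R f q) hd⟩

/-- The function `q w / (ℓ f₃ f₅)` on the open set `ℓ f₃ f₅ ≠ 0`, for a sextic form `q`. -/
def cechFraction (R : Type) [CommRing R] (f : Form 6) (l : Form 1) (f₃ : Form 3) (f₅ : Form 5)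
    (q : Form 6) :
    Γ(surface R f, (openOf R f one_pos l : (surface R f).Opens) ⊓
      openOf R f three_pos f₃ ⊓ openOf R f (Nat.succ_pos 4) f₅) :=
  projFraction (grading R f) (n := 9)
    ⟨coe R f q * w R f, SetLike.mul_mem_graded (coe_mem R f q) (w_mem R f)⟩
    ⟨coe R f l * coe R f f₃ * coe R f f₅, SetLike.mul_mem_graded
      (SetLike.mul_mem_graded (coe_mem R f l) (coe_mem R f f₃)) (coe_mem R f f₅)⟩
    (by rw [Proj.basicOpen_mul, Proj.basicOpen_mul]; exact le_rfl)

/-- The inclusion `S_p ⟶ S_{p²}`. -/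
def reductionIncl (p : ℕ) (f : Form 6) :
    surface (ZMod p) f ⟶ surface (ZMod (p ^ 2)) f :=
  incl (ZMod.castHom (dvd_pow_self p two_ne_zero) (ZMod p)) (ZMod.castHom_surjective _) f

end DoublePlane

end

open DoublePlane

/-! Modulo `p` the surface satisfies (w + εf₃)(w − εf₃) = ℓf₅, and the component is ℓ = w + εf₃ = 0.
Its local equation is 1 off the component, ℓ where w − εf₃ is invertible, and w + εf₃ where f₅ is
invertible. The quotients 1/ℓ, 1/(w + εf₃) and ℓ/(w + εf₃) = (w − εf₃)/f₅ make sense over ℤ/p²,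
where (w + εf₃)(w − εf₃) = ℓf₅ + pG. So the cocycle condition fails exactly by the factor 1 +
pG/(ℓf₅), and G/(ℓf₅) is an obstruction cocycle (`wAdd_mul_wSub`, `transForm_cocycle`,
`liftingDatum`).

This cocycle lives on the patches ℓ ≠ 0, f₃(w ± εf₃) ≠ 0, f₅ ≠ 0, which refine the covering by ℓ,
f₃, f₅. There it is cohomologous to −εGw/(2ℓf₃f₅), because G(εw ∓ f₃)/(ℓf₃f₅) = εG/(f₃(w ± εf₃)) is
regular where f₃(w ± εf₃) ≠ 0 (`exists_comparison`, `two_nsmul_sub_mem_range`). Division by 2 is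
possible since `p` is odd.

For three affine open sets, H² is the group of functions on the triple intersection modulo sums of
functions on the pairwise ones. The coordinate ring is free over k[x,y,z] with basis 1, w, so such a
function is (a + bw)/(ℓf₃f₅)^N with deg a = 9N and deg b = 9N − 3. Nonsingularity of the sextic
forbids a common zero of ℓ, f₃, f₅, hence (ℓ^N, f₃^N, f₅^N) is a complete intersection with socle
degree 9N − 3. The part a therefore splits completely, and b reduces to r(ℓf₃f₅)^(N−1) with a sextic
r that is unique modulo (ℓ, f₃, f₅) (`mem_span_pow`, `exists_sextic`, `mem_span_of_mul_pow_mem`).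
These facts come from restriction to the line, where they concern a coprime pair of binary forms.

Since `H2` uses all affine open sets, a Leray comparison is needed: Čech cocycles on affine sets are
coboundaries (`exists_primitive_one`, `exists_primitive_two`), so a finite affine covering computes
`H2` (`mem_range_d1_of_subfamily`, `exists_extend_cocycle`). Independence of the lifting datum is
`IsObstruction.unique`: two data differ by units, which lift, and the error is a coboundary.

Finally, f₃ and f₅ exist because the sextic restricted to the line must be a square over 𝔽_p:
otherwise the coordinate ring of the pull-back is a quadratic extension that is a domain, and the
pull-back is irreducible (`isDomain_of_not_isSquare`, `exists_eq_sq`). -/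

noncomputable section

/-! ### Čech cochains on a separated scheme -/

namespace Cech

variable {X : Scheme.{0}}

/-- Inclusions between intersections of open sets, proved automatically. -/
theorem leI {U V : X.Opens}
    (h : V ≤ U := by intro x hx; simp only [Opens.mem_inf] at hx ⊢; tauto) : V ≤ U := h

@[simp] theorem res_res {U V W : X.Opens} (h : V ≤ U) (h' : W ≤ V) (x : Γ(X, U)) :
    res X h' (res X h x) = res X (h'.trans h) x := by
  simp only [res]
  rw [← CommRingCat.comp_apply, ← X.presheaf.map_comp]
  rfl

@[simp] theorem res_self {U : X.Opens} (h : U ≤ U) (x : Γ(X, U)) : res X h x = x := by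
  simp [res]

theorem eq_of_res {ι : Type} {U : ι → X.Opens} {V : X.Opens} (hUV : ∀ i, U i ≤ V)
    (hV : V ≤ ⨆ i, U i) {x y : Γ(X, V)} (h : ∀ i, res X (hUV i) x = res X (hUV i) y) : x = y :=
  X.sheaf.eq_of_locally_eq' U V (fun i => homOfLE (hUV i)) hV x y h

theorem exists_glue {ι : Type} {U : ι → X.Opens} {V : X.Opens} (hUV : ∀ i, U i ≤ V)
    (hV : V ≤ ⨆ i, U i) (x : ∀ i, Γ(X, U i))
    (h : ∀ i j, res X inf_le_left (x i) = res X (inf_le_right : U i ⊓ U j ≤ U j) (x j)) :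
    ∃ y : Γ(X, V), ∀ i, res X (hUV i) y = x i :=
  (X.sheaf.existsUnique_gluing' U V (fun i => homOfLE (hUV i)) hV x h).exists

/-- Sections over `O ∩ D(f)` extend to the affine open set `O` after multiplication by a power
of `f`. -/
theorem exists_extend {O W V : X.Opens} (hO : IsAffineOpen O) (hOW : O ≤ W) (f : Γ(X, W))
    (hVO : V ≤ O) (hV : O ⊓ X.basicOpen f ≤ V) (hVf : V ≤ X.basicOpen f) (h : Γ(X, V)) :
    ∃ N, ∀ n ≥ N, ∃ y : X.presheaf.obj (.op O), res X hVO y = res X (hVO.trans hOW) f ^ n * h := by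
  have e : V = X.basicOpen (res X hOW f) := by
    rw [res, X.basicOpen_res]
    exact le_antisymm (le_inf hVO hVf) hV
  let _ : Algebra Γ(X, O) Γ(X, V) := (res X hVO).toAlgebra
  have : IsLocalization.Away (res X hOW f) Γ(X, V) :=
    hO.isLocalization_of_eq_basicOpen (res X hOW f) (homOfLE hVO) e
  obtain ⟨N, y, hy⟩ := IsLocalization.Away.surj (res X hOW f) h
  refine ⟨N, fun n hn => ⟨res X hOW f ^ (n - N) * y, ?_⟩⟩
  have hy' : h * res X (hVO.trans hOW) f ^ N = res X hVO y := by
    simpa [RingHom.algebraMap_toAlgebra] using hy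
  rw [map_mul, ← hy', map_pow, res_res, mul_left_comm, ← pow_add, Nat.sub_add_cancel hn, mul_comm]

/-- A section over the affine open set `O` which vanishes on `O ∩ D(f)` is annihilated by a power
of `f`. -/
theorem exists_kill {O W V : X.Opens} (hO : IsAffineOpen O) (hOW : O ≤ W) (f : Γ(X, W))
    (hVO : V ≤ O) (hV : O ⊓ X.basicOpen f ≤ V) (hVf : V ≤ X.basicOpen f) (x : Γ(X, O))
    (hx : res X hVO x = 0) :
    ∃ N, ∀ n ≥ N, res X hOW f ^ n * x = 0 := by
  have e : V = X.basicOpen (res X hOW f) := by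
    rw [res, X.basicOpen_res]
    exact le_antisymm (le_inf hVO hVf) hV
  let _ : Algebra Γ(X, O) Γ(X, V) := (res X hVO).toAlgebra
  have : IsLocalization.Away (res X hOW f) Γ(X, V) :=
    hO.isLocalization_of_eq_basicOpen (res X hOW f) (homOfLE hVO) e
  obtain ⟨N, hN⟩ := IsLocalization.Away.exists_of_eq (S := Γ(X, V)) (res X hOW f) (a := x) (b := 0)
    (by simpa [RingHom.algebraMap_toAlgebra] using hx)
  refine ⟨N, fun n hn => ?_⟩
  rw [← Nat.sub_add_cancel hn, pow_add, mul_assoc, hN]; simp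

/-- The radical of `I` contains every `f` whose basic open set lies in a member of the covering, and
these basic open sets cover `W`. This is how local primitives are patched below. -/
theorem eq_top_of_pow_mem {W : X.Opens} (hW : IsAffineOpen W) (I : Ideal Γ(X, W)) {ι : Type}
    {U : ι → X.Opens} (hU : W ≤ ⨆ i, U i)
    (h : ∀ i (f : Γ(X, W)), X.basicOpen f ≤ U i → ∃ n, f ^ n ∈ I) : I = ⊤ := by
  rw [← Ideal.radical_eq_top, ← Ideal.span_eq I.radical, ← hW.iSup_basicOpen_eq_self_iff]
  refine le_antisymm (iSup_le fun f => X.basicOpen_le _) fun x hx => ?_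
  obtain ⟨i, hi⟩ := Opens.mem_iSup.mp (hU hx)
  obtain ⟨f, hf, hxf⟩ := hW.exists_basicOpen_le (V := U i) ⟨x, hi⟩ hx
  exact Opens.mem_iSup.mpr ⟨⟨f, h i f hf⟩, hxf⟩

theorem exists_bound {κ : Type} [Finite κ] {P : κ → ℕ → Prop}
    (h : ∀ k, ∃ N, ∀ n ≥ N, P k n) : ∃ N, ∀ n ≥ N, ∀ k, P k n := by
  simpa [Filter.eventually_atTop] using
    (Filter.eventually_all (l := Filter.atTop)).mpr fun k => Filter.eventually_atTop.mpr (h k)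

/-! ### Vanishing of Čech H¹ and H² on affine open sets. -/

section Vanishing

variable [X.IsSeparated] {ι : Type} [Finite ι] {W : X.Opens} (hW : IsAffineOpen W)
  (U : ι → X.Opens) (hU : ∀ i, IsAffineOpen (U i)) (hcov : W ≤ ⨆ i, U i)

include hW hU hcov

/-- Čech 1-cocycles on an affine open set are coboundaries. -/
theorem exists_primitive_one (η : ∀ i j, Γ(X, W ⊓ U i ⊓ U j))
    (hη : ∀ i j k, res X (leI : W ⊓ U i ⊓ U j ⊓ U k ≤ _) (η j k) - res X leI (η i k)
      + res X leI (η i j) = 0) :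
    ∃ ρ : ∀ i, Γ(X, W ⊓ U i), ∀ i j, η i j = res X leI (ρ j) - res X leI (ρ i) := by
  have hW2 i j : IsAffineOpen (W ⊓ U i ⊓ U j) := (hW.inf (hU i)).inf (hU j)
  -- The functions whose product with `η` is a coboundary form an ideal; it is enough to find in it
  -- a power of each `f` with `D(f) ⊆ U m`.
  let I : Ideal Γ(X, W) :=
    { carrier := {g | ∃ ρ : ∀ i, Γ(X, W ⊓ U i), ∀ i j,
        res X leI g * η i j = res X leI (ρ j) - res X leI (ρ i)}
      zero_mem' := ⟨fun i => 0, by simp⟩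
      add_mem' := by
        rintro a b ⟨ρ, hρ⟩ ⟨σ, hσ⟩
        refine ⟨fun i => ρ i + σ i, fun i j => ?_⟩
        simp only [map_add]
        linear_combination hρ i j + hσ i j
      smul_mem' := by
        rintro a b ⟨ρ, hρ⟩
        refine ⟨fun i => res X leI a * ρ i, fun i j => ?_⟩
        simp only [map_mul, smul_eq_mul, res_res]
        linear_combination res X (leI : W ⊓ U i ⊓ U j ≤ W) a * hρ i j }
  have hI : I = ⊤ := by
    refine eq_top_of_pow_mem hW I hcov fun m f hf => ?_
    have hfW : X.basicOpen f ≤ W := X.basicOpen_le f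
    let V i := W ⊓ U i ⊓ X.basicOpen f
    have hV i : V i ≤ W ⊓ U m ⊓ U i := fun x hx => ⟨⟨hx.1.1, hf hx.2⟩, hx.1.2⟩
    -- Over `D(f) ⊆ U m` the cochain `i ↦ η m i` is a primitive of `η`; a power of `f` times it
    -- extends to `W ⊓ U i`.
    obtain ⟨N, hN⟩ := exists_bound fun i => exists_extend (hW.inf (hU i)) inf_le_left f
      (V := V i) inf_le_left le_rfl inf_le_right (res X (hV i) (η m i))
    choose u hu using hN N le_rfl
    -- The extensions satisfy the equation only over `D(f)`; a further power of `f` kills the error.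
    have key i j : ∃ M, ∀ n ≥ M, res X (leI : W ⊓ U i ⊓ U j ≤ W) f ^ n *
        (res X leI f ^ N * η i j - (res X leI (u j) - res X leI (u i))) = 0 := by
      refine exists_kill (hW2 i j) leI f (V := W ⊓ U i ⊓ U j ⊓ X.basicOpen f) inf_le_left le_rfl
        inf_le_right _ ?_
      have h1 := congrArg (res X (leI : W ⊓ U i ⊓ U j ⊓ X.basicOpen f ≤ V i)) (hu i)
      have h2 := congrArg (res X (leI : W ⊓ U i ⊓ U j ⊓ X.basicOpen f ≤ V j)) (hu j)
      have h3 := congrArg (res X (show W ⊓ U i ⊓ U j ⊓ X.basicOpen f ≤ W ⊓ U m ⊓ U i ⊓ U j from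
        fun x hx => ⟨⟨⟨hx.1.1.1, hf hx.2⟩, hx.1.1.2⟩, hx.1.2⟩)) (hη m i j)
      simp only [map_mul, map_pow, map_sub, map_add, map_zero, res_res] at h1 h2 h3 ⊢
      linear_combination h1 - h2 + res X (leI : W ⊓ U i ⊓ U j ⊓ X.basicOpen f ≤ W) f ^ N * h3
    obtain ⟨M, hM⟩ := exists_bound fun ij : ι × ι => key ij.1 ij.2
    refine ⟨M + N, fun i => res X leI f ^ M * u i, fun i j => ?_⟩
    have := hM M le_rfl (i, j)
    simp only [map_mul, map_pow, res_res]
    linear_combination this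
  obtain ⟨ρ, hρ⟩ := (Ideal.eq_top_iff_one I).mp hI
  exact ⟨ρ, fun i j => by simpa using hρ i j⟩

/-- Čech 2-cocycles on an affine open set are coboundaries. -/
theorem exists_primitive_two (γ : ∀ i j k, Γ(X, W ⊓ U i ⊓ U j ⊓ U k))
    (hγ : ∀ i j k l, res X (leI : W ⊓ U i ⊓ U j ⊓ U k ⊓ U l ≤ _) (γ j k l) - res X leI (γ i k l)
      + res X leI (γ i j l) - res X leI (γ i j k) = 0) :
    ∃ η : ∀ i j, Γ(X, W ⊓ U i ⊓ U j), ∀ i j k,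
      γ i j k = res X leI (η j k) - res X leI (η i k) + res X leI (η i j) := by
  have hW2 i j : IsAffineOpen (W ⊓ U i ⊓ U j) := (hW.inf (hU i)).inf (hU j)
  have hW3 i j k : IsAffineOpen (W ⊓ U i ⊓ U j ⊓ U k) := (hW2 i j).inf (hU k)
  let I : Ideal Γ(X, W) :=
    { carrier := {g | ∃ η : ∀ i j, Γ(X, W ⊓ U i ⊓ U j), ∀ i j k,
        res X leI g * γ i j k = res X leI (η j k) - res X leI (η i k) + res X leI (η i j)}
      zero_mem' := ⟨fun i j => 0, by simp⟩
      add_mem' := by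
        rintro a b ⟨ρ, hρ⟩ ⟨σ, hσ⟩
        refine ⟨fun i j => ρ i j + σ i j, fun i j k => ?_⟩
        simp only [map_add]
        linear_combination hρ i j k + hσ i j k
      smul_mem' := by
        rintro a b ⟨ρ, hρ⟩
        refine ⟨fun i j => res X leI a * ρ i j, fun i j k => ?_⟩
        simp only [map_mul, smul_eq_mul, res_res]
        linear_combination res X (leI : W ⊓ U i ⊓ U j ⊓ U k ≤ W) a * hρ i j k }
  have hI : I = ⊤ := by
    refine eq_top_of_pow_mem hW I hcov fun m f hf => ?_
    have hfW : X.basicOpen f ≤ W := X.basicOpen_le f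
    let V i j := W ⊓ U i ⊓ U j ⊓ X.basicOpen f
    have hV i j : V i j ≤ W ⊓ U m ⊓ U i ⊓ U j :=
      fun x hx => ⟨⟨⟨hx.1.1.1, hf hx.2⟩, hx.1.1.2⟩, hx.1.2⟩
    -- As for 1-cocycles, with `γ m i j` as the primitive over `D(f) ⊆ U m`.
    obtain ⟨N, hN⟩ := exists_bound fun ij : ι × ι => exists_extend (hW2 ij.1 ij.2) leI f
      (V := V ij.1 ij.2) inf_le_left le_rfl inf_le_right (res X (hV _ _) (γ m ij.1 ij.2))
    choose u hu using hN N le_rfl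
    have key i j k : ∃ M, ∀ n ≥ M, res X (leI : W ⊓ U i ⊓ U j ⊓ U k ≤ W) f ^ n *
        (res X leI f ^ N * γ i j k -
          (res X leI (u (j, k)) - res X leI (u (i, k)) + res X leI (u (i, j)))) = 0 := by
      refine exists_kill (hW3 i j k) leI f (V := W ⊓ U i ⊓ U j ⊓ U k ⊓ X.basicOpen f) inf_le_left
        le_rfl inf_le_right _ ?_
      have h1 := congrArg (res X (leI : W ⊓ U i ⊓ U j ⊓ U k ⊓ X.basicOpen f ≤
        W ⊓ U i ⊓ U j ⊓ X.basicOpen f)) (hu (i, j))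
      have h2 := congrArg (res X (leI : W ⊓ U i ⊓ U j ⊓ U k ⊓ X.basicOpen f ≤
        W ⊓ U i ⊓ U k ⊓ X.basicOpen f)) (hu (i, k))
      have h3 := congrArg (res X (leI : W ⊓ U i ⊓ U j ⊓ U k ⊓ X.basicOpen f ≤
        W ⊓ U j ⊓ U k ⊓ X.basicOpen f)) (hu (j, k))
      have h4 := congrArg (res X (show W ⊓ U i ⊓ U j ⊓ U k ⊓ X.basicOpen f ≤
        W ⊓ U m ⊓ U i ⊓ U j ⊓ U k from
        fun x hx => ⟨⟨⟨⟨hx.1.1.1.1, hf hx.2⟩, hx.1.1.1.2⟩, hx.1.1.2⟩, hx.1.2⟩)) (hγ m i j k)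
      simp only [map_mul, map_pow, map_sub, map_add, map_zero, res_res] at h1 h2 h3 h4 ⊢
      linear_combination - h1 + h2 - h3 +
        res X (leI : W ⊓ U i ⊓ U j ⊓ U k ⊓ X.basicOpen f ≤ W) f ^ N * h4
    obtain ⟨M, hM⟩ := exists_bound fun ij : ι × ι × ι => key ij.1 ij.2.1 ij.2.2
    refine ⟨M + N, fun i j => res X leI f ^ M * u (i, j), fun i j k => ?_⟩
    have := hM M le_rfl (i, j, k)
    simp only [map_mul, map_pow, res_res]
    linear_combination this
  obtain ⟨ρ, hρ⟩ := (Ideal.eq_top_iff_one I).mp hI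
  exact ⟨ρ, fun i j k => by simpa using hρ i j k⟩

end Vanishing

end Cech

end

/-! ### Comparison of the Čech cohomology of different affine families. -/

noncomputable section

namespace Cech

variable {X : Scheme.{0}} {J : Type} {W : J → X.Opens}

theorem mem_ker_d2 {z : C2 X W} : z ∈ (d2 X W).ker ↔ ∀ a b c e,
    res X (leI : W a ⊓ W b ⊓ W c ⊓ W e ≤ _) (z b c e) - res X leI (z a c e)
      + res X leI (z a b e) - res X leI (z a b c) = 0 := by
  rw [AddMonoidHom.mem_ker]
  exact ⟨fun h a b c e => congrFun (congrFun (congrFun (congrFun h a) b) c) e,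
    fun h => by funext a b c e; exact h a b c e⟩

theorem mem_range_d1 {z : C2 X W} : z ∈ (d1 X W).range ↔ ∃ β : C1 X W, ∀ a b c,
    z a b c = res X leI (β b c) - res X leI (β a c) + res X leI (β a b) := by
  rw [AddMonoidHom.mem_range]
  refine exists_congr fun β => ⟨fun h a b c => ?_, fun h => ?_⟩
  · rw [← h]; rfl
  · funext a b c; rw [h]; rfl

theorem cocycle_res {z : C2 X W} (hz : z ∈ (d2 X W).ker) (a b c e : J) {V : X.Opens}
    (h1 : V ≤ W b ⊓ W c ⊓ W e) (h2 : V ≤ W a ⊓ W c ⊓ W e) (h3 : V ≤ W a ⊓ W b ⊓ W e)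
    (h4 : V ≤ W a ⊓ W b ⊓ W c) :
    res X h1 (z b c e) - res X h2 (z a c e) + res X h3 (z a b e) - res X h4 (z a b c) = 0 := by
  simpa using congrArg (res X (show V ≤ W a ⊓ W b ⊓ W c ⊓ W e from
    fun x hx => ⟨h4 hx, (h1 hx).2⟩)) (mem_ker_d2.mp hz a b c e)

theorem range_d1_le_ker_d2 : (d1 X W).range ≤ (d2 X W).ker := by
  intro z hz
  obtain ⟨β, hβ⟩ := mem_range_d1.mp hz
  refine mem_ker_d2.mpr fun a b c e => ?_
  simp only [hβ, map_add, map_sub, res_res]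
  ring

/-- A 2-cocycle for a family of affine open sets is a coboundary if its restriction to a finite
covering subfamily is one. -/
theorem mem_range_d1_of_subfamily [X.IsSeparated] {ι : Type} [Finite ι]
    (hW : ∀ a, IsAffineOpen (W a)) (σ : ι → J) (hcov : ⨆ i, W (σ i) = ⊤) {z : C2 X W}
    (hz : z ∈ (d2 X W).ker)
    (h : (fun i j k => z (σ i) (σ j) (σ k)) ∈ (d1 X (fun i => W (σ i))).range) :
    z ∈ (d1 X W).range := by
  obtain ⟨β, hβ⟩ := mem_range_d1.mp h
  have hβ' (i j k : ι) {V : X.Opens} (hV : V ≤ W (σ i) ⊓ W (σ j) ⊓ W (σ k)) :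
      res X hV (z (σ i) (σ j) (σ k)) = res X (hV.trans leI) (β j k)
        - res X (hV.trans leI) (β i k) + res X (hV.trans leI) (β i j) := by
    rw [hβ i j k]; simp
  -- For fixed `a`, the cochain `z a i j - β i j` is a 1-cocycle on the affine set `W a`.
  have step a : ∃ ρ : ∀ i, Γ(X, W a ⊓ W (σ i)), ∀ i j,
      z a (σ i) (σ j) - res X leI (β i j) = res X leI (ρ j) - res X leI (ρ i) := by
    refine exists_primitive_one (hW a) (fun i => W (σ i)) (fun i => hW _) (by rw [hcov]; exact le_top)
      (fun i j => z a (σ i) (σ j) - res X leI (β i j)) fun i j k => ?_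
    have h1 := cocycle_res hz a (σ i) (σ j) (σ k)
      (V := W a ⊓ W (σ i) ⊓ W (σ j) ⊓ W (σ k)) leI leI leI leI
    rw [hβ'] at h1
    simp only [map_sub, res_res]
    linear_combination -h1
  choose ρ hρ using step
  -- The primitive on `W a ⊓ W b` is given on each `W (σ i)` by a formula whose independence of `i`
  -- is the cocycle identity at `(a, b, i, j)`.
  have glue a b : ∃ y : Γ(X, W a ⊓ W b), ∀ i, res X (leI : W a ⊓ W b ⊓ W (σ i) ≤ W a ⊓ W b) y =
      z a b (σ i) + res X leI (ρ b i) - res X leI (ρ a i) := by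
    refine exists_glue (U := fun i => W a ⊓ W b ⊓ W (σ i)) (fun i => leI)
      (by rw [← inf_iSup_eq, hcov, inf_top_eq]) _ fun i j => ?_
    have h1 := cocycle_res hz a b (σ i) (σ j)
      (V := (W a ⊓ W b ⊓ W (σ i)) ⊓ (W a ⊓ W b ⊓ W (σ j))) leI leI leI leI
    have h2 := congrArg (res X (leI : (W a ⊓ W b ⊓ W (σ i)) ⊓ (W a ⊓ W b ⊓ W (σ j)) ≤ _)) (hρ a i j)
    have h3 := congrArg (res X (leI : (W a ⊓ W b ⊓ W (σ i)) ⊓ (W a ⊓ W b ⊓ W (σ j)) ≤ _)) (hρ b i j)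
    simp only [map_sub, map_add, res_res] at h1 h2 h3 ⊢
    linear_combination -h1 - h2 + h3
  choose β' hβ' using glue
  refine mem_range_d1.mpr ⟨β', fun a b c => ?_⟩
  refine eq_of_res (U := fun i => W a ⊓ W b ⊓ W c ⊓ W (σ i)) (fun i => inf_le_left)
    (by rw [← inf_iSup_eq, hcov, inf_top_eq]) fun i => ?_
  have h1 := cocycle_res hz a b c (σ i) (V := W a ⊓ W b ⊓ W c ⊓ W (σ i)) leI leI leI leI
  have h2 := congrArg (res X (leI : W a ⊓ W b ⊓ W c ⊓ W (σ i) ≤ _)) (hβ' a b i)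
  have h3 := congrArg (res X (leI : W a ⊓ W b ⊓ W c ⊓ W (σ i) ≤ _)) (hβ' a c i)
  have h4 := congrArg (res X (leI : W a ⊓ W b ⊓ W c ⊓ W (σ i) ≤ _)) (hβ' b c i)
  simp only [map_sub, map_add, res_res] at h1 h2 h3 h4 ⊢
  linear_combination -h1 - h2 + h3 - h4

/-- A 2-cocycle for a finite affine covering extends, up to a coboundary, to every family of
affine open sets which contains the covering. -/
theorem exists_extend_cocycle [X.IsSeparated] {ι : Type} [Finite ι]
    (hW : ∀ a, IsAffineOpen (W a)) (σ : ι → J) (hcov : ⨆ i, W (σ i) = ⊤)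
    {γ : C2 X (fun i => W (σ i))} (hγ : γ ∈ (d2 X (fun i => W (σ i))).ker) :
    ∃ z ∈ (d2 X W).ker,
      (fun i j k => z (σ i) (σ j) (σ k) - γ i j k) ∈ (d1 X (fun i => W (σ i))).range := by
  have hcov' (V : X.Opens) : V ≤ ⨆ i, W (σ i) := by rw [hcov]; exact le_top
  -- Staircase of the double complex: on `W a` the cocycle `γ` is the coboundary of `η a`, on `W a ⊓
  -- W b` the difference `η b - η a` is the coboundary of `ρ a b`, and the alternating sum of the
  -- `ρ` over a triple no longer depends on `i`.
  have step1 a : ∃ η : ∀ i j, Γ(X, W a ⊓ W (σ i) ⊓ W (σ j)), ∀ i j k,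
      res X leI (γ i j k) = res X (leI : W a ⊓ W (σ i) ⊓ W (σ j) ⊓ W (σ k) ≤ _) (η j k)
        - res X leI (η i k) + res X leI (η i j) := by
    refine exists_primitive_two (hW a) (fun i => W (σ i)) (fun i => hW _) (hcov' _)
      (fun i j k => res X leI (γ i j k)) fun i j k l => ?_
    have h1 := cocycle_res hγ i j k l
      (V := W a ⊓ W (σ i) ⊓ W (σ j) ⊓ W (σ k) ⊓ W (σ l)) leI leI leI leI
    simpa using h1
  choose η hη using step1
  have step2 a b : ∃ ρ : ∀ i, Γ(X, W a ⊓ W b ⊓ W (σ i)), ∀ i j,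
      res X (leI : W a ⊓ W b ⊓ W (σ i) ⊓ W (σ j) ≤ _) (η b i j) - res X leI (η a i j)
        = res X leI (ρ j) - res X leI (ρ i) := by
    refine exists_primitive_one ((hW a).inf (hW b)) (fun i => W (σ i)) (fun i => hW _) (hcov' _)
      (fun i j => res X leI (η b i j) - res X leI (η a i j)) fun i j k => ?_
    have h1 := congrArg (res X (leI : W a ⊓ W b ⊓ W (σ i) ⊓ W (σ j) ⊓ W (σ k) ≤ _)) (hη a i j k)
    have h2 := congrArg (res X (leI : W a ⊓ W b ⊓ W (σ i) ⊓ W (σ j) ⊓ W (σ k) ≤ _)) (hη b i j k)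
    simp only [map_sub, map_add, res_res] at h1 h2 ⊢
    linear_combination h1 - h2
  choose ρ hρ using step2
  have glue a b c : ∃ y : Γ(X, W a ⊓ W b ⊓ W c), ∀ i,
      res X (leI : W a ⊓ W b ⊓ W c ⊓ W (σ i) ≤ W a ⊓ W b ⊓ W c) y =
      res X leI (ρ b c i) - res X leI (ρ a c i) + res X leI (ρ a b i) := by
    refine exists_glue (U := fun i => W a ⊓ W b ⊓ W c ⊓ W (σ i)) (fun i => leI)
      (by rw [← inf_iSup_eq, hcov, inf_top_eq]) _ fun i j => ?_
    have h (a' b') (hab : W a ⊓ W b ⊓ W c ≤ W a' ⊓ W b') := congrArg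
      (res X (show (W a ⊓ W b ⊓ W c ⊓ W (σ i)) ⊓ (W a ⊓ W b ⊓ W c ⊓ W (σ j)) ≤
        W a' ⊓ W b' ⊓ W (σ i) ⊓ W (σ j) from
        fun x hx => ⟨⟨hab hx.1.1, hx.1.2⟩, hx.2.2⟩)) (hρ a' b' i j)
    have h1 := h b c leI
    have h2 := h a c leI
    have h3 := h a b leI
    simp only [map_sub, map_add, res_res] at h1 h2 h3 ⊢
    linear_combination h1 - h2 + h3
  choose y hy using glue
  have hy' (a b c : J) (i : ι) {V : X.Opens} (h : V ≤ W a ⊓ W b ⊓ W c) (hi : V ≤ W (σ i)) :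
      res X h (y a b c) =
        res X (show V ≤ W b ⊓ W c ⊓ W (σ i) from fun x hx => ⟨⟨(h hx).1.2, (h hx).2⟩, hi hx⟩)
          (ρ b c i)
        - res X (show V ≤ W a ⊓ W c ⊓ W (σ i) from fun x hx => ⟨⟨(h hx).1.1, (h hx).2⟩, hi hx⟩)
          (ρ a c i)
        + res X (show V ≤ W a ⊓ W b ⊓ W (σ i) from fun x hx => ⟨(h hx).1, hi hx⟩) (ρ a b i) := by
    simpa using congrArg (res X (le_inf h hi)) (hy a b c i)
  -- The sign comes from the staircase. On the subfamily, the cochain relating `-y` to `γ` is read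
  -- off from `ρ` and `η` at repeated indices.
  refine ⟨-y, neg_mem (mem_ker_d2.mpr fun a b c e => ?_), mem_range_d1.mpr
    ⟨fun i j => -(res X leI (ρ (σ i) (σ j) i) + res X leI (η (σ j) i j)), fun i j k => ?_⟩⟩
  · refine eq_of_res (U := fun i => W a ⊓ W b ⊓ W c ⊓ W e ⊓ W (σ i)) (fun i => inf_le_left)
      (by rw [← inf_iSup_eq, hcov, inf_top_eq]) fun i => ?_
    simp only [map_sub, map_add, map_zero, res_res]
    rw [hy' _ _ _ i _ leI, hy' _ _ _ i _ leI, hy' _ _ _ i _ leI, hy' _ _ _ i _ leI]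
    ring
  · have h1 := hy' (σ i) (σ j) (σ k) i le_rfl leI
    have h2 := congrArg (res X (leI : W (σ i) ⊓ W (σ j) ⊓ W (σ k) ≤ _)) (hη (σ k) i j k)
    have h3 := congrArg (res X (leI : W (σ i) ⊓ W (σ j) ⊓ W (σ k) ≤ _)) (hρ (σ j) (σ k) i j)
    simp only [map_sub, map_add, map_neg, res_res, res_self, Pi.neg_apply] at h1 h2 h3 ⊢
    linear_combination -h1 - h2 - h3

/-- Restrictions of a 2-cocycle along two refinement maps are cohomologous. -/
theorem refine_mem_range_d1 {K : Type} (α τ : K → J) (h : ∀ k, W (α k) ≤ W (τ k)) {z : C2 X W}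
    (hz : z ∈ (d2 X W).ker) :
    (fun a b c => res X (inf_le_inf (inf_le_inf (h a) (h b)) (h c)) (z (τ a) (τ b) (τ c))
      - z (α a) (α b) (α c)) ∈ (d1 X (fun k => W (α k))).range := by
  have e1 (a b) : W (α a) ⊓ W (α b) ≤ W (α a) ⊓ W (τ a) ⊓ W (τ b) :=
    fun x hx => ⟨⟨hx.1, h _ hx.1⟩, h _ hx.2⟩
  have e2 (a b) : W (α a) ⊓ W (α b) ≤ W (α a) ⊓ W (α b) ⊓ W (τ b) :=
    fun x hx => ⟨⟨hx.1, hx.2⟩, h _ hx.2⟩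
  -- The prism homotopy between the index maps `α` and `τ`.
  refine mem_range_d1.mpr ⟨fun a b => res X (e1 a b) (z (α a) (τ a) (τ b))
    - res X (e2 a b) (z (α a) (α b) (τ b)), fun a b c => ?_⟩
  let V := W (α a) ⊓ W (α b) ⊓ W (α c)
  have ha : V ≤ W (α a) := fun x hx => hx.1.1
  have hb : V ≤ W (α b) := fun x hx => hx.1.2
  have hc : V ≤ W (α c) := fun x hx => hx.2
  have ha' := ha.trans (h a)
  have hb' := hb.trans (h b)
  have hc' := hc.trans (h c)
  have h1 := cocycle_res hz (α a) (α b) (α c) (τ c) (V := V) (le_inf (le_inf hb hc) hc')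
    (le_inf (le_inf ha hc) hc') (le_inf (le_inf ha hb) hc') (le_inf (le_inf ha hb) hc)
  have h2 := cocycle_res hz (α a) (α b) (τ b) (τ c) (V := V) (le_inf (le_inf hb hb') hc')
    (le_inf (le_inf ha hb') hc') (le_inf (le_inf ha hb) hc') (le_inf (le_inf ha hb) hb')
  have h3 := cocycle_res hz (α a) (τ a) (τ b) (τ c) (V := V) (le_inf (le_inf ha' hb') hc')
    (le_inf (le_inf ha hb') hc') (le_inf (le_inf ha ha') hc') (le_inf (le_inf ha ha') hb')
  simp only [map_sub, res_res, V, res_self] at h1 h2 h3 ⊢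
  linear_combination h1 - h2 + h3

end Cech

end

/-! ### Alternating cochains for three open sets. -/

noncomputable section

namespace Cech

variable {X : Scheme.{0}}

/-- The sign of the triple `(i, j, k)`, zero if two entries agree. -/
def triSign (i j k : Fin 3) : ℤ :=
  -- The Vandermonde product of three distinct elements of `{0, 1, 2}` is `±2`.
  (((j : ℕ) : ℤ) - (i : ℕ)) * (((k : ℕ) : ℤ) - (i : ℕ)) * (((k : ℕ) : ℤ) - (j : ℕ)) / 2

theorem triSign_cocycle : ∀ a b c e : Fin 3,
    triSign b c e - triSign a c e + triSign a b e - triSign a b c = 0 := by decide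

theorem le_of_triSign {U : Fin 3 → X.Opens} {V : X.Opens} : ∀ {i j k : Fin 3},
    triSign i j k ≠ 0 → V ≤ U i → V ≤ U j → V ≤ U k → V ≤ U 0 ⊓ U 1 ⊓ U 2 := by
  intro i j k
  fin_cases i <;> fin_cases j <;> fin_cases k <;> intro h h1 h2 h3 <;>
    first | exact absurd rfl h | exact le_inf (le_inf ‹_› ‹_›) ‹_›

variable (U : Fin 3 → X.Opens)

open Classical in
/-- The alternating 2-cochain with a given value at `(0, 1, 2)`. -/
def alternating (t : Γ(X, U 0 ⊓ U 1 ⊓ U 2)) : C2 X U := fun i j k =>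
  if h : triSign i j k ≠ 0 then
    triSign i j k • res X (le_of_triSign h leI leI leI) t
  else 0

variable {U}

theorem res_alternating (t : Γ(X, U 0 ⊓ U 1 ⊓ U 2)) {i j k : Fin 3} {V : X.Opens}
    (h : V ≤ U i ⊓ U j ⊓ U k) (hV : V ≤ U 0 ⊓ U 1 ⊓ U 2) :
    res X h (alternating U t i j k) = triSign i j k • res X hV t := by
  rw [alternating]
  split_ifs with h'
  · simp [map_zsmul]
  · simp [not_not.mp h']

theorem res_alternating_eq_zero (t : Γ(X, U 0 ⊓ U 1 ⊓ U 2)) {i j k : Fin 3} {V : X.Opens}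
    (h : V ≤ U i ⊓ U j ⊓ U k) (hijk : triSign i j k = 0) :
    res X h (alternating U t i j k) = 0 := by
  rw [alternating, dif_neg (not_not.mpr hijk), map_zero]

theorem alternating_mem_ker (t : Γ(X, U 0 ⊓ U 1 ⊓ U 2)) : alternating U t ∈ (d2 X U).ker := by
  refine mem_ker_d2.mpr fun a b c e => ?_
  by_cases hV : U a ⊓ U b ⊓ U c ⊓ U e ≤ U 0 ⊓ U 1 ⊓ U 2
  · simp only [res_alternating t _ hV, ← sub_smul, ← add_smul, triSign_cocycle, zero_smul]
  · have h (i j k) (hi : U a ⊓ U b ⊓ U c ⊓ U e ≤ U i ⊓ U j ⊓ U k) : triSign i j k = 0 := by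
      by_contra h
      exact hV (le_of_triSign h (hi.trans leI) (hi.trans leI) (hi.trans leI))
    rw [res_alternating_eq_zero, res_alternating_eq_zero, res_alternating_eq_zero,
      res_alternating_eq_zero] <;> first | (apply h; exact leI) | simp

theorem alternating_apply (t : Γ(X, U 0 ⊓ U 1 ⊓ U 2)) : alternating U t 0 1 2 = t := by
  have h := res_alternating t (i := 0) (j := 1) (k := 2) le_rfl le_rfl
  rw [res_self, res_self, show triSign 0 1 2 = 1 by decide, one_smul] at h
  exact h

/-- The cocycle identity on quadruples with a repeated index first kills the values at `(i, j, j)`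
and `(i, j, i)`, and then shows that vanishing is preserved by transposing adjacent entries; so
everything follows from `(0, 1, 2)`. -/
theorem eq_zero_of_alternating {y : C2 X U} (hy : y ∈ (d2 X U).ker) (h1 : ∀ i j, y i i j = 0)
    (h2 : ∀ i j, i < j → y i j i = 0) (h3 : y 0 1 2 = 0) : y = 0 := by
  have h4 i j : y i j j = 0 := by
    have h := cocycle_res hy i j j j (V := U i ⊓ U j ⊓ U j) leI leI leI leI
    rw [h1] at h
    simpa using h
  have h5 i j : y i j i = 0 := by
    rcases lt_trichotomy i j with h | rfl | h
    · exact h2 i j h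
    · exact h1 i i
    · have h' := cocycle_res hy j i j i (V := U i ⊓ U j ⊓ U i) leI leI leI leI
      rw [h1, h2 j i h, h4] at h'
      simpa using h'
  have h6 a b c (h : y a b c = 0) : y b a c = 0 := by
    have h' := cocycle_res hy a b a c (V := U b ⊓ U a ⊓ U c) leI leI leI leI
    rw [h1, h5, h] at h'
    simpa using h'
  have h7 a b c (h : y a b c = 0) : y a c b = 0 := by
    have h' := cocycle_res hy a b c b (V := U a ⊓ U c ⊓ U b) leI leI leI leI
    rw [h5, h4, h] at h'
    simpa using h'
  funext a b c
  fin_cases a <;> fin_cases b <;> fin_cases c <;>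
    first
    | exact h1 _ _
    | exact h4 _ _
    | exact h5 _ _
    | exact h3
    | exact h6 _ _ _ h3
    | exact h7 _ _ _ h3
    | exact h7 _ _ _ (h6 _ _ _ h3)
    | exact h6 _ _ _ (h7 _ _ _ h3)
    | exact h7 _ _ _ (h6 _ _ _ (h7 _ _ _ h3))

/-- For three open sets, a 2-cocycle is a coboundary as soon as its value at `(0, 1, 2)` is a
combination of sections over the pairwise intersections. -/
theorem mem_range_d1_of_three {z : C2 X U} (hz : z ∈ (d2 X U).ker) (β : C1 X U)
    (h : z 0 1 2 = res X leI (β 1 2) - res X leI (β 0 2) + res X leI (β 0 1)) :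
    z ∈ (d1 X U).range := by
  -- Below the diagonal the value is forced by the equation `dβ' = z` at `(j, i, j)`, on the
  -- diagonal by the equation at `(i, i, i)`.
  let β' : C1 X U := fun i j =>
    if i < j then β i j
    else if j < i then res X leI (z j i j) + res X leI (z j j j) - res X leI (β j i)
    else res X leI (z i i j)
  have hβ' i : β' i i = res X leI (z i i i) := by simp [β']
  have hiii i j {V : X.Opens} (hV : V ≤ U i ⊓ U i ⊓ U j) :
      res X hV (z i i j) = res X (hV.trans leI) (z i i i) := by
    have h' := cocycle_res hz i i i j hV hV hV (hV.trans leI)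
    linear_combination h'
  suffices z - d1 X U β' = 0 by rw [sub_eq_zero] at this; exact ⟨β', this.symm⟩
  have happ i j k : (z - d1 X U β') i j k = z i j k -
    (res X leI (β' j k) - res X leI (β' i k) + res X leI (β' i j)) := rfl
  refine eq_zero_of_alternating (sub_mem hz (range_d1_le_ker_d2 ⟨β', rfl⟩)) ?_ ?_ ?_
  · intro i j
    rw [happ, hβ', ← res_self (le_refl _) (z i i j), hiii]
    simp
  · intro i j hij
    rw [happ, hβ']
    simp only [β', if_pos hij, if_neg hij.not_gt, map_sub, map_add, res_res, res_self]
    ring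
  · rw [happ, h]
    simp [β']

end Cech

end

/-! ### The second cohomology from three affine open sets. -/

noncomputable section

namespace Cech

variable {X : Scheme.{0}}

/-- The sections over `U 0 ∩ U 1 ∩ U 2` which are combinations of sections over the pairwise
intersections. -/
def pairSum (U : Fin 3 → X.Opens) : AddSubgroup Γ(X, U 0 ⊓ U 1 ⊓ U 2) :=
  (res X (leI : U 0 ⊓ U 1 ⊓ U 2 ≤ U 1 ⊓ U 2)).toAddMonoidHom.range ⊔
    (res X (leI : U 0 ⊓ U 1 ⊓ U 2 ≤ U 0 ⊓ U 2)).toAddMonoidHom.range ⊔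
    (res X (leI : U 0 ⊓ U 1 ⊓ U 2 ≤ U 0 ⊓ U 1)).toAddMonoidHom.range

theorem mem_pairSum {U : Fin 3 → X.Opens} {t : Γ(X, U 0 ⊓ U 1 ⊓ U 2)} : t ∈ pairSum U ↔
    ∃ (a : Γ(X, U 1 ⊓ U 2)) (b : Γ(X, U 0 ⊓ U 2)) (c : Γ(X, U 0 ⊓ U 1)),
      t = res X leI a + res X leI b + res X leI c := by
  simp only [pairSum, AddSubgroup.mem_sup, AddMonoidHom.mem_range]
  constructor
  · rintro ⟨_, ⟨_, ⟨a, rfl⟩, _, ⟨b, rfl⟩, rfl⟩, _, ⟨c, rfl⟩, rfl⟩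
    exact ⟨a, b, c, rfl⟩
  · rintro ⟨a, b, c, rfl⟩
    exact ⟨_, ⟨_, ⟨a, rfl⟩, _, ⟨b, rfl⟩, rfl⟩, _, ⟨c, rfl⟩, rfl⟩

theorem apply_mem_pairSum {U : Fin 3 → X.Opens} {z : C2 X U} (hz : z ∈ (d1 X U).range) :
    z 0 1 2 ∈ pairSum U := by
  obtain ⟨β, hβ⟩ := mem_range_d1.mp hz
  refine mem_pairSum.mpr ⟨β 1 2, -β 0 2, β 0 1, ?_⟩
  rw [hβ, map_neg]
  ring

theorem mem_range_d1_of_pairSum {U : Fin 3 → X.Opens} {z : C2 X U} (hz : z ∈ (d2 X U).ker)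
    (h : z 0 1 2 ∈ pairSum U) : z ∈ (d1 X U).range := by
  obtain ⟨a, b, c, h⟩ := mem_pairSum.mp h
  refine mem_range_d1_of_three hz (fun i j =>
    if hij : i = 1 ∧ j = 2 then res X (by rw [hij.1, hij.2]) a
    else if hij : i = 0 ∧ j = 2 then -res X (by rw [hij.1, hij.2]) b
    else if hij : i = 0 ∧ j = 1 then res X (by rw [hij.1, hij.2]) c else 0) ?_
  simp [h]

variable {ι : Type}

/-- The restriction to the family `U` of a cocycle on all affine open sets. -/
theorem restrict_mem_ker {z : C2 X (aff X)} (hz : z ∈ (d2 X (aff X)).ker)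
    (U : ι → X.affineOpens) :
    (fun a b c => z (U a) (U b) (U c)) ∈ (d2 X (fun a => (U a : X.Opens))).ker :=
  mem_ker_d2.mpr fun a b c e => mem_ker_d2.mp hz (U a) (U b) (U c) (U e)

theorem restrict_mem_range {z : C2 X (aff X)} (hz : z ∈ (d1 X (aff X)).range)
    (U : ι → X.affineOpens) :
    (fun a b c => z (U a) (U b) (U c)) ∈ (d1 X (fun a => (U a : X.Opens))).range := by
  obtain ⟨β, hβ⟩ := mem_range_d1.mp hz
  exact mem_range_d1.mpr ⟨fun a b => β (U a) (U b), fun a b c => hβ _ _ _⟩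

theorem restrict_mem_range_iff [X.IsSeparated] [Finite ι] (U : ι → X.affineOpens)
    (hcov : ⨆ i, (U i : X.Opens) = ⊤) {z : C2 X (aff X)} (hz : z ∈ (d2 X (aff X)).ker) :
    (fun a b c => z (U a) (U b) (U c)) ∈ (d1 X (fun a => (U a : X.Opens))).range ↔
      z ∈ (d1 X (aff X)).range :=
  ⟨mem_range_d1_of_subfamily (fun a => a.2) U hcov hz, fun h => restrict_mem_range h U⟩

/-- Restriction to a finite affine covering loses nothing, and for three open sets the value at `(0,
1, 2)` determines a cocycle up to coboundaries. -/
theorem mem_range_iff_pairSum [X.IsSeparated] (U : Fin 3 → X.affineOpens)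
    (hcov : ⨆ i, (U i : X.Opens) = ⊤) {z : C2 X (aff X)} (hz : z ∈ (d2 X (aff X)).ker) :
    z ∈ (d1 X (aff X)).range ↔ z (U 0) (U 1) (U 2) ∈ pairSum (fun i => (U i : X.Opens)) := by
  rw [← restrict_mem_range_iff U hcov hz]
  exact ⟨fun h => apply_mem_pairSum h, fun h => mem_range_d1_of_pairSum (restrict_mem_ker hz U) h⟩

/-- Injectivity of `σ` makes the prescribed values consistent; the extension is zero at all other
pairs. -/
theorem exists_extend_cochain {J : Type} {W : J → X.Opens} {σ : ι → J}
    (hσ : Function.Injective σ) (β : C1 X (fun i => W (σ i))) :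
    ∃ β' : C1 X W, ∀ i j, β' (σ i) (σ j) = β i j := by
  have h a b : ∃ y : Γ(X, W a ⊓ W b), ∀ i j (hi : σ i = a) (hj : σ j = b),
      y = res X (by subst hi hj; exact le_rfl) (β i j) := by
    by_cases hab : ∃ i j, σ i = a ∧ σ j = b
    · obtain ⟨i, j, rfl, rfl⟩ := hab
      refine ⟨β i j, fun i' j' hi hj => ?_⟩
      obtain rfl := hσ hi
      obtain rfl := hσ hj
      simp
    · exact ⟨0, fun i j hi hj => absurd ⟨i, j, hi, hj⟩ hab⟩
  choose β' hβ' using h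
  exact ⟨β', fun i j => (hβ' _ _ i j rfl rfl).trans (res_self _ _)⟩

/-- The alternating cocycle with value `t` extends only up to a coboundary; subtracting an extension
of that coboundary makes the value exactly `t`. -/
theorem exists_cocycle_apply_eq [X.IsSeparated] {J : Type} {W : J → X.Opens}
    (hW : ∀ a, IsAffineOpen (W a)) {σ : Fin 3 → J} (hσ : Function.Injective σ)
    (hcov : ⨆ i, W (σ i) = ⊤) (t : Γ(X, W (σ 0) ⊓ W (σ 1) ⊓ W (σ 2))) :
    ∃ z ∈ (d2 X W).ker, z (σ 0) (σ 1) (σ 2) = t := by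
  obtain ⟨z, hz, h⟩ := exists_extend_cocycle hW σ hcov
    (alternating_mem_ker (U := fun i => W (σ i)) t)
  obtain ⟨β, hβ⟩ := mem_range_d1.mp h
  obtain ⟨β', hβ'⟩ := exists_extend_cochain hσ β
  refine ⟨z - d1 X W β', sub_mem hz (range_d1_le_ker_d2 ⟨β', rfl⟩), ?_⟩
  have h012 := hβ 0 1 2
  have halt := alternating_apply (U := fun i => W (σ i)) t
  have happ : (z - d1 X W β') (σ 0) (σ 1) (σ 2) = z (σ 0) (σ 1) (σ 2) -
    (res X leI (β' (σ 1) (σ 2)) - res X leI (β' (σ 0) (σ 2)) + res X leI (β' (σ 0) (σ 1))) := rfl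
  rw [happ, hβ' 1 2, hβ' 0 2, hβ' 0 1]
  exact (congrArg (z (σ 0) (σ 1) (σ 2) - ·) h012.symm).trans ((sub_sub_cancel _ _).trans halt)

theorem mk_eq_mk_iff {G : Type} [AddCommGroup G] {K R : AddSubgroup G} {z z' : G} {hz : z ∈ K}
    {hz' : z' ∈ K} : (QuotientAddGroup.mk ⟨z, hz⟩ : K ⧸ R.addSubgroupOf K) =
      QuotientAddGroup.mk ⟨z', hz'⟩ ↔ z - z' ∈ R := by
  rw [QuotientAddGroup.eq, AddSubgroup.mem_addSubgroupOf, ← neg_mem_iff]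
  simp [sub_eq_add_neg, add_comm]

theorem Represents.eq_iff {z z' : C2 X (aff X)} {θ θ' : H2 X} (h : Represents z θ)
    (h' : Represents z' θ') : θ = θ' ↔ z - z' ∈ (d1 X (aff X)).range := by
  obtain ⟨hz, h⟩ := h
  obtain ⟨hz', h'⟩ := h'
  rw [← h, ← h']
  exact mk_eq_mk_iff

theorem Represents.add {z z' : C2 X (aff X)} {θ θ' : H2 X} (h : Represents z θ)
    (h' : Represents z' θ') : Represents (z + z') (θ + θ') := by
  obtain ⟨hz, rfl⟩ := h
  obtain ⟨hz', rfl⟩ := h'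
  exact ⟨add_mem hz hz', rfl⟩

theorem represents_zero : Represents (0 : C2 X (aff X)) 0 := ⟨zero_mem _, rfl⟩

theorem exists_represents (θ : H2 X) : ∃ z, Represents z θ := by
  obtain ⟨z, rfl⟩ := QuotientAddGroup.mk_surjective θ
  exact ⟨z, z.2, rfl⟩

/-- A description of `H²` by the cocycles for a covering by three affine open sets. -/
theorem exists_equiv_H2 [X.IsSeparated] (U : Fin 3 → X.affineOpens)
    (hU : Function.Injective U) (hcov : ⨆ i, (U i : X.Opens) = ⊤) {F : Type} [AddCommGroup F]
    (S : AddSubgroup F) (T : F →+ Γ(X, (U 0 : X.Opens) ⊓ U 1 ⊓ U 2))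
    (hS : ∀ q, T q ∈ pairSum (fun i => (U i : X.Opens)) ↔ q ∈ S)
    (hT : ∀ t, ∃ q, t - T q ∈ pairSum (fun i => (U i : X.Opens))) :
    ∃ Φ : (F ⧸ S) ≃+ H2 X, ∀ q, ∃ z, Represents z (Φ (QuotientAddGroup.mk q)) ∧
      z (U 0) (U 1) (U 2) = T q := by
  -- The chosen cocycles need not be additive in `q`, but their classes are, since these depend only
  -- on the value at `(0, 1, 2)` modulo `pairSum`.
  choose z hz hzT using fun q => exists_cocycle_apply_eq (W := aff X) (fun a => a.2) hU hcov (T q)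
  let Ψ₀ (q : F) : H2 X := QuotientAddGroup.mk ⟨z q, hz q⟩
  have hrep q : Represents (z q) (Ψ₀ q) := ⟨hz q, rfl⟩
  have hadd q r : Ψ₀ (q + r) = Ψ₀ q + Ψ₀ r := by
    rw [(hrep _).eq_iff ((hrep q).add (hrep r)),
      mem_range_iff_pairSum U hcov (sub_mem (hz _) (add_mem (hz _) (hz _)))]
    simp only [Pi.sub_apply, Pi.add_apply, hzT, map_add, sub_self]
    exact zero_mem _
  let Ψ : F →+ H2 X := AddMonoidHom.mk' Ψ₀ hadd
  have hker : Ψ.ker = S := by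
    ext q
    rw [AddMonoidHom.mem_ker, ← hS, ← hzT, ← mem_range_iff_pairSum U hcov (hz q)]
    refine ((hrep q).eq_iff represents_zero).trans ?_
    rw [sub_zero]
  have hsurj : Function.Surjective Ψ := by
    intro θ
    obtain ⟨y, hy⟩ := exists_represents θ
    obtain ⟨q, hq⟩ := hT (y (U 0) (U 1) (U 2))
    refine ⟨q, ((hrep q).eq_iff hy).mpr ?_⟩
    rw [mem_range_iff_pairSum U hcov (sub_mem (hz _) hy.1), Pi.sub_apply, Pi.sub_apply,
      Pi.sub_apply, hzT, ← neg_sub]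
    exact neg_mem hq
  refine ⟨(QuotientAddGroup.quotientAddEquivOfEq hker.symm).trans
    (QuotientAddGroup.quotientKerEquivOfSurjective Ψ hsurj), fun q => ⟨z q, hrep q, hzT q⟩⟩

/-- The restriction of `θ` to the affine covering `U` is the class of `γ`. -/
def RepresentsOn (U : ι → X.affineOpens) (γ : C2 X (fun a => (U a : X.Opens))) (θ : H2 X) : Prop :=
  ∃ z, Represents z θ ∧
    (fun a b c => z (U a) (U b) (U c)) - γ ∈ (d1 X (fun a => (U a : X.Opens))).range

theorem RepresentsOn.congr {U : ι → X.affineOpens} {γ γ' : C2 X (fun a => (U a : X.Opens))}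
    {θ : H2 X} (h : RepresentsOn U γ θ) (hγ : γ - γ' ∈ (d1 X (fun a => (U a : X.Opens))).range) :
    RepresentsOn U γ' θ := by
  obtain ⟨z, hz, h⟩ := h
  exact ⟨z, hz, by simpa using add_mem h hγ⟩

theorem RepresentsOn.unique [X.IsSeparated] [Finite ι] {U : ι → X.affineOpens}
    (hcov : ⨆ i, (U i : X.Opens) = ⊤) {γ γ' : C2 X (fun a => (U a : X.Opens))} {θ θ' : H2 X}
    (h : RepresentsOn U γ θ) (h' : RepresentsOn U γ' θ')
    (hγ : γ - γ' ∈ (d1 X (fun a => (U a : X.Opens))).range) : θ = θ' := by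
  obtain ⟨z, hz, h⟩ := h.congr hγ
  obtain ⟨z', hz', h'⟩ := h'
  refine (hz.eq_iff hz').mpr ((restrict_mem_range_iff U hcov (sub_mem hz.1 hz'.1)).mp ?_)
  convert sub_mem h h' using 1
  funext a b c
  simp

/-- The cocycle on all affine sets, restricted to `κ` or to `U ∘ τ`, gives cohomologous results by
the prism homotopy. -/
theorem RepresentsOn.refine {K : Type} {U : ι → X.affineOpens}
    {γ : C2 X (fun a => (U a : X.Opens))} {θ : H2 X} (h : RepresentsOn U γ θ)
    (κ : K → X.affineOpens) (τ : K → ι) (hκ : ∀ k, (κ k : X.Opens) ≤ U (τ k)) :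
    RepresentsOn κ (fun a b c => res X (inf_le_inf (inf_le_inf (hκ a) (hκ b)) (hκ c))
      (γ (τ a) (τ b) (τ c))) θ := by
  obtain ⟨z, hz, h⟩ := h
  refine ⟨z, hz, ?_⟩
  obtain ⟨β, hβ⟩ := mem_range_d1.mp h
  have h1 : (fun a b c => res X (inf_le_inf (inf_le_inf (hκ a) (hκ b)) (hκ c))
      (z (U (τ a)) (U (τ b)) (U (τ c)) - γ (τ a) (τ b) (τ c))) ∈
      (d1 X (fun a => (κ a : X.Opens))).range := by
    refine mem_range_d1.mpr ⟨fun a b => res X (inf_le_inf (hκ a) (hκ b)) (β (τ a) (τ b)),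
      fun a b c => ?_⟩
    have := congrArg (res X (inf_le_inf (inf_le_inf (hκ a) (hκ b)) (hκ c))) (hβ (τ a) (τ b) (τ c))
    simpa only [Pi.sub_apply, map_add, map_sub, res_res] using this
  have h2 := refine_mem_range_d1 (W := aff X) κ (fun k => U (τ k)) hκ hz.1
  convert sub_mem h1 h2 using 1
  funext a b c
  simp

theorem Represents.representsOn_alternating {U : Fin 3 → X.affineOpens} {z : C2 X (aff X)}
    {θ : H2 X} (h : Represents z θ) :
    RepresentsOn U (alternating (fun i => (U i : X.Opens)) (z (U 0) (U 1) (U 2))) θ := by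
  refine ⟨z, h, mem_range_d1_of_pairSum (_root_.sub_mem (restrict_mem_ker h.1 U)
    (alternating_mem_ker _)) ?_⟩
  have : alternating (fun i => (U i : X.Opens)) (z (U 0) (U 1) (U 2)) 0 1 2 =
    z (U 0) (U 1) (U 2) := alternating_apply _
  rw [Pi.sub_apply, Pi.sub_apply, Pi.sub_apply, this, sub_self]
  exact zero_mem _

end Cech

/-- The cochain `β` of the definition is absorbed into `RepresentsOn`, to which refinement and
uniqueness apply. -/
theorem isObstruction_iff {X Y : Scheme.{0}} (i : X ⟶ Y) (p : ℕ) (I : X.IdealSheafData)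
    (θ : Cech.H2 X) : IsObstruction i p I θ ↔ ∃ D : LiftingDatum i p I,
      Cech.RepresentsOn D.U (fun a b e =>
        (i.appLE (D.V a ⊓ D.V b ⊓ D.V e) (D.U a ⊓ D.U b ⊓ D.U e) le_rfl).hom (D.c a b e)) θ := by
  constructor
  · rintro ⟨D, z, β, hz, h⟩
    refine ⟨D, z, hz, β, ?_⟩
    funext a b e
    rw [Pi.sub_apply, Pi.sub_apply, Pi.sub_apply, h, add_sub_cancel_left]
  · rintro ⟨D, z, hz, β, h⟩
    refine ⟨D, z, β, hz, fun a b e => ?_⟩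
    rw [h, Pi.sub_apply, Pi.sub_apply, Pi.sub_apply, add_sub_cancel]

end

noncomputable section

/-! ### Fractions on `Proj` -/

namespace ProjFraction

open Cech HomogeneousLocalization

variable {A : Type} [CommRing A] {σ : Type} [SetLike σ A] [AddSubgroupClass σ A] (𝒜 : ℕ → σ)
  [GradedRing 𝒜]

/-- The function `a / b` on an open set on which `b` does not vanish. -/
def fr {U : (Proj 𝒜).Opens} (a b : A) {n : ℕ} (ha : a ∈ 𝒜 n) (hb : b ∈ 𝒜 n)
    (h : U ≤ Proj.basicOpen 𝒜 b) : Γ(Proj 𝒜, U) :=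
  projFraction 𝒜 ⟨a, ha⟩ ⟨b, hb⟩ h

/-- The value of a section at a point, in the localization of `A`. -/
def value {U : (Proj 𝒜).Opens} (s : Γ(Proj 𝒜, U)) (x : ProjectiveSpectrum 𝒜) (hx : x ∈ U) :
    Localization x.asHomogeneousIdeal.toIdeal.primeCompl :=
  HomogeneousLocalization.val
    ((show (ProjectiveSpectrum.Proj.structureSheaf 𝒜).1.obj (.op U) from s).1 ⟨x, hx⟩)

variable {𝒜} {U V : (Proj 𝒜).Opens} {a b c d : A} {m n : ℕ}

/-- Germs on `Proj` embed in the localizations of `A` itself, where identities between fractions can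
be verified. -/
theorem ext_value {s t : Γ(Proj 𝒜, U)} (h : ∀ x hx, value 𝒜 s x hx = value 𝒜 t x hx) : s = t :=
  Subtype.ext <| funext fun x => HomogeneousLocalization.val_injective _ (h x.1 x.2)

theorem value_add (s t : Γ(Proj 𝒜, U)) (x : ProjectiveSpectrum 𝒜) (hx : x ∈ U) :
    value 𝒜 (s + t) x hx = value 𝒜 s x hx + value 𝒜 t x hx := HomogeneousLocalization.val_add ..

theorem value_mul (s t : Γ(Proj 𝒜, U)) (x : ProjectiveSpectrum 𝒜) (hx : x ∈ U) :
    value 𝒜 (s * t) x hx = value 𝒜 s x hx * value 𝒜 t x hx := HomogeneousLocalization.val_mul ..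

theorem value_zero (x : ProjectiveSpectrum 𝒜) (hx : x ∈ U) :
    value 𝒜 (0 : Γ(Proj 𝒜, U)) x hx = 0 := HomogeneousLocalization.val_zero

theorem value_one (x : ProjectiveSpectrum 𝒜) (hx : x ∈ U) :
    value 𝒜 (1 : Γ(Proj 𝒜, U)) x hx = 1 := HomogeneousLocalization.val_one

theorem value_fr (ha : a ∈ 𝒜 n) (hb : b ∈ 𝒜 n) (h : U ≤ Proj.basicOpen 𝒜 b)
    (x : ProjectiveSpectrum 𝒜) (hx : x ∈ U) :
    value 𝒜 (fr 𝒜 a b ha hb h) x hx = Localization.mk a ⟨b, h hx⟩ := rfl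

theorem res_fr (ha : a ∈ 𝒜 n) (hb : b ∈ 𝒜 n) (h : U ≤ Proj.basicOpen 𝒜 b) (hV : V ≤ U) :
    res (Proj 𝒜) hV (fr 𝒜 a b ha hb h) = fr 𝒜 a b ha hb (hV.trans h) := rfl

theorem fr_eq_of_mul {s : A} (ha : a ∈ 𝒜 n) (hb : b ∈ 𝒜 n) (h : U ≤ Proj.basicOpen 𝒜 b)
    (hc : c ∈ 𝒜 m) (hd : d ∈ 𝒜 m) (h' : U ≤ Proj.basicOpen 𝒜 d) (hs : U ≤ Proj.basicOpen 𝒜 s)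
    (e : s * (a * d) = s * (c * b)) : fr 𝒜 a b ha hb h = fr 𝒜 c d hc hd h' := by
  refine ext_value fun x hx => ?_
  rw [value_fr, value_fr, Localization.mk_eq_mk_iff, Localization.r_iff_exists]
  refine ⟨⟨s, hs hx⟩, ?_⟩
  change s * (d * a) = s * (b * c)
  rw [mul_comm d, e, mul_comm b]

theorem fr_eq (ha : a ∈ 𝒜 n) (hb : b ∈ 𝒜 n) (h : U ≤ Proj.basicOpen 𝒜 b)
    (hc : c ∈ 𝒜 m) (hd : d ∈ 𝒜 m) (h' : U ≤ Proj.basicOpen 𝒜 d)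
    (e : a * d = c * b) : fr 𝒜 a b ha hb h = fr 𝒜 c d hc hd h' :=
  fr_eq_of_mul ha hb h hc hd h' h (by rw [e])

theorem fr_congr (ha : a ∈ 𝒜 n) (hb : b ∈ 𝒜 n) (h : U ≤ Proj.basicOpen 𝒜 b)
    (hc : c ∈ 𝒜 n) (e : a = c) : fr 𝒜 a b ha hb h = fr 𝒜 c b hc hb h := by
  subst e; rfl

theorem fr_mul (ha : a ∈ 𝒜 n) (hb : b ∈ 𝒜 n) (h : U ≤ Proj.basicOpen 𝒜 b)
    (hc : c ∈ 𝒜 m) (hd : d ∈ 𝒜 m) (h' : U ≤ Proj.basicOpen 𝒜 d) :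
    fr 𝒜 a b ha hb h * fr 𝒜 c d hc hd h' =
      fr 𝒜 (a * c) (b * d) (SetLike.mul_mem_graded ha hc) (SetLike.mul_mem_graded hb hd)
        (by rw [Proj.basicOpen_mul]; exact le_inf h h') := by
  refine ext_value fun x hx => ?_
  rw [value_mul, value_fr, value_fr, value_fr, Localization.mk_mul]
  rfl

theorem fr_add (ha : a ∈ 𝒜 n) (hb : b ∈ 𝒜 n) (h : U ≤ Proj.basicOpen 𝒜 b) (hc : c ∈ 𝒜 n) :
    fr 𝒜 a b ha hb h + fr 𝒜 c b hc hb h = fr 𝒜 (a + c) b (add_mem ha hc) hb h := by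
  refine ext_value fun x hx => ?_
  rw [value_add, value_fr, value_fr, value_fr, Localization.add_mk_self]

theorem fr_zero (hb : b ∈ 𝒜 n) (h : U ≤ Proj.basicOpen 𝒜 b) :
    fr 𝒜 0 b (zero_mem _) hb h = 0 := by
  refine ext_value fun x hx => ?_
  rw [value_fr, value_zero, Localization.mk_zero]

theorem fr_self (hb : b ∈ 𝒜 n) (h : U ≤ Proj.basicOpen 𝒜 b) : fr 𝒜 b b hb hb h = 1 := by
  refine ext_value fun x hx => ?_
  rw [value_fr, value_one]
  exact Localization.mk_self ⟨b, h hx⟩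

/-- The functions `a / b` with fixed denominator, as an additive map. -/
def frHom (hb : b ∈ 𝒜 n) (h : U ≤ Proj.basicOpen 𝒜 b) : 𝒜 n →+ Γ(Proj 𝒜, U) where
  toFun a := fr 𝒜 a b a.2 hb h
  map_zero' := fr_zero hb h
  map_add' a c := (fr_add a.2 hb h c.2).symm

theorem fr_zsmul (k : ℤ) (ha : a ∈ 𝒜 n) (hb : b ∈ 𝒜 n) (h : U ≤ Proj.basicOpen 𝒜 b) :
    k • fr 𝒜 a b ha hb h = fr 𝒜 (k • a) b (zsmul_mem ha k) hb h :=
  (map_zsmul (frHom hb h) k ⟨a, ha⟩).symm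

theorem fr_sub (ha : a ∈ 𝒜 n) (hb : b ∈ 𝒜 n) (h : U ≤ Proj.basicOpen 𝒜 b) (hc : c ∈ 𝒜 n) :
    fr 𝒜 a b ha hb h - fr 𝒜 c b hc hb h = fr 𝒜 (a - c) b (sub_mem ha hc) hb h :=
  (map_sub (frHom hb h) ⟨a, ha⟩ ⟨c, hc⟩).symm

/-- The function `a / b` as a unit, where neither `a` nor `b` vanishes. -/
def frUnit (ha : a ∈ 𝒜 n) (hb : b ∈ 𝒜 n) (h : U ≤ Proj.basicOpen 𝒜 b)
    (h' : U ≤ Proj.basicOpen 𝒜 a) : (Γ(Proj 𝒜, U))ˣ where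
  val := fr 𝒜 a b ha hb h
  inv := fr 𝒜 b a hb ha h'
  val_inv := by
    rw [fr_mul, ← fr_self (SetLike.mul_mem_graded ha hb)
      (by rw [Proj.basicOpen_mul]; exact le_inf h' h)]
    exact fr_eq _ _ _ _ _ _ (by ring)
  inv_val := by
    rw [fr_mul, ← fr_self (SetLike.mul_mem_graded ha hb)
      (by rw [Proj.basicOpen_mul]; exact le_inf h' h)]
    exact fr_eq _ _ _ _ _ _ (by ring)

/-- All large exponents are allowed, so that several sections can be given the same one; numerator
and denominator are multiplied by `b ^ (n - N)`. -/
theorem exists_fr (hb : b ∈ 𝒜 m) (hm : 0 < m) (hU : U ≤ Proj.basicOpen 𝒜 b)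
    (hU' : Proj.basicOpen 𝒜 b ≤ U) (s : Γ(Proj 𝒜, U)) :
    ∃ N, ∀ n ≥ N, ∃ (a : A) (ha : a ∈ 𝒜 (n • m)), s = fr 𝒜 a (b ^ n) ha (SetLike.pow_mem_graded n hb)
      (by rcases n.eq_zero_or_pos with rfl | h
          · simp
          · rwa [Proj.basicOpen_pow _ _ _ h]) := by
  obtain rfl := le_antisymm hU hU'
  obtain ⟨y, rfl⟩ : ∃ y, (Proj.awayToSection 𝒜 b).hom y = s := by
    refine ⟨(Proj.basicOpenIsoAway 𝒜 b hb hm).inv.hom s, ?_⟩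
    rw [← Proj.basicOpenIsoAway_hom 𝒜 b hb hm, ← CommRingCat.comp_apply, Iso.inv_hom_id]
    rfl
  obtain ⟨N, a, ha, rfl⟩ := HomogeneousLocalization.Away.mk_surjective 𝒜 hb y
  refine ⟨N, fun n hn => ⟨b ^ (n - N) * a, ?_, ?_⟩⟩
  · have := SetLike.mul_mem_graded (SetLike.pow_mem_graded (n - N) hb) ha
    rwa [← add_smul, Nat.sub_add_cancel hn] at this
  · refine ext_value fun x hx => ?_
    rw [value_fr]
    change Localization.mk _ _ = _
    rw [Localization.mk_eq_mk_iff, Localization.r_iff_exists]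
    refine ⟨1, ?_⟩
    change 1 * (b ^ n * a) = 1 * (b ^ N * (b ^ (n - N) * a))
    rw [← mul_assoc (b ^ N), ← pow_add, Nat.add_sub_cancel' hn]

/-- As `c` is invertible on `D(b)`, multiplication by `c ^ m / b ^ n` turns the fraction into one
with a power of `b` as denominator, and its vanishing means annihilation by some `b ^ k`. The
exponents equalize the degrees. -/
theorem exists_pow_mul_eq_zero (hb : b ∈ 𝒜 m) (hm : 0 < m) (hU : U ≤ Proj.basicOpen 𝒜 b)
    (hU' : Proj.basicOpen 𝒜 b ≤ U) (ha : a ∈ 𝒜 n) (hc : c ∈ 𝒜 n) (h : U ≤ Proj.basicOpen 𝒜 c)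
    (e : fr 𝒜 a c ha hc h = 0) : ∃ k, b ^ k * c ^ (m - 1) * a = 0 := by
  obtain rfl := le_antisymm hU hU'
  have hbn : b ^ n ∈ 𝒜 (m • n) := by
    rw [smul_eq_mul, mul_comm]; exact SetLike.pow_mem_graded n hb
  have hcm : c ^ m ∈ 𝒜 (m • n) := SetLike.pow_mem_graded m hc
  have hac : c ^ (m - 1) * a ∈ 𝒜 (m • n) := by
    have := SetLike.mul_mem_graded (SetLike.pow_mem_graded (m - 1) hc) ha
    rwa [← succ_nsmul, Nat.sub_add_cancel hm] at this
  have hn' : Proj.basicOpen 𝒜 b ≤ Proj.basicOpen 𝒜 (b ^ n) := by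
    rcases n.eq_zero_or_pos with rfl | h
    · simp
    · rw [Proj.basicOpen_pow _ _ _ h]
  have e1 : fr 𝒜 (c ^ (m - 1) * a) (b ^ n) hac hbn hn' = 0 := by
    rw [← zero_mul (fr 𝒜 (c ^ m) (b ^ n) hcm hbn hn'), ← e, fr_mul]
    refine fr_eq _ _ _ _ _ _ ?_
    obtain ⟨k, rfl⟩ : ∃ k, m = k + 1 := ⟨m - 1, by omega⟩
    rw [Nat.add_sub_cancel]; ring
  let y : Away 𝒜 b := HomogeneousLocalization.mk ⟨m • n, ⟨_, hac⟩, ⟨_, hbn⟩, n, rfl⟩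
  have e2 : (Proj.awayToSection 𝒜 b).hom y = 0 := e1
  have e3 : y = 0 := by
    have := congrArg (Proj.basicOpenIsoAway 𝒜 b hb hm).inv.hom e2
    rw [← Proj.basicOpenIsoAway_hom 𝒜 b hb hm, ← CommRingCat.comp_apply, Iso.hom_inv_id,
      map_zero] at this
    exact this
  have e4 : Localization.mk (c ^ (m - 1) * a) (⟨b ^ n, n, rfl⟩ : Submonoid.powers b) = 0 := by
    have := congrArg HomogeneousLocalization.val e3
    rwa [HomogeneousLocalization.val_zero] at this
  rw [← Localization.mk_zero 1, Localization.mk_eq_mk_iff, Localization.r_iff_exists] at e4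
  obtain ⟨⟨_, k, rfl⟩, hk⟩ := e4
  refine ⟨k, ?_⟩
  simpa [mul_assoc] using hk

variable {B : Type} [CommRing B] {τ : Type} [SetLike τ B] [AddSubgroupClass τ B] {ℬ : ℕ → τ}
  [GradedRing ℬ]

theorem map_fr (f : GradedRingHom 𝒜 ℬ)
    (hf : HomogeneousIdeal.irrelevant ℬ ≤ (HomogeneousIdeal.irrelevant 𝒜).map f)
    (ha : a ∈ 𝒜 n) (hb : b ∈ 𝒜 n) (h : U ≤ Proj.basicOpen 𝒜 b) {V : (Proj ℬ).Opens}
    (hV : V ≤ (Proj.map f hf) ⁻¹ᵁ U) :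
    ((Proj.map f hf).appLE U V hV).hom (fr 𝒜 a b ha hb h) =
      fr ℬ (f a) (f b) (f.map_mem ha) (f.map_mem hb) (fun _ hx => h (hV hx)) := by
  refine Subtype.ext <| funext fun p => ?_
  change HomogeneousLocalization.mk _ = .mk _
  ext
  simp

end ProjFraction

end

noncomputable section

/-! ### Complete intersections of a line, a cubic and a quintic -/

namespace TernaryForms

variable {k : Type} [Field k]

/-- Elimination of a variable by means of a nonzero linear form. -/
theorem exists_elimination {l : MvPolynomial (Fin 3) k} (hl : l.IsHomogeneous 1) (hl0 : l ≠ 0) :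
    ∃ (π : MvPolynomial (Fin 3) k →ₐ[k] MvPolynomial (Fin 2) k)
      (σ : MvPolynomial (Fin 2) k →ₐ[k] MvPolynomial (Fin 3) k),
      (∀ q, π (σ q) = q) ∧ (∀ q, l ∣ q - σ (π q)) ∧ π l = 0 ∧
      (∀ n q, q.IsHomogeneous n → (π q).IsHomogeneous n) ∧
      (∀ n q, q.IsHomogeneous n → (σ q).IsHomogeneous n) ∧ ∀ j, ∃ m, σ (X j) = X m := by
  have hspan : l ∈ Submodule.span k (Set.range (X : Fin 3 → MvPolynomial (Fin 3) k)) := by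
    rw [← homogeneousSubmodule_one_eq_span_X]; exact hl
  obtain ⟨c, rfl⟩ := (Submodule.mem_span_range_iff_exists_fun k).mp hspan
  obtain ⟨i, hi⟩ : ∃ i, c i ≠ 0 := by
    by_contra! h
    exact hl0 (by simp [h])
  -- The solution of `l = 0` for the variable `X i`, whose coefficient is nonzero.
  let v : MvPolynomial (Fin 2) k := -∑ j, C (c (i.succAbove j) / c i) * X j
  let π : MvPolynomial (Fin 3) k →ₐ[k] MvPolynomial (Fin 2) k :=
    aeval (i.insertNth (α := fun _ => MvPolynomial (Fin 2) k) v (fun j => X j))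
  let σ : MvPolynomial (Fin 2) k →ₐ[k] MvPolynomial (Fin 3) k := rename i.succAbove
  have hπi : π (X i) = v := by simp [π]
  have hπj j : π (X (i.succAbove j)) = X j := by simp [π]
  have hv : v.IsHomogeneous 1 :=
    (IsHomogeneous.sum _ _ _ fun j _ => isHomogeneous_C_mul_X _ _).neg
  have hl' : ∑ m, c m • (X m : MvPolynomial (Fin 3) k) = C (c i) * (X i - σ v) := by
    rw [Fin.sum_univ_succAbove _ i]
    simp only [v, σ, map_neg, map_sum, map_mul, rename_C, rename_X, sub_neg_eq_add, mul_add,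
      Finset.mul_sum, smul_eq_C_mul]
    refine congrArg _ (Finset.sum_congr rfl fun j _ => ?_)
    rw [← mul_assoc, ← C_mul, mul_div_cancel₀ _ hi]
  refine ⟨π, σ, fun q => ?_, fun q => ?_, ?_, fun n q hq => ?_, fun n q hq =>
    hq.rename_isHomogeneous, fun j => ⟨_, rename_X _ _⟩⟩
  · have : π.comp σ = AlgHom.id _ _ := by
      ext j : 1
      simp [σ, hπj]
    exact DFunLike.congr_fun this q
  · rw [← Ideal.mem_span_singleton, ← Ideal.Quotient.mk_eq_mk_iff_sub_mem]
    have : Ideal.Quotient.mkₐ k (Ideal.span {∑ m, c m • (X m : MvPolynomial (Fin 3) k)}) =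
        (Ideal.Quotient.mkₐ k _).comp (σ.comp π) := by
      ext m : 1
      rw [AlgHom.comp_apply, AlgHom.comp_apply]
      rcases Fin.eq_self_or_eq_succAbove i m with rfl | ⟨j, rfl⟩
      · rw [hπi, Ideal.Quotient.mkₐ_eq_mk, Ideal.Quotient.mk_eq_mk_iff_sub_mem,
          Ideal.mem_span_singleton, hl']
        refine ⟨C (c m)⁻¹, ?_⟩
        rw [mul_right_comm, ← C_mul, mul_inv_cancel₀ hi, C_1, one_mul]
      · rw [hπj]
        simp [σ]
    exact DFunLike.congr_fun this q
  · rw [hl', map_mul, map_sub, hπi]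
    have : π (σ v) = v := by
      have : π.comp σ = AlgHom.id _ _ := by
        ext j : 1
        simp [σ, hπj]
      exact DFunLike.congr_fun this v
    rw [this, sub_self, mul_zero]
  · have := hq.aeval (i.insertNth (α := fun _ => MvPolynomial (Fin 2) k) v (fun j => X j)) (n := 1)
      (fun m => by
        rcases Fin.eq_self_or_eq_succAbove i m with rfl | ⟨j, rfl⟩
        · simpa using hv
        · simpa using isHomogeneous_X _ _)
    rwa [one_mul] at this

theorem finrank_binaryForms (n : ℕ) :
    Module.finrank k (homogeneousSubmodule (Fin 2) k n) = n + 1 := by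
  let e : Fin (n + 1) ≃ {d : Fin 2 →₀ ℕ | d.degree = n} :=
    { toFun a := ⟨Finsupp.single 0 (a : ℕ) + Finsupp.single 1 (n - a), by
        simp only [Set.mem_ofPred_eq, map_add, Finsupp.degree_single]
        omega⟩
      invFun d := ⟨d.1 0, by
        have h : d.1.degree = n := d.2
        rw [Finsupp.degree_eq_sum, Fin.sum_univ_two] at h
        omega⟩
      left_inv a := by
        ext
        simp
      right_inv d := by
        have h : d.1.degree = n := d.2
        rw [Finsupp.degree_eq_sum, Fin.sum_univ_two] at h
        apply Subtype.ext
        ext j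
        fin_cases j
        · simp
        · simp
          omega }
  have : Fintype {d : Fin 2 →₀ ℕ | d.degree = n} := Fintype.ofEquiv _ e
  rw [homogeneousSubmodule_eq_finsupp_supported,
    (AddMonoidAlgebra.supportedEquivFinsupp {d : Fin 2 →₀ ℕ | d.degree = n}).finrank_eq,
    Module.finrank_finsupp_self, ← Fintype.card_congr e, Fintype.card_fin]

instance (n : ℕ) : Module.Finite k (homogeneousSubmodule (Fin 2) k n) :=
  Module.finite_of_finrank_pos (by rw [finrank_binaryForms]; omega)

theorem eq_zero_of_dvd {ι : Type} {g v : MvPolynomial ι k} {m n : ℕ} (hg : g.IsHomogeneous m)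
    (hv : v.IsHomogeneous n) (hmn : n < m) (h : g ∣ v) : v = 0 := by
  by_contra hv0
  obtain ⟨u, rfl⟩ := h
  have h1 := hv.totalDegree hv0
  rw [totalDegree_mul_of_isDomain (left_ne_zero_of_mul hv0) (right_ne_zero_of_mul hv0),
    hg.totalDegree (left_ne_zero_of_mul hv0)] at h1
  omega

/-- The map `(u, v) ↦ g u + h v` on binary forms. -/
def combine {g h : MvPolynomial (Fin 2) k} {d e : ℕ} (hg : g.IsHomogeneous d)
    (hh : h.IsHomogeneous e) (a b n : ℕ) (ha : d + a = n) (hb : e + b = n) :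
    (homogeneousSubmodule (Fin 2) k a × homogeneousSubmodule (Fin 2) k b) →ₗ[k]
      homogeneousSubmodule (Fin 2) k n :=
  LinearMap.codRestrict _ (((LinearMap.mulLeft k g).comp (Submodule.subtype _)).coprod
    ((LinearMap.mulLeft k h).comp (Submodule.subtype _))) (by
      rintro ⟨⟨u, hu⟩, ⟨v, hv⟩⟩
      exact Submodule.add_mem _ (ha ▸ hg.mul hu) (hb ▸ hh.mul hv))

variable {g h : MvPolynomial (Fin 2) k} (hg : g.IsHomogeneous 3) (hh : h.IsHomogeneous 5)

include hg hh

/-- The dimensions agree: binary forms of degrees 4 and 2 give 5 + 3 = 8, the dimension in degree 7.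
So injectivity of `(u, v) ↦ g u + h v` is enough; a relation forces `g ∣ v`, and a cubic does not
divide a nonzero quadratic form. -/
theorem exists_combination_of_septic (hg0 : g ≠ 0) (hgh : IsRelPrime g h)
    {q : MvPolynomial (Fin 2) k} (hq : q.IsHomogeneous 7) : ∃ u v, q = g * u + h * v := by
  have hinj : Function.Injective (combine hg hh 4 2 7 rfl rfl) := by
    rw [injective_iff_map_eq_zero]
    rintro ⟨⟨u, hu⟩, ⟨v, hv⟩⟩ huv
    have huv : g * u + h * v = 0 := congrArg Subtype.val huv
    have hv0 : v = 0 := by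
      refine eq_zero_of_dvd hg hv (by norm_num) (hgh.dvd_of_dvd_mul_left ⟨-u, ?_⟩)
      linear_combination huv
    subst hv0
    have hu0 : u = 0 := by
      rw [mul_zero, add_zero] at huv
      exact (mul_eq_zero.mp huv).resolve_left hg0
    subst hu0
    rfl
  have hsurj := (LinearMap.injective_iff_surjective_of_finrank_eq_finrank (by
    rw [Module.finrank_prod, finrank_binaryForms, finrank_binaryForms, finrank_binaryForms])).mp hinj
  obtain ⟨⟨u, v⟩, huv⟩ := hsurj ⟨q, hq⟩
  exact ⟨u, v, (congrArg Subtype.val huv).symm⟩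

/-- One degree lower, the source has dimension 4 + 2 = 6 and the target 7. -/
theorem exists_sextic_not_combination : ∃ q : MvPolynomial (Fin 2) k, q.IsHomogeneous 6 ∧
    ∀ u v, u.IsHomogeneous 3 → v.IsHomogeneous 1 → q ≠ g * u + h * v := by
  by_contra! H
  have hsurj : Function.Surjective (combine hg hh 3 1 6 rfl rfl) := by
    rintro ⟨q, hq⟩
    obtain ⟨u, v, hu, hv, rfl⟩ := H q hq
    exact ⟨⟨⟨u, hu⟩, ⟨v, hv⟩⟩, rfl⟩
  have := LinearMap.finrank_le_finrank_of_surjective hsurj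
  rw [Module.finrank_prod, finrank_binaryForms, finrank_binaryForms, finrank_binaryForms] at this
  omega

omit hg hh

theorem isRelPrime_X_pow (m n : ℕ) :
    IsRelPrime (X 0 ^ m : MvPolynomial (Fin 2) k) (X 1 ^ n) := by
  have h : IsRelPrime (X 0 : MvPolynomial (Fin 2) k) (X 1) := by
    rw [(X_prime (R := k) (i := (0 : Fin 2))).irreducible.isRelPrime_iff_not_dvd, X_dvd_X]
    decide
  exact h.pow

/-- Only the part of `a` of degree `n - d` contributes; for `n < d` the component is zero, and the
truncated subtraction does no harm. -/
theorem coe_homogeneousComponent_mul {ι : Type} {e : MvPolynomial ι k} {d n : ℕ}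
    (he : e.IsHomogeneous d) (a : MvPolynomial ι k) :
    ∃ b : MvPolynomial ι k, b.IsHomogeneous (n - d) ∧ homogeneousComponent n (a * e) = b * e := by
  classical
  by_cases hd : d ≤ n
  · refine ⟨homogeneousComponent (n - d) a, homogeneousComponent_isHomogeneous _ _, ?_⟩
    conv_lhs => rw [← sum_homogeneousComponent a, Finset.sum_mul, map_sum]
    have h i : homogeneousComponent n (homogeneousComponent i a * e) =
        if i = n - d then homogeneousComponent i a * e else 0 := by
      rw [homogeneousComponent_of_mem ((homogeneousComponent_isHomogeneous i a).mul he)]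
      exact if_congr (by omega) rfl rfl
    simp only [h, Finset.sum_ite_eq', Finset.mem_range]
    split_ifs with h'
    · rfl
    · rw [homogeneousComponent_eq_zero _ _ (by omega), zero_mul]
  · refine ⟨0, isHomogeneous_zero _ _ _, ?_⟩
    conv_lhs => rw [← sum_homogeneousComponent a, Finset.sum_mul, map_sum]
    rw [zero_mul]
    refine Finset.sum_eq_zero fun i _ => ?_
    rw [homogeneousComponent_of_mem ((homogeneousComponent_isHomogeneous i a).mul he),
      if_neg (by omega)]

theorem exists_isHomogeneous_of_mem_span {ι : Type} {e₁ e₂ e₃ q : MvPolynomial ι k}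
    {d₁ d₂ d₃ n : ℕ} (h₁ : e₁.IsHomogeneous d₁) (h₂ : e₂.IsHomogeneous d₂)
    (h₃ : e₃.IsHomogeneous d₃) (hq : q.IsHomogeneous n) (h : q ∈ Ideal.span {e₁, e₂, e₃}) :
    ∃ a₁ a₂ a₃ : MvPolynomial ι k, a₁.IsHomogeneous (n - d₁) ∧ a₂.IsHomogeneous (n - d₂) ∧
      a₃.IsHomogeneous (n - d₃) ∧ q = a₁ * e₁ + a₂ * e₂ + a₃ * e₃ := by
  obtain ⟨a, b, c, rfl⟩ := Submodule.mem_span_triple.mp h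
  simp only [smul_eq_mul] at hq ⊢
  obtain ⟨a₁, ha₁, h₁⟩ := coe_homogeneousComponent_mul (n := n) h₁ a
  obtain ⟨a₂, ha₂, h₂⟩ := coe_homogeneousComponent_mul (n := n) h₂ b
  obtain ⟨a₃, ha₃, h₃⟩ := coe_homogeneousComponent_mul (n := n) h₃ c
  refine ⟨a₁, a₂, a₃, ha₁, ha₂, ha₃, ?_⟩
  rw [← homogeneousComponent_eq_self hq, map_add, map_add, h₁, h₂, h₃]

end TernaryForms

end

/-! ### Powers of a line, a cubic and a quintic: membership and colon ideals. -/

noncomputable section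

namespace TernaryForms

variable {k : Type} [Field k]

/-- A line, a cubic and a quintic without a common point. -/
structure IsCompleteIntersection (l f₃ f₅ : MvPolynomial (Fin 3) k) : Prop where
  line : l.IsHomogeneous 1
  cubic : f₃.IsHomogeneous 3
  quintic : f₅.IsHomogeneous 5
  ne_zero : l ≠ 0
  mem_radical : ∀ i, X i ∈ (Ideal.span {l, f₃, f₅}).radical

/-- The restriction of a cubic and a quintic to a line which they meet in disjoint sets. -/
structure IsElimination (l f₃ f₅ : MvPolynomial (Fin 3) k)
    (π : MvPolynomial (Fin 3) k →ₐ[k] MvPolynomial (Fin 2) k)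
    (σ : MvPolynomial (Fin 2) k →ₐ[k] MvPolynomial (Fin 3) k) : Prop where
  right_inv : ∀ q, π (σ q) = q
  dvd_sub : ∀ q, l ∣ q - σ (π q)
  map_line : π l = 0
  map_mem : ∀ n q, q.IsHomogeneous n → (π q).IsHomogeneous n
  lift_mem : ∀ n q, q.IsHomogeneous n → (σ q).IsHomogeneous n
  cubic_ne_zero : π f₃ ≠ 0
  isRelPrime : IsRelPrime (π f₃) (π f₅)

variable {l f₃ f₅ : MvPolynomial (Fin 3) k}

/-- A common factor of the two restrictions divides powers of both variables, since the ideal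
contains powers of all coordinates, so it is a unit. If the cubic restricted to zero, the quintic
would restrict to such a unit, against its degree. -/
theorem IsCompleteIntersection.exists_isElimination (H : IsCompleteIntersection l f₃ f₅) :
    ∃ π σ, IsElimination l f₃ f₅ π σ := by
  obtain ⟨π, σ, h1, h2, h3, h4, h5, h6⟩ := exists_elimination H.line H.ne_zero
  have key (d : MvPolynomial (Fin 2) k) (hd₁ : d ∣ π f₃) (hd₂ : d ∣ π f₅) : IsUnit d := by
    have hX j : ∃ N, d ∣ X j ^ N := by
      obtain ⟨m, hm⟩ := h6 j
      obtain ⟨N, hN⟩ := H.mem_radical m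
      obtain ⟨a, b, c, habc⟩ := Submodule.mem_span_triple.mp hN
      refine ⟨N, ?_⟩
      rw [← h1 (X j), hm, ← map_pow, ← habc]
      simp only [smul_eq_mul, map_add, map_mul, h3, mul_zero, zero_add]
      exact dvd_add (hd₁.mul_left _) (hd₂.mul_left _)
    obtain ⟨m, hm⟩ := hX 0
    obtain ⟨n, hn⟩ := hX 1
    exact isRelPrime_X_pow m n hm hn
  refine ⟨π, σ, h1, h2, h3, h4, h5, fun h0 => ?_, fun d => key d⟩
  have hu := key (π f₅) (h0 ▸ dvd_zero _) dvd_rfl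
  exact one_ne_zero (eq_zero_of_dvd (h4 5 _ H.quintic) (isHomogeneous_one _ _) (by norm_num)
    hu.dvd)

section

variable {π : MvPolynomial (Fin 3) k →ₐ[k] MvPolynomial (Fin 2) k}
    {σ : MvPolynomial (Fin 2) k →ₐ[k] MvPolynomial (Fin 3) k}

namespace IsElimination

variable (E : IsElimination l f₃ f₅ π σ)

include E

theorem dvd_of_map_eq_zero {q : MvPolynomial (Fin 3) k} (h : π q = 0) : l ∣ q := by
  simpa [h] using E.dvd_sub q

/-- A combination on the line lifts by `σ`, with an error divisible by `l`. -/
theorem mem_span {q : MvPolynomial (Fin 3) k} {a b : ℕ} {u v : MvPolynomial (Fin 2) k}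
    (h : π q = u * π f₃ ^ a + v * π f₅ ^ b) : q ∈ Ideal.span {l, f₃ ^ a, f₅ ^ b} := by
  obtain ⟨c, hc⟩ := E.dvd_of_map_eq_zero (q := q - σ u * f₃ ^ a - σ v * f₅ ^ b) (by
    simp only [map_sub, map_mul, map_pow, E.right_inv, h]
    ring)
  exact Submodule.mem_span_triple.mpr ⟨c, σ u, σ v, by
    simp only [smul_eq_mul]
    linear_combination -hc⟩

end IsElimination

end

namespace IsCompleteIntersection

/-- The coefficient of `e₁` in `q` can be taken of degree `n - d₁`; if all forms of that degree lie
in `(s, e₂, e₃)`, one more factor `s` splits off. This raises exponents one at a time. -/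
theorem mem_span_of_mul_mem {ι : Type} {e₁ e₂ e₃ s q : MvPolynomial ι k}
    {d₁ d₂ d₃ n : ℕ} (h₁ : e₁.IsHomogeneous d₁) (h₂ : e₂.IsHomogeneous d₂)
    (h₃ : e₃.IsHomogeneous d₃) (hq : q.IsHomogeneous n) (h : q ∈ Ideal.span {e₁, e₂, e₃})
    (hs : ∀ α : MvPolynomial ι k, α.IsHomogeneous (n - d₁) → α ∈ Ideal.span {s, e₂, e₃}) :
    q ∈ Ideal.span {e₁ * s, e₂, e₃} := by
  obtain ⟨a₁, a₂, a₃, ha₁, -, -, rfl⟩ := exists_isHomogeneous_of_mem_span h₁ h₂ h₃ hq h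
  obtain ⟨b₁, b₂, b₃, rfl⟩ := Submodule.mem_span_triple.mp (hs a₁ ha₁)
  exact Submodule.mem_span_triple.mpr ⟨b₁, b₂ * e₁ + a₂, b₃ * e₁ + a₃, by
    simp only [smul_eq_mul]
    ring⟩

variable (H : IsCompleteIntersection l f₃ f₅)

include H

/-- A form of degree `m + 7` is a sum of products of forms of degrees `m` and 7, and septics are
treated on the line. -/
theorem mem_span_of_seven_le {n : ℕ} (hn : 7 ≤ n) {q : MvPolynomial (Fin 3) k}
    (hq : q.IsHomogeneous n) : q ∈ Ideal.span {l, f₃, f₅} := by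
  obtain ⟨π, σ, E⟩ := H.exists_isElimination
  obtain ⟨m, rfl⟩ := Nat.exists_eq_add_of_le' hn
  have hq' : q ∈ homogeneousSubmodule (Fin 3) k m * homogeneousSubmodule (Fin 3) k 7 := by
    rw [← homogeneousSubmodule_one_pow (σ := Fin 3) k m, ← homogeneousSubmodule_one_pow (σ := Fin 3) k 7, ← pow_add,
      homogeneousSubmodule_one_pow]
    exact hq
  refine Submodule.mul_induction_on hq' (fun a _ b hb => Ideal.mul_mem_left _ _ ?_)
    (fun a b => Ideal.add_mem _)
  obtain ⟨u, v, huv⟩ := exists_combination_of_septic (E.map_mem 3 _ H.cubic)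
    (E.map_mem 5 _ H.quintic) E.cubic_ne_zero E.isRelPrime (E.map_mem 7 _ hb)
  simpa using E.mem_span (a := 1) (b := 1) (u := u) (v := v) (by rw [huv]; ring)

/-- The bound says that `n` exceeds the socle degree `(a + 1) + 3(b + 1) + 5(c + 1) - 3`. Starting
from exponents 1, induction raises those of `f₅`, `f₃` and `l` in turn. -/
theorem mem_span_pow {a b c n : ℕ} (hn : (a + 1) + 3 * (b + 1) + 5 * (c + 1) ≤ n + 2)
    {q : MvPolynomial (Fin 3) k} (hq : q.IsHomogeneous n) :
    q ∈ Ideal.span {l ^ (a + 1), f₃ ^ (b + 1), f₅ ^ (c + 1)} := by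
  have h3 (b : ℕ) : (f₃ ^ b).IsHomogeneous (3 * b) := H.cubic.pow b
  have h5 (b : ℕ) : (f₅ ^ b).IsHomogeneous (5 * b) := H.quintic.pow b
  have h1 (b : ℕ) : (l ^ b).IsHomogeneous (1 * b) := H.line.pow b
  have hc (c : ℕ) : ∀ (n : ℕ) (_ : 1 + 3 + 5 * (c + 1) ≤ n + 2)
      (q : MvPolynomial (Fin 3) k) (_ : q.IsHomogeneous n),
      q ∈ Ideal.span {l, f₃, f₅ ^ (c + 1)} := by
    induction c with
    | zero =>
      intro n hn q hq
      simpa using H.mem_span_of_seven_le (by omega) hq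
    | succ c ih =>
      intro n hn q hq
      have hp (e : MvPolynomial (Fin 3) k) :
          ({l, f₃, e} : Set (MvPolynomial (Fin 3) k)) = {e, l, f₃} := by
        rw [Set.insert_comm e, Set.pair_comm e]
      have := ih n (by omega) q hq
      rw [hp] at this ⊢
      rw [pow_succ]
      refine mem_span_of_mul_mem (h5 _) H.line H.cubic hq this fun α hα => ?_
      rw [← hp]
      exact H.mem_span_of_seven_le (by omega) hα
  have hb (b : ℕ) : ∀ (n : ℕ) (_ : 1 + 3 * (b + 1) + 5 * (c + 1) ≤ n + 2)
      (q : MvPolynomial (Fin 3) k) (_ : q.IsHomogeneous n),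
      q ∈ Ideal.span {l, f₃ ^ (b + 1), f₅ ^ (c + 1)} := by
    induction b with
    | zero =>
      intro n hn q hq
      simpa using hc c n (by omega) q hq
    | succ b ih =>
      intro n hn q hq
      have := ih n (by omega) q hq
      rw [Set.insert_comm] at this ⊢
      rw [pow_succ f₃]
      refine mem_span_of_mul_mem (h3 _) H.line (h5 _) hq this fun α hα => ?_
      rw [Set.insert_comm]
      exact hc c _ (by omega) α hα
  induction a generalizing n q with
  | zero => simpa using hb b n (by omega) q hq
  | succ a ih =>
    rw [pow_succ l]
    exact mem_span_of_mul_mem (h1 _) (h3 _) (h5 _) hq (ih (by omega) hq) fun α hα =>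
      hb b _ (by omega) α hα

/-- Every form of degree `9 k + 6` is a multiple of `(l f₃ f₅) ^ k` modulo the powers of the three
forms. -/
theorem exists_sextic {m : ℕ} {q : MvPolynomial (Fin 3) k} (hq : q.IsHomogeneous (9 * m + 6)) :
    ∃ r : MvPolynomial (Fin 3) k, r.IsHomogeneous 6 ∧
      q - r * (l * f₃ * f₅) ^ m ∈ Ideal.span {l ^ (m + 1), f₃ ^ (m + 1), f₅ ^ (m + 1)} := by
  have h3 (b : ℕ) : (f₃ ^ b).IsHomogeneous (3 * b) := H.cubic.pow b
  have h5 (b : ℕ) : (f₅ ^ b).IsHomogeneous (5 * b) := H.quintic.pow b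
  have h1 (b : ℕ) : (l ^ b).IsHomogeneous (1 * b) := H.line.pow b
  cases m with
  | zero => exact ⟨q, hq, by simp⟩
  | succ m =>
    -- The factors `f₅ ^ (m + 1)`, `f₃ ^ (m + 1)` and `l ^ (m + 1)` are peeled off one after the
    -- other. Every other term is divisible by an `(m + 2)`-nd power of one of the forms, and the
    -- last coefficient has degree 6.
    obtain ⟨a, b, γ, -, -, hγ, rfl⟩ := exists_isHomogeneous_of_mem_span (h1 (m + 1 + 1))
      (h3 (m + 1 + 1)) (h5 (m + 1)) hq (H.mem_span_pow (by omega) hq)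
    obtain ⟨a', δ, c', -, hδ, -, rfl⟩ := exists_isHomogeneous_of_mem_span (h1 (m + 1 + 1))
      (h3 (m + 1)) (h5 (0 + 1)) hγ (H.mem_span_pow (by omega) hγ)
    obtain ⟨r, b'', c'', hr, -, -, rfl⟩ := exists_isHomogeneous_of_mem_span (h1 (m + 1))
      (h3 (0 + 1)) (h5 (0 + 1)) hδ (H.mem_span_pow (by omega) hδ)
    refine ⟨r, by convert hr using 1; omega, Submodule.mem_span_triple.mpr
      ⟨a + a' * f₅ ^ (m + 1), b + b'' * f₅ ^ (m + 1),
        c' + c'' * f₃ ^ (m + 1), ?_⟩⟩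
    simp only [smul_eq_mul]
    ring

omit H in
-- The only syzygies of a coprime pair are the Koszul ones.
theorem _root_.IsRelPrime.exists_eq_of_mul_add_mul_eq_zero {R : Type} [CommRing R] [IsDomain R]
    [DecompositionMonoid R] {g h a b : R} (hgh : IsRelPrime g h) (hg : g ≠ 0)
    (H : a * g + b * h = 0) : ∃ c, a = c * h ∧ b = -(c * g) := by
  obtain ⟨c, rfl⟩ : g ∣ b := hgh.dvd_of_dvd_mul_right ⟨-a, by linear_combination H⟩
  refine ⟨-c, mul_right_cancel₀ hg ?_, by ring⟩
  linear_combination H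

/-- A combination of `f₃ ^ m` and `f₅ ^ n` divisible by `l` restricts to a syzygy on the line, which
is Koszul. Subtracting its lift makes both coefficients divisible by `l`, so one factor `l` cancels.
-/
theorem mem_span_pair_of_mul {m n a : ℕ} {u : MvPolynomial (Fin 3) k}
    (h : l ^ a * u ∈ Ideal.span {f₃ ^ m, f₅ ^ n}) : u ∈ Ideal.span {f₃ ^ m, f₅ ^ n} := by
  obtain ⟨π, σ, E⟩ := H.exists_isElimination
  induction a with
  | zero => simpa using h
  | succ a ih =>
    apply ih
    obtain ⟨α, β, hαβ⟩ := Ideal.mem_span_pair.mp h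
    have h0 : π α * π f₃ ^ m + π β * π f₅ ^ n = 0 := by
      rw [← map_pow, ← map_pow, ← map_mul, ← map_mul, ← map_add, hαβ, pow_succ, map_mul, map_mul,
        E.map_line, mul_zero, zero_mul]
    obtain ⟨c, hc₁, hc₂⟩ := (E.isRelPrime.pow (m := m) (n := n)).exists_eq_of_mul_add_mul_eq_zero
      (pow_ne_zero _ E.cubic_ne_zero) h0
    obtain ⟨α', hα⟩ := E.dvd_of_map_eq_zero (q := α - σ c * f₅ ^ n) (by simp [E.right_inv, hc₁])
    obtain ⟨β', hβ⟩ := E.dvd_of_map_eq_zero (q := β + σ c * f₃ ^ m) (by simp [E.right_inv, hc₂])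
    refine Ideal.mem_span_pair.mpr ⟨α', β', mul_left_cancel₀ H.ne_zero ?_⟩
    linear_combination hαβ - f₃ ^ m * hα - f₅ ^ n * hβ

/-- First `l ^ m` is cancelled; on the line coprimality then makes the two coefficients divisible by
`f₃ ^ m` and `f₅ ^ m`, and division leaves an expression for `q`. This gives injectivity of the map
from sextics to H². -/
theorem mem_span_of_mul_pow_mem {m : ℕ} {q : MvPolynomial (Fin 3) k}
    (h : q * (l * f₃ * f₅) ^ m ∈ Ideal.span {l ^ (m + 1), f₃ ^ (m + 1), f₅ ^ (m + 1)}) :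
    q ∈ Ideal.span {l, f₃, f₅} := by
  obtain ⟨π, σ, E⟩ := H.exists_isElimination
  obtain ⟨a, b, c, habc⟩ := Submodule.mem_span_triple.mp h
  simp only [smul_eq_mul] at habc
  obtain ⟨b', c', hbc⟩ := Ideal.mem_span_pair.mp (H.mem_span_pair_of_mul (a := m) (m := m + 1) (n := m + 1)
    (u := q * (f₃ * f₅) ^ m - a * l) (Ideal.mem_span_pair.mpr ⟨b, c, by
      linear_combination habc⟩))
  have h1 : π b' * π f₃ ^ (m + 1) + π c' * π f₅ ^ (m + 1) = π q * (π f₃ * π f₅) ^ m := by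
    have := congrArg π hbc
    simpa [E.map_line] using this
  obtain ⟨v, hv⟩ : π f₃ ^ m ∣ π c' :=
    (E.isRelPrime.pow (m := m) (n := m + 1)).dvd_of_dvd_mul_right
      ⟨π q * π f₅ ^ m - π b' * π f₃, by linear_combination h1⟩
  have hE := E.isRelPrime
  -- If the quintic vanishes on the line, the cubic is coprime to zero, hence a unit there, and the
  -- claim is immediate. Otherwise powers of `π f₅` can be cancelled.
  rcases eq_or_ne (π f₅) 0 with h0 | h0
  · have hu : IsUnit (π f₃) := E.isRelPrime dvd_rfl (h0 ▸ dvd_zero _)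
    obtain ⟨u, hu⟩ := hu.dvd (a := π q)
    simpa using E.mem_span (a := 1) (b := 1) (u := u) (v := 0) (by rw [hu]; ring)
  obtain ⟨u, hu⟩ : π f₅ ^ m ∣ π b' :=
    (E.isRelPrime.symm.pow (m := m) (n := m + 1)).dvd_of_dvd_mul_right
      ⟨π q * π f₃ ^ m - π c' * π f₅, by linear_combination h1⟩
  have h2 : π q = u * π f₃ ^ 1 + v * π f₅ ^ 1 := by
    apply mul_left_cancel₀ (mul_ne_zero (pow_ne_zero m E.cubic_ne_zero) (pow_ne_zero m h0))
    rw [hu, hv] at h1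
    linear_combination -h1
  simpa using E.mem_span h2

/-- Used to see that the three open sets of the covering are distinct. -/
theorem exists_sextic_notMem : ∃ q : MvPolynomial (Fin 3) k, q.IsHomogeneous 6 ∧
    q ∉ Ideal.span {l, f₃, f₅} := by
  obtain ⟨π, σ, E⟩ := H.exists_isElimination
  obtain ⟨q, hq, hq'⟩ := exists_sextic_not_combination (E.map_mem 3 _ H.cubic)
    (E.map_mem 5 _ H.quintic)
  refine ⟨σ q, E.lift_mem 6 _ hq, fun h => ?_⟩
  obtain ⟨a, u, v, -, hu, hv, huv⟩ := exists_isHomogeneous_of_mem_span H.line H.cubic H.quintic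
    (E.lift_mem 6 _ hq) h
  refine hq' (π u) (π v) (E.map_mem 3 _ hu) (E.map_mem 1 _ hv) ?_
  rw [← E.right_inv q, huv]
  simp only [map_add, map_mul, E.map_line]
  ring

end IsCompleteIntersection

end TernaryForms

end

noncomputable section

/-! ### The coordinate ring as a free module over the polynomial ring -/

namespace DoublePlane

/-- The inclusion of `R[x, y, z]`. -/
def base (R : Type) [CommRing R] (f : Form 6) : MvPolynomial (Fin 3) R →+* CoordRing R f :=
  (Ideal.Quotient.mk (relIdeal R f)).comp
    (rename Fin.castSucc : MvPolynomial (Fin 3) R →ₐ[R] MvPolynomial (Fin 4) R).toRingHom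

/-- The reduction of an integral polynomial. -/
abbrev intMap (R : Type) [CommRing R] : MvPolynomial (Fin 3) ℤ →+* MvPolynomial (Fin 3) R :=
  MvPolynomial.map (Int.castRingHom R)

variable {R T : Type} [CommRing R] [CommRing T] {f : Form 6}

theorem coe_eq (q : MvPolynomial (Fin 3) ℤ) : coe R f q = base R f (intMap R q) := rfl

theorem base_mem {n : ℕ} {a : MvPolynomial (Fin 3) R} (ha : a.IsHomogeneous n) :
    base R f a ∈ grading R f n := by
  refine ⟨_, ?_, rfl⟩
  change IsWeightedHomogeneous wt (rename Fin.castSucc a) n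
  intro m hm
  obtain ⟨u, rfl, hu⟩ := coeff_rename_ne_zero _ _ _ hm
  have h := ha hu
  rw [← h]
  rw [Finsupp.weight_apply, Finsupp.sum_mapDomain_index (by simp) (by intros; simp [add_mul]),
    Finsupp.weight_apply]
  refine Finsupp.sum_congr fun i _ => ?_
  fin_cases i <;> simp [wt]

theorem w_sq : w R f ^ 2 = base R f (intMap R f) := by
  rw [← coe_eq, ← sub_eq_zero]
  change Ideal.Quotient.mk (relIdeal R f) (X 3 ^ 2 - toPoly R f) = 0
  exact Ideal.Quotient.eq_zero_iff_mem.mpr (Ideal.mem_span_singleton_self _)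

theorem exists_base (x : CoordRing R f) : ∃ a b, x = base R f a + base R f b * w R f := by
  obtain ⟨P, rfl⟩ := Ideal.Quotient.mk_surjective x
  induction P using MvPolynomial.induction_on with
  | C r => exact ⟨C r, 0, by simp [base]⟩
  | add P Q hP hQ =>
    obtain ⟨a, b, hP⟩ := hP
    obtain ⟨c, d, hQ⟩ := hQ
    exact ⟨a + c, b + d, by rw [map_add, hP, hQ, map_add, map_add]; ring⟩
  | mul_X P i hP =>
    obtain ⟨a, b, hP⟩ := hP
    induction i using Fin.lastCases with
    | last =>
      refine ⟨b * intMap R f, a, ?_⟩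
      rw [map_mul, hP, map_mul, ← w_sq]
      change _ * w R f = _
      ring
    | cast i =>
      refine ⟨a * X i, b * X i, ?_⟩
      have : Ideal.Quotient.mk (relIdeal R f) (X (Fin.castSucc i)) = base R f (X i) := by
        simp [base]
      rw [map_mul, hP, this, map_mul, map_mul]
      ring

variable (R f) in
/-- Elimination of the powers of `w` from a polynomial. -/
def polyCoords :
    MvPolynomial (Fin 4) R →ₐ[R] QuadraticAlgebra (MvPolynomial (Fin 3) R) (intMap R f) 0 :=
  aeval (Fin.lastCases (motive := fun _ => QuadraticAlgebra (MvPolynomial (Fin 3) R) (intMap R f) 0)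
    ⟨0, 1⟩ fun i => algebraMap (MvPolynomial (Fin 3) R) _ (X i))

theorem polyCoords_rename (a : MvPolynomial (Fin 3) R) :
    polyCoords R f (rename Fin.castSucc a) = algebraMap (MvPolynomial (Fin 3) R) _ a := by
  have : (polyCoords R f).comp (rename Fin.castSucc) =
      IsScalarTower.toAlgHom R (MvPolynomial (Fin 3) R) _ := by
    ext i : 1
    rw [AlgHom.comp_apply, rename_X, polyCoords, aeval_X, Fin.lastCases_castSucc]
    rfl
  exact DFunLike.congr_fun this a

theorem polyCoords_X : polyCoords R f (X 3) = ⟨0, 1⟩ := by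
  change polyCoords R f (X (Fin.last 3)) = _
  rw [polyCoords, aeval_X, Fin.lastCases_last]

variable (R f) in
/-- The coordinates with respect to the basis `1, w`. -/
def coords : CoordRing R f →+* QuadraticAlgebra (MvPolynomial (Fin 3) R) (intMap R f) 0 :=
  Ideal.Quotient.lift (relIdeal R f) (polyCoords R f).toRingHom (by
    suffices relIdeal R f ≤ RingHom.ker (polyCoords R f).toRingHom from fun x hx => this hx
    rw [relIdeal, Ideal.span_le, Set.singleton_subset_iff]
    change polyCoords R f (X 3 ^ 2 - rename Fin.castSucc (intMap R f)) = 0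
    rw [map_sub, polyCoords_rename, map_pow, polyCoords_X, pow_two]
    ext <;> simp)

theorem coords_base (a : MvPolynomial (Fin 3) R) : coords R f (base R f a) = ⟨a, 0⟩ :=
  polyCoords_rename a

theorem coords_w : coords R f (w R f) = ⟨0, 1⟩ :=
  polyCoords_X

theorem coords_add_mul (a b : MvPolynomial (Fin 3) R) :
    coords R f (base R f a + base R f b * w R f) = ⟨a, b⟩ := by
  rw [map_add, map_mul, coords_base, coords_base, coords_w]
  ext <;> simp

theorem base_add_mul_inj {a b c d : MvPolynomial (Fin 3) R} :
    base R f a + base R f b * w R f = base R f c + base R f d * w R f ↔ a = c ∧ b = d := by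
  refine ⟨fun h => ?_, by rintro ⟨rfl, rfl⟩; rfl⟩
  have := congrArg (coords R f) h
  rw [coords_add_mul, coords_add_mul] at this
  exact ⟨congrArg QuadraticAlgebra.re this, congrArg QuadraticAlgebra.im this⟩

theorem base_add_mul_eq_zero {a b : MvPolynomial (Fin 3) R} :
    base R f a + base R f b * w R f = 0 ↔ a = 0 ∧ b = 0 := by
  rw [← base_add_mul_inj (f := f)]
  simp

theorem exists_base_of_mem {n : ℕ} {x : CoordRing R f} (hx : x ∈ grading R f n) :
    ∃ a b : MvPolynomial (Fin 3) R, a.IsHomogeneous n ∧ b.IsHomogeneous (n - 3) ∧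
      x = base R f a + base R f b * w R f := by
  obtain ⟨a, b, rfl⟩ := exists_base x
  -- For `n < 3` the truncated `n - 3` is zero, and the constant term of `b` must not be picked up.
  refine ⟨homogeneousComponent n a, if 3 ≤ n then homogeneousComponent (n - 3) b else 0,
    homogeneousComponent_isHomogeneous _ _, ?_, ?_⟩
  · split_ifs
    · exact homogeneousComponent_isHomogeneous _ _
    · exact isHomogeneous_zero _ _ _
  have key {m : ℕ} {y : CoordRing R f} (hy : y ∈ grading R f m) :
      GradedRing.proj (grading R f) n y = if m = n then y else 0 := by
    rw [GradedRing.proj_apply]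
    split_ifs with h
    · subst h
      exact DirectSum.decompose_of_mem_same _ hy
    · exact DirectSum.decompose_of_mem_ne _ hy h
  have h1 := key hx
  rw [if_pos rfl] at h1
  rw [← h1]
  conv_lhs => rw [← sum_homogeneousComponent a, ← sum_homogeneousComponent b]
  rw [map_add, map_sum, map_sum, map_sum, Finset.sum_mul, map_sum]
  congr 1
  · rw [Finset.sum_congr rfl fun i _ => key (base_mem (homogeneousComponent_isHomogeneous i a)),
      Finset.sum_ite_eq']
    split_ifs with h
    · rfl
    · rw [homogeneousComponent_eq_zero _ _ (by simpa using h), map_zero]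
  · rw [Finset.sum_congr rfl fun i _ => key (SetLike.mul_mem_graded
      (base_mem (homogeneousComponent_isHomogeneous i b)) (w_mem R f))]
    by_cases h3 : 3 ≤ n
    · have e i : i + 3 = n ↔ i = n - 3 := by omega
      simp only [e, Finset.sum_ite_eq', if_pos h3]
      split_ifs with h
      · rfl
      · rw [homogeneousComponent_eq_zero _ _ (by simp at h; omega), map_zero, zero_mul]
    · rw [if_neg h3, map_zero, zero_mul]
      exact Finset.sum_eq_zero fun i _ => if_neg (by omega)

theorem base_mem_nonZeroDivisors {a : MvPolynomial (Fin 3) R}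
    (ha : a ∈ nonZeroDivisors (MvPolynomial (Fin 3) R)) :
    base R f a ∈ nonZeroDivisors (CoordRing R f) := by
  rw [mem_nonZeroDivisors_iff_right] at ha ⊢
  intro x hx
  obtain ⟨c, d, rfl⟩ := exists_base x
  rw [add_mul, mul_right_comm, ← map_mul, ← map_mul, base_add_mul_eq_zero] at hx
  rw [ha _ hx.1, ha _ hx.2]
  simp

theorem coeffMap_base (φ : R →+* T) (a : MvPolynomial (Fin 3) R) :
    coeffMap φ f (base R f a) = base T f (MvPolynomial.map φ a) := by
  change Ideal.Quotient.mk (relIdeal T f) (MvPolynomial.map φ (rename Fin.castSucc a)) = _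
  rw [map_rename]
  rfl

theorem coeffMap_w (φ : R →+* T) : coeffMap φ f (w R f) = w T f := by
  change Ideal.Quotient.mk (relIdeal T f) (MvPolynomial.map φ (X 3)) = _
  rw [map_X]
  rfl

theorem coeffMap_coe (φ : R →+* T) (q : MvPolynomial (Fin 3) ℤ) :
    coeffMap φ f (coe R f q) = coe T f q := by
  rw [coe_eq, coe_eq, coeffMap_base, MvPolynomial.map_map,
    Subsingleton.elim (φ.comp (Int.castRingHom R)) (Int.castRingHom T)]

theorem exists_map_eq (φ : R →+* T) (hφ : Function.Surjective φ) {n : ℕ}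
    {a : MvPolynomial (Fin 3) T} (ha : a.IsHomogeneous n) :
    ∃ b : MvPolynomial (Fin 3) R, b.IsHomogeneous n ∧ MvPolynomial.map φ b = a := by
  classical
  obtain ⟨b, rfl⟩ := MvPolynomial.map_surjective φ hφ a
  refine ⟨homogeneousComponent n b, homogeneousComponent_isHomogeneous _ _, ?_⟩
  rw [← homogeneousComponent_eq_self ha]
  ext m
  simp only [coeff_map, coeff_homogeneousComponent]
  split_ifs <;> simp

theorem exists_coeffMap_eq (φ : R →+* T) (hφ : Function.Surjective φ) {n : ℕ} {x : CoordRing T f}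
    (hx : x ∈ grading T f n) : ∃ y ∈ grading R f n, coeffMap φ f y = x := by
  obtain ⟨P, hP, rfl⟩ := hx
  obtain ⟨Q, rfl⟩ := MvPolynomial.map_surjective φ hφ P
  refine ⟨_, ⟨weightedHomogeneousComponent wt n Q,
    weightedHomogeneousComponent_isWeightedHomogeneous _ _, rfl⟩, ?_⟩
  change Ideal.Quotient.mk _ (MvPolynomial.map φ (weightedHomogeneousComponent wt n Q)) = 
    Ideal.Quotient.mk _ (MvPolynomial.map φ Q)
  congr 1
  have hP : weightedHomogeneousComponent wt n (MvPolynomial.map φ Q) = MvPolynomial.map φ Q :=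
    weightedHomogeneousComponent_eq_self hP
  rw [← hP]
  classical
  ext m
  simp only [coeff_map, coeff_weightedHomogeneousComponent]
  split_ifs <;> simp

/-! ### Reduction from ℤ/p² to 𝔽_p and flatness of the coordinate ring. -/

section Reduction

variable (p : ℕ) [Fact p.Prime]

/-- The reduction `ℤ/p² → 𝔽_p`. -/
abbrev red : ZMod (p ^ 2) →+* ZMod p := ZMod.castHom (dvd_pow_self p two_ne_zero) (ZMod p)

theorem red_eq_zero_iff (c : ZMod (p ^ 2)) : red p c = 0 ↔ ∃ d, c = p * d := by
  have hp : p ≠ 0 := (Fact.out : p.Prime).ne_zero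
  have : NeZero (p ^ 2) := ⟨pow_ne_zero 2 hp⟩
  obtain ⟨n, rfl⟩ := ZMod.natCast_zmod_surjective c
  rw [map_natCast, ZMod.natCast_eq_zero_iff]
  constructor
  · rintro ⟨m, rfl⟩
    exact ⟨m, by push_cast; rfl⟩
  · rintro ⟨d, hd⟩
    obtain ⟨m, rfl⟩ := ZMod.natCast_zmod_surjective d
    rw [← Nat.cast_mul, ZMod.natCast_eq_natCast_iff] at hd
    have := (hd.of_dvd (dvd_pow_self p two_ne_zero)).dvd_iff dvd_rfl
    exact this.mpr (dvd_mul_right _ _)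

theorem p_mul_eq_zero_iff (c : ZMod (p ^ 2)) : (p : ZMod (p ^ 2)) * c = 0 ↔ red p c = 0 := by
  have hp : p ≠ 0 := (Fact.out : p.Prime).ne_zero
  have : NeZero (p ^ 2) := ⟨pow_ne_zero 2 hp⟩
  obtain ⟨n, rfl⟩ := ZMod.natCast_zmod_surjective c
  rw [map_natCast, ZMod.natCast_eq_zero_iff, ← Nat.cast_mul, ZMod.natCast_eq_zero_iff, pow_two,
    Nat.mul_dvd_mul_iff_left (Nat.pos_of_ne_zero hp)]

variable {p}

theorem map_red_eq_zero {a : MvPolynomial (Fin 3) (ZMod (p ^ 2))} {n : ℕ} (ha : a.IsHomogeneous n)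
    (h : MvPolynomial.map (red p) a = 0) :
    ∃ b : MvPolynomial (Fin 3) (ZMod (p ^ 2)), b.IsHomogeneous n ∧ a = (p : MvPolynomial (Fin 3) (ZMod (p ^ 2))) * b := by
  classical
  have hc m : ∃ d, a.coeff m = p * d := by
    rw [← red_eq_zero_iff, ← coeff_map, h, coeff_zero]
  choose d hd using hc
  refine ⟨homogeneousComponent n (∑ m ∈ a.support, monomial m (d m)),
    homogeneousComponent_isHomogeneous _ _, ?_⟩
  have e : a = (p : MvPolynomial (Fin 3) (ZMod (p ^ 2))) * ∑ m ∈ a.support, monomial m (d m) := by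
    conv_lhs => rw [a.as_sum]
    rw [Finset.mul_sum]
    refine Finset.sum_congr rfl fun m _ => ?_
    rw [← map_natCast (C : ZMod (p ^ 2) →+* _), C_mul_monomial, hd]
  rw [← map_natCast (C : ZMod (p ^ 2) →+* _), ← homogeneousComponent_C_mul, map_natCast, ← e,
    homogeneousComponent_eq_self ha]

/-- By freeness with basis `1, w`, divisibility by `p` is decided on coefficients; projection to
degree `n` makes the quotient homogeneous. -/
theorem exists_eq_p_mul {n : ℕ} {x : CoordRing (ZMod (p ^ 2)) f}
    (hx : x ∈ grading (ZMod (p ^ 2)) f n) (h : coeffMap (red p) f x = 0) :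
    ∃ y ∈ grading (ZMod (p ^ 2)) f n, x = (p : CoordRing (ZMod (p ^ 2)) f) * y := by
  obtain ⟨a, b, ha, hb, e⟩ := exists_base_of_mem hx
  have e' := e
  rw [e, map_add, map_mul, coeffMap_base, coeffMap_base, coeffMap_w, base_add_mul_eq_zero] at h
  obtain ⟨a', ha', ea⟩ := map_red_eq_zero ha h.1
  obtain ⟨b', -, eb⟩ := map_red_eq_zero hb h.2
  have e2 : x = (p : CoordRing (ZMod (p ^ 2)) f) * (base _ f a' + base _ f b' * w _ f) := by
    rw [e, ea, eb, map_mul, map_mul, map_natCast]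
    ring
  refine ⟨GradedRing.proj _ n (base _ f a' + base _ f b' * w _ f), SetLike.coe_mem _, ?_⟩
  have h1 : GradedRing.proj (grading (ZMod (p ^ 2)) f) n x = x := by
    rw [GradedRing.proj_apply]
    exact DirectSum.decompose_of_mem_same _ hx
  rw [← h1]
  conv_lhs => rw [e2]
  rw [← nsmul_eq_mul, map_nsmul, nsmul_eq_mul]

/-- On coefficients, `p c = 0` in `ℤ/p²` means that `c` reduces to zero. With `exists_eq_p_mul` this
is flatness over `ℤ/p²`. -/
theorem coeffMap_eq_zero_of_p_mul {x : CoordRing (ZMod (p ^ 2)) f} (h : (p : CoordRing (ZMod (p ^ 2)) f) * x = 0) :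
    coeffMap (red p) f x = 0 := by
  obtain ⟨a, b, rfl⟩ := exists_base x
  have hz (a : MvPolynomial (Fin 3) (ZMod (p ^ 2))) (h : (p : MvPolynomial (Fin 3) (ZMod (p ^ 2))) * a = 0) :
      MvPolynomial.map (red p) a = 0 := by
    ext m
    rw [coeff_map, coeff_zero, ← p_mul_eq_zero_iff, ← coeff_C_mul, map_natCast, h, coeff_zero]
  rw [mul_add, ← mul_assoc, ← map_natCast (base _ f), ← map_mul, ← map_mul,
    base_add_mul_eq_zero] at h
  rw [map_add, map_mul, coeffMap_base, coeffMap_base, hz a h.1, hz b h.2]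
  simp

end Reduction

end DoublePlane

end

noncomputable section

/-! ### Sections on the intersection of three basic open sets -/

namespace ProjFraction

open Cech

variable {A : Type} [CommRing A] {σ : Type} [SetLike σ A] [AddSubgroupClass σ A] {𝒜 : ℕ → σ}
  [GradedRing 𝒜] {U V : (Proj 𝒜).Opens} {a b c d : A} {m n : ℕ}

theorem le_basicOpen_mul (ha : U ≤ Proj.basicOpen 𝒜 a) (hb : U ≤ Proj.basicOpen 𝒜 b) :
    U ≤ Proj.basicOpen 𝒜 (a * b) := by
  rw [Proj.basicOpen_mul]; exact le_inf ha hb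

theorem le_basicOpen_pow (ha : U ≤ Proj.basicOpen 𝒜 a) (n : ℕ) :
    U ≤ Proj.basicOpen 𝒜 (a ^ n) := by
  rcases n.eq_zero_or_pos with rfl | h
  · simp
  · rwa [Proj.basicOpen_pow _ _ _ h]

omit [CommRing A] [AddSubgroupClass σ A] [GradedRing 𝒜] in
theorem mem_of_eq (h : a ∈ 𝒜 m) (e : m = n) : a ∈ 𝒜 n := e ▸ h

/-- The powers that a localization introduces cancel, because all denominators are nonzerodivisors.
-/
theorem eq_of_fr_eq {e : A} {k : ℕ} (he : e ∈ 𝒜 k) (hk : 0 < k) (hU : U ≤ Proj.basicOpen 𝒜 e)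
    (hU' : Proj.basicOpen 𝒜 e ≤ U) (he' : e ∈ nonZeroDivisors A)
    (ha : a ∈ 𝒜 n) (hb : b ∈ 𝒜 n) (h : U ≤ Proj.basicOpen 𝒜 b)
    (hc : c ∈ 𝒜 m) (hd : d ∈ 𝒜 m) (h' : U ≤ Proj.basicOpen 𝒜 d) (hb' : b ∈ nonZeroDivisors A)
    (hd' : d ∈ nonZeroDivisors A) (H : fr 𝒜 a b ha hb h = fr 𝒜 c d hc hd h') :
    a * d = c * b := by
  have hbd := SetLike.mul_mem_graded hb hd
  have hcb : c * b ∈ 𝒜 (n + m) := mem_of_eq (SetLike.mul_mem_graded hc hb) (add_comm _ _)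
  have e1 : fr 𝒜 (a * d - c * b) (b * d) (sub_mem (SetLike.mul_mem_graded ha hd) hcb) hbd
      (le_basicOpen_mul h h') = 0 := by
    rw [← fr_sub (SetLike.mul_mem_graded ha hd) hbd _ hcb, sub_eq_zero,
      ← fr_eq ha hb h _ _ _ (by ring), H]
    exact fr_eq _ _ _ _ _ _ (by ring)
  obtain ⟨N, hN⟩ := exists_pow_mul_eq_zero he hk hU hU' _ hbd _ e1
  rw [← sub_eq_zero]
  exact (mul_left_mem_nonZeroDivisors_eq_zero_iff
    (mul_mem (pow_mem he' N) (pow_mem (mul_mem hb' hd') _))).mp hN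

variable {W : Fin 3 → (Proj 𝒜).Opens} {e : Fin 3 → A} {δ : Fin 3 → ℕ} (he : ∀ i, e i ∈ 𝒜 (δ i))

include he

/-- The hypothesis `H` is `a/b = a₀/(e₁e₂)^N + a₁/(e₀e₂)^N + a₂/(e₀e₁)^N` with denominators cleared.
-/
theorem fr_mem_pairSum (hW : ∀ i, W i ≤ Proj.basicOpen 𝒜 (e i)) {N : ℕ} {a₀ a₁ a₂ : A}
    (h₀ : a₀ ∈ 𝒜 (N • (δ 1 + δ 2))) (h₁ : a₁ ∈ 𝒜 (N • (δ 0 + δ 2)))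
    (h₂ : a₂ ∈ 𝒜 (N • (δ 0 + δ 1))) (ha : a ∈ 𝒜 n) (hb : b ∈ 𝒜 n)
    (h : W 0 ⊓ W 1 ⊓ W 2 ≤ Proj.basicOpen 𝒜 b)
    (H : a * (e 0 * e 1 * e 2) ^ N = (a₀ * e 0 ^ N + a₁ * e 1 ^ N + a₂ * e 2 ^ N) * b) :
    fr 𝒜 a b ha hb h ∈ pairSum W := by
  have hp i j : (e i * e j) ^ N ∈ 𝒜 (N • (δ i + δ j)) :=
    SetLike.pow_mem_graded N (SetLike.mul_mem_graded (he i) (he j))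
  have hD i j : W i ⊓ W j ≤ Proj.basicOpen 𝒜 ((e i * e j) ^ N) :=
    le_basicOpen_pow (le_basicOpen_mul (le_trans leI (hW i)) (le_trans leI (hW j))) N
  rw [mem_pairSum]
  refine ⟨fr 𝒜 a₀ _ h₀ (hp 1 2) (hD 1 2), fr 𝒜 a₁ _ h₁ (hp 0 2) (hD 0 2),
    fr 𝒜 a₂ _ h₂ (hp 0 1) (hD 0 1), ?_⟩
  have hE : (e 0 * e 1 * e 2) ^ N ∈ 𝒜 (N • (δ 0 + δ 1 + δ 2)) :=
    SetLike.pow_mem_graded N (SetLike.mul_mem_graded (SetLike.mul_mem_graded (he 0) (he 1)) (he 2))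
  have hDE : W 0 ⊓ W 1 ⊓ W 2 ≤ Proj.basicOpen 𝒜 ((e 0 * e 1 * e 2) ^ N) :=
    le_basicOpen_pow (le_basicOpen_mul (le_basicOpen_mul (le_trans leI (hW 0)) (le_trans leI (hW 1)))
      (le_trans leI (hW 2))) N
  have k₀ : a₀ * e 0 ^ N ∈ 𝒜 (N • (δ 0 + δ 1 + δ 2)) :=
    mem_of_eq (SetLike.mul_mem_graded h₀ (SetLike.pow_mem_graded N (he 0)))
      (by simp only [smul_eq_mul]; ring)
  have k₁ : a₁ * e 1 ^ N ∈ 𝒜 (N • (δ 0 + δ 1 + δ 2)) :=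
    mem_of_eq (SetLike.mul_mem_graded h₁ (SetLike.pow_mem_graded N (he 1)))
      (by simp only [smul_eq_mul]; ring)
  have k₂ : a₂ * e 2 ^ N ∈ 𝒜 (N • (δ 0 + δ 1 + δ 2)) :=
    mem_of_eq (SetLike.mul_mem_graded h₂ (SetLike.pow_mem_graded N (he 2)))
      (by simp only [smul_eq_mul]; ring)
  rw [res_fr, res_fr, res_fr, fr_eq h₀ _ _ k₀ hE hDE (by ring), fr_eq h₁ _ _ k₁ hE hDE (by ring),
    fr_eq h₂ _ _ k₂ hE hDE (by ring), fr_add, fr_add]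
  exact fr_eq _ _ _ _ _ _ H

theorem exists_of_mem_pairSum (hδ : ∀ i, 0 < δ i) (hW : ∀ i, W i ≤ Proj.basicOpen 𝒜 (e i))
    (hW' : ∀ i, Proj.basicOpen 𝒜 (e i) ≤ W i) {t : Γ(Proj 𝒜, W 0 ⊓ W 1 ⊓ W 2)}
    (ht : t ∈ pairSum W) :
    ∃ N₀, ∀ N ≥ N₀, ∃ a₀ a₁ a₂ : A, ∃ (hE : (e 0 * e 1 * e 2) ^ N ∈ 𝒜 (N • (δ 0 + δ 1 + δ 2)))
      (ha : a₀ * e 0 ^ N + a₁ * e 1 ^ N + a₂ * e 2 ^ N ∈ 𝒜 (N • (δ 0 + δ 1 + δ 2)))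
      (hD : W 0 ⊓ W 1 ⊓ W 2 ≤ Proj.basicOpen 𝒜 ((e 0 * e 1 * e 2) ^ N)),
      t = fr 𝒜 _ _ ha hE hD := by
  obtain ⟨a, b, c, rfl⟩ := mem_pairSum.mp ht
  have hm i j : e i * e j ∈ 𝒜 (δ i + δ j) := SetLike.mul_mem_graded (he i) (he j)
  have hmD i j : W i ⊓ W j ≤ Proj.basicOpen 𝒜 (e i * e j) :=
    le_basicOpen_mul (le_trans leI (hW i)) (le_trans leI (hW j))
  have hmD' i j : Proj.basicOpen 𝒜 (e i * e j) ≤ W i ⊓ W j := by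
    rw [Proj.basicOpen_mul]
    exact inf_le_inf (hW' i) (hW' j)
  obtain ⟨N₀, H₀⟩ := exists_fr (hm 1 2) (Nat.add_pos_left (hδ _) _) (hmD 1 2) (hmD' 1 2) a
  obtain ⟨N₁, H₁⟩ := exists_fr (hm 0 2) (Nat.add_pos_left (hδ _) _) (hmD 0 2) (hmD' 0 2) b
  obtain ⟨N₂, H₂⟩ := exists_fr (hm 0 1) (Nat.add_pos_left (hδ _) _) (hmD 0 1) (hmD' 0 1) c
  refine ⟨N₀ + N₁ + N₂, fun N hN => ?_⟩
  obtain ⟨a₀, h₀, rfl⟩ := H₀ N (by omega)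
  obtain ⟨a₁, h₁, rfl⟩ := H₁ N (by omega)
  obtain ⟨a₂, h₂, rfl⟩ := H₂ N (by omega)
  have hE : (e 0 * e 1 * e 2) ^ N ∈ 𝒜 (N • (δ 0 + δ 1 + δ 2)) :=
    SetLike.pow_mem_graded N (SetLike.mul_mem_graded (SetLike.mul_mem_graded (he 0) (he 1)) (he 2))
  have hDE : W 0 ⊓ W 1 ⊓ W 2 ≤ Proj.basicOpen 𝒜 ((e 0 * e 1 * e 2) ^ N) :=
    le_basicOpen_pow (le_basicOpen_mul (le_basicOpen_mul (le_trans leI (hW 0)) (le_trans leI (hW 1)))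
      (le_trans leI (hW 2))) N
  have k₀ : a₀ * e 0 ^ N ∈ 𝒜 (N • (δ 0 + δ 1 + δ 2)) :=
    mem_of_eq (SetLike.mul_mem_graded h₀ (SetLike.pow_mem_graded N (he 0)))
      (by simp only [smul_eq_mul]; ring)
  have k₁ : a₁ * e 1 ^ N ∈ 𝒜 (N • (δ 0 + δ 1 + δ 2)) :=
    mem_of_eq (SetLike.mul_mem_graded h₁ (SetLike.pow_mem_graded N (he 1)))
      (by simp only [smul_eq_mul]; ring)
  have k₂ : a₂ * e 2 ^ N ∈ 𝒜 (N • (δ 0 + δ 1 + δ 2)) :=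
    mem_of_eq (SetLike.mul_mem_graded h₂ (SetLike.pow_mem_graded N (he 2)))
      (by simp only [smul_eq_mul]; ring)
  refine ⟨a₀, a₁, a₂, hE, add_mem (add_mem k₀ k₁) k₂, hDE, ?_⟩
  rw [res_fr, res_fr, res_fr, fr_eq h₀ _ _ k₀ hE hDE (by ring), fr_eq h₁ _ _ k₁ hE hDE (by ring),
    fr_eq h₂ _ _ k₂ hE hDE (by ring), fr_add, fr_add]

end ProjFraction

/-! ### The covering of the surface -/

namespace DoublePlane

variable {R : Type} [CommRing R] {f : Form 6}

/-- If `x, y, z` all vanished at a point, so would `w`, since `w² = f`, and the prime would contain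
the irrelevant ideal. -/
theorem exists_base_X_notMem (x : surface R f) :
    ∃ i, base R f (X i) ∉ x.asHomogeneousIdeal := by
  by_contra! H
  have : x.asHomogeneousIdeal.toIdeal.IsPrime := x.isPrime
  have hbase {n : ℕ} (hn : n ≠ 0) {a : MvPolynomial (Fin 3) R} (ha : a.IsHomogeneous n) :
      base R f a ∈ x.asHomogeneousIdeal.toIdeal := by
    rw [← Ideal.Quotient.eq_zero_iff_mem]
    let ψ := (Ideal.Quotient.mk x.asHomogeneousIdeal.toIdeal).comp (base R f)
    have hψ : ψ = (ψ.comp C).comp constantCoeff := by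
      refine MvPolynomial.ringHom_ext (fun r => by simp) fun i => ?_
      simp only [RingHom.comp_apply, constantCoeff_X, map_zero]
      exact Ideal.Quotient.eq_zero_iff_mem.mpr (H i)
    change ψ a = 0
    have h0 : constantCoeff a = 0 := by
      rw [constantCoeff_eq]
      exact ha.coeff_eq_zero (by simpa using Ne.symm hn)
    rw [hψ, RingHom.comp_apply, h0, map_zero]
  have hw : w R f ∈ x.asHomogeneousIdeal.toIdeal := by
    refine this.mem_of_pow_mem 2 ?_
    rw [w_sq]
    exact hbase (n := 6) (by norm_num) (IsHomogeneous.map f.2 _)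
  refine x.not_irrelevant_le ?_
  rw [HomogeneousIdeal.irrelevant_le]
  intro n hn y hy
  obtain ⟨a, b, ha, -, rfl⟩ := exists_base_of_mem hy
  exact add_mem (hbase hn.ne' ha) (Ideal.mul_mem_left _ _ hw)

theorem iSup_basicOpen_X : ⨆ i, Proj.basicOpen (grading R f) (base R f (X i)) = ⊤ := by
  refine top_le_iff.mp fun x _ => ?_
  obtain ⟨i, hi⟩ := exists_base_X_notMem x
  exact (le_iSup (fun i => Proj.basicOpen (grading R f) (base R f (X i))) i) hi

end DoublePlane

end

noncomputable section

/-! ### The second cohomology of the double plane -/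

namespace DoublePlane

open Cech ProjFraction TernaryForms

theorem intMap_isHomogeneous (R : Type) [CommRing R] {d : ℕ} (q : Form d) :
    (intMap R q).IsHomogeneous d := IsHomogeneous.map q.2 _

variable {p : ℕ} [Fact p.Prime] {f : Form 6} {l : Form 1} {f₃ : Form 3} {f₅ : Form 5} {G : Form 6}

theorem _root_.TernaryForms.IsCompleteIntersection.cubic_ne_zero {k : Type} [Field k]
    {l f₃ f₅ : MvPolynomial (Fin 3) k} (H : IsCompleteIntersection l f₃ f₅) : f₃ ≠ 0 := by
  obtain ⟨π, σ, E⟩ := H.exists_isElimination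
  rintro rfl
  exact E.cubic_ne_zero (map_zero _)

theorem _root_.TernaryForms.IsCompleteIntersection.quintic_ne_zero {k : Type} [Field k]
    {l f₃ f₅ : MvPolynomial (Fin 3) k} (H : IsCompleteIntersection l f₃ f₅) : f₅ ≠ 0 := by
  obtain ⟨π, σ, E⟩ := H.exists_isElimination
  rintro rfl
  have hu := E.isRelPrime dvd_rfl (by simp)
  exact one_ne_zero (eq_zero_of_dvd (E.map_mem 3 _ H.cubic) (isHomogeneous_one _ _) (by norm_num)
    hu.dvd)

/-- At a common zero of `ℓ, f₃, f₅` the sextic `f₃² + ℓf₅` vanishes together with its gradient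
`2f₃∇f₃ + ℓ∇f₅ + f₅∇ℓ`, against nonsingularity. The Nullstellensatz turns the absence of geometric
points into the statement on the radical. -/
theorem isCompleteIntersection (hf : NonsingularMod p f) (hl : intMap (ZMod p) l ≠ 0)
    (h : (f : MvPolynomial (Fin 3) ℤ) = f₃ ^ 2 + l * f₅ + p * G) :
    IsCompleteIntersection (intMap (ZMod p) l) (intMap (ZMod p) f₃) (intMap (ZMod p) f₅) where
  line := intMap_isHomogeneous _ l
  cubic := intMap_isHomogeneous _ f₃
  quintic := intMap_isHomogeneous _ f₅
  ne_zero := hl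
  mem_radical i := by
    rw [← vanishingIdeal_zeroLocus_eq_radical (K := AlgebraicClosure (ZMod p)),
      mem_vanishingIdeal_iff]
    intro v hv
    have hred (q : MvPolynomial (Fin 3) ℤ) : aeval v (intMap (ZMod p) q) = aeval v q := by
      rw [aeval_def, aeval_def, intMap, eval₂_map]
      congr 1
    have hz (q : MvPolynomial (Fin 3) ℤ) (hq : intMap (ZMod p) q ∈
        ({intMap (ZMod p) l, intMap (ZMod p) f₃, intMap (ZMod p) f₅} : Set _)) :
        aeval v q = 0 := by
      rw [← hred]
      exact hv _ (Ideal.subset_span hq)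
    have h₁ := hz l (by simp)
    have h₃ := hz f₃ (by simp)
    have h₅ := hz f₅ (by simp)
    rw [aeval_X]
    by_contra hvi
    obtain ⟨j, hj⟩ := hf v (fun h0 => hvi (by rw [h0]; rfl)) (by
      rw [h]
      simp [h₁, h₃])
    apply hj
    rw [h]
    simp [h₁, h₃, h₅]

section

variable (H : IsCompleteIntersection (intMap (ZMod p) l) (intMap (ZMod p) f₃)
  (intMap (ZMod p) f₅))

include H

theorem sup_openOf_eq_top :
    (openOf (ZMod p) f one_pos l : (surface (ZMod p) f).Opens) ⊔ openOf (ZMod p) f three_pos f₃ ⊔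
      openOf (ZMod p) f (Nat.succ_pos 4) f₅ = ⊤ := by
  refine top_le_iff.mp fun x _ => ?_
  by_contra hx
  have : x.asHomogeneousIdeal.toIdeal.IsPrime := x.isPrime
  simp only [Opens.mem_sup, openOf, Proj.mem_basicOpen, not_or, not_not, coe_eq] at hx
  obtain ⟨i, hi⟩ := exists_base_X_notMem x
  have hle : Ideal.span {intMap (ZMod p) l, intMap (ZMod p) f₃, intMap (ZMod p) f₅} ≤
      x.asHomogeneousIdeal.toIdeal.comap (base (ZMod p) f) := by
    rw [Ideal.span_le]
    rintro _ (rfl | rfl | rfl)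
    exacts [hx.1.1, hx.1.2, hx.2]
  have hprime := Ideal.comap_isPrime (base (ZMod p) f) x.asHomogeneousIdeal.toIdeal
  exact hi ((hprime.radical_le_iff.mpr hle) (H.mem_radical i))

omit H [Fact p.Prime] in
theorem mem_sexticIdeal {q : Form 6} : q ∈ sexticIdeal p l f₃ f₅ ↔
    intMap (ZMod p) q ∈
      Ideal.span {intMap (ZMod p) l, intMap (ZMod p) f₃, intMap (ZMod p) f₅} := by
  change (q : MvPolynomial (Fin 3) ℤ) ∈ Ideal.span {(p : MvPolynomial (Fin 3) ℤ), _, _, _} ↔ _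
  have hsurj : Function.Surjective (intMap (ZMod p)) :=
    map_surjective _ (ZMod.ringHom_surjective _)
  rw [Ideal.mem_span_insert]
  constructor
  · rintro ⟨a, z, hz, h⟩
    obtain ⟨b, c, d, rfl⟩ := Submodule.mem_span_triple.mp hz
    rw [h]
    refine Submodule.mem_span_triple.mpr ⟨intMap _ b, intMap _ c, intMap _ d, ?_⟩
    simp
  · intro h
    obtain ⟨b, c, d, h⟩ := Submodule.mem_span_triple.mp h
    obtain ⟨b, rfl⟩ := hsurj b
    obtain ⟨c, rfl⟩ := hsurj c
    obtain ⟨d, rfl⟩ := hsurj d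
    have hdvd : C (p : ℤ) ∣ (q : MvPolynomial (Fin 3) ℤ) - (b * (l : MvPolynomial (Fin 3) ℤ) +
        c * (f₃ : MvPolynomial (Fin 3) ℤ) + d * (f₅ : MvPolynomial (Fin 3) ℤ)) := by
      rw [C_dvd_iff_zmod]
      simp only [smul_eq_mul] at h
      rw [map_sub, sub_eq_zero]
      simp only [map_add, map_mul]
      exact h.symm
    obtain ⟨a, ha⟩ := hdvd
    rw [map_natCast] at ha
    refine ⟨a, _, Submodule.mem_span_triple.mpr ⟨b, c, d, rfl⟩, ?_⟩
    simp only [smul_eq_mul]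
    linear_combination ha

variable (p f l f₃ f₅) in
/-- The three open sets `ℓ ≠ 0`, `f₃ ≠ 0` and `f₅ ≠ 0`. -/
def cover : Fin 3 → (surface (ZMod p) f).affineOpens :=
  ![openOf (ZMod p) f one_pos l, openOf (ZMod p) f three_pos f₃,
    openOf (ZMod p) f (Nat.succ_pos 4) f₅]

variable (p f l f₃ f₅) in
/-- The three forms. -/
def forms : Fin 3 → CoordRing (ZMod p) f :=
  ![coe (ZMod p) f l, coe (ZMod p) f f₃, coe (ZMod p) f f₅]

omit H [Fact p.Prime] in
theorem forms_mem (i : Fin 3) : forms p f l f₃ f₅ i ∈ grading (ZMod p) f (![1, 3, 5] i) := by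
  fin_cases i
  exacts [coe_mem _ _ l, coe_mem _ _ f₃, coe_mem _ _ f₅]

omit H in
theorem cover_eq (i : Fin 3) : (cover p f l f₃ f₅ i : (surface (ZMod p) f).Opens) =
    Proj.basicOpen (grading (ZMod p) f) (forms p f l f₃ f₅ i) := by
  fin_cases i <;> rfl

omit H in
theorem forms_prod_mem : forms p f l f₃ f₅ 0 * forms p f l f₃ f₅ 1 * forms p f l f₃ f₅ 2 ∈
    grading (ZMod p) f (![1, 3, 5] 0 + ![1, 3, 5] 1 + ![1, 3, 5] 2) :=
  SetLike.mul_mem_graded (SetLike.mul_mem_graded (forms_mem 0) (forms_mem 1)) (forms_mem 2)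

omit H in
theorem inf_cover_eq :
    (cover p f l f₃ f₅ 0 : (surface (ZMod p) f).Opens) ⊓ cover p f l f₃ f₅ 1 ⊓
      cover p f l f₃ f₅ 2 = Proj.basicOpen (grading (ZMod p) f)
        (forms p f l f₃ f₅ 0 * forms p f l f₃ f₅ 1 * forms p f l f₃ f₅ 2) := by
  rw [Proj.basicOpen_mul, Proj.basicOpen_mul, cover_eq, cover_eq, cover_eq]

theorem forms_prod_mem_nonZeroDivisors :
    forms p f l f₃ f₅ 0 * forms p f l f₃ f₅ 1 * forms p f l f₃ f₅ 2 ∈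
      nonZeroDivisors (CoordRing (ZMod p) f) :=
  mul_mem (mul_mem (base_mem_nonZeroDivisors (mem_nonZeroDivisors_of_ne_zero H.ne_zero))
    (base_mem_nonZeroDivisors (mem_nonZeroDivisors_of_ne_zero H.cubic_ne_zero)))
    (base_mem_nonZeroDivisors (mem_nonZeroDivisors_of_ne_zero H.quintic_ne_zero))

end

variable (p f l f₃ f₅) in
/-- The fraction `q w / (ℓ f₃ f₅)` as a homomorphism. -/
def cechHom : Form 6 →+ Γ(surface (ZMod p) f, (cover p f l f₃ f₅ 0 :
    (surface (ZMod p) f).Opens) ⊓ cover p f l f₃ f₅ 1 ⊓ cover p f l f₃ f₅ 2) where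
  toFun := cechFraction (ZMod p) f l f₃ f₅
  map_zero' := by
    rw [← fr_zero (𝒜 := grading (ZMod p) f) (n := 9) (b := coe (ZMod p) f l * coe (ZMod p) f f₃ *
      coe (ZMod p) f f₅) (SetLike.mul_mem_graded
      (SetLike.mul_mem_graded (coe_mem _ f l) (coe_mem _ f f₃)) (coe_mem _ f f₅))
      (by rw [Proj.basicOpen_mul, Proj.basicOpen_mul]; exact le_rfl)]
    exact fr_congr _ _ _ _ (by simp)
  map_add' q r := by
    refine Eq.trans ?_ (fr_add (𝒜 := grading (ZMod p) f) _ _ _ _).symm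
    exact fr_congr _ _ _ _ (by simp [add_mul])

theorem exists_int_form {d : ℕ} {r : MvPolynomial (Fin 3) (ZMod p)} (hr : r.IsHomogeneous d) :
    ∃ q : Form d, intMap (ZMod p) q = r := by
  obtain ⟨q, hq, rfl⟩ := exists_map_eq (Int.castRingHom (ZMod p)) (ZMod.ringHom_surjective _) hr
  exact ⟨⟨q, hq⟩, rfl⟩

section

variable (H : IsCompleteIntersection (intMap (ZMod p) l) (intMap (ZMod p) f₃)
  (intMap (ZMod p) f₅))

include H

/-- For `q = aℓ + bf₃ + cf₅` modulo `p` the fraction splits as `aw/(f₃f₅) + bw/(ℓf₅) + cw/(ℓf₃)`. -/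
theorem cechHom_mem_pairSum_of_mem {q : Form 6} (hq : q ∈ sexticIdeal p l f₃ f₅) :
    cechHom p f l f₃ f₅ q ∈ pairSum (fun i => (cover p f l f₃ f₅ i : (surface (ZMod p) f).Opens)) := by
  obtain ⟨a, b, c, ha, hb, hc, h⟩ := exists_isHomogeneous_of_mem_span H.line H.cubic H.quintic
    (intMap_isHomogeneous _ q) (mem_sexticIdeal.mp hq)
  refine fr_mem_pairSum (𝒜 := grading (ZMod p) f) (e := forms p f l f₃ f₅) forms_mem
    (fun i => (cover_eq i).le) (N := 1) (a₀ := base _ f a * w _ f) (a₁ := base _ f b * w _ f)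
    (a₂ := base _ f c * w _ f) ?_ ?_ ?_ _ _ _ ?_
  · exact SetLike.mul_mem_graded (base_mem ha) (w_mem _ f)
  · exact SetLike.mul_mem_graded (base_mem hb) (w_mem _ f)
  · exact SetLike.mul_mem_graded (base_mem hc) (w_mem _ f)
  · simp only [forms, Matrix.cons_val_zero, Matrix.cons_val_one, Matrix.cons_val, coe_eq, h,
      map_add, map_mul]
    ring

/-- Comparing the coefficients of `w` in a splitting with common denominator `(ℓf₃f₅) ^ (N₀ + 1)`
gives a membership to which the colon ideal computation applies. -/
theorem mem_of_cechHom_mem_pairSum {q : Form 6} (h : cechHom p f l f₃ f₅ q ∈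
      pairSum (fun i => (cover p f l f₃ f₅ i : (surface (ZMod p) f).Opens))) :
    q ∈ sexticIdeal p l f₃ f₅ := by
  obtain ⟨N₀, hN⟩ := exists_of_mem_pairSum (𝒜 := grading (ZMod p) f) (e := forms p f l f₃ f₅)
    forms_mem (fun i => by fin_cases i <;> simp) (fun i => (cover_eq i).le)
    (fun i => (cover_eq i).ge) h
  obtain ⟨a₀, a₁, a₂, hE, ha, hD, e⟩ := hN (N₀ + 1) (by omega)
  have hnz := forms_prod_mem_nonZeroDivisors (f := f) H
  have hm := forms_prod_mem (p := p) (f := f) (l := l) (f₃ := f₃) (f₅ := f₅)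
  have key := eq_of_fr_eq (𝒜 := grading (ZMod p) f) hm (by norm_num) inf_cover_eq.le inf_cover_eq.ge hnz _ _ _ ha hE hD hnz
    (pow_mem hnz _) e
  obtain ⟨b₀, c₀, rfl⟩ := exists_base a₀
  obtain ⟨b₁, c₁, rfl⟩ := exists_base a₁
  obtain ⟨b₂, c₂, rfl⟩ := exists_base a₂
  have hF : forms p f l f₃ f₅ 0 * forms p f l f₃ f₅ 1 * forms p f l f₃ f₅ 2 =
    base _ f (intMap _ l * intMap _ f₃ * intMap _ f₅) := by
    simp [forms, coe_eq]
  have key2 : base (ZMod p) f 0 + base (ZMod p) f (intMap _ q *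
      (intMap _ l * intMap _ f₃ * intMap _ f₅) ^ (N₀ + 1)) * w _ f =
      base (ZMod p) f ((b₀ * intMap _ l ^ (N₀ + 1) + b₁ * intMap _ f₃ ^ (N₀ + 1) +
        b₂ * intMap _ f₅ ^ (N₀ + 1)) * (intMap _ l * intMap _ f₃ * intMap _ f₅)) +
      base (ZMod p) f ((c₀ * intMap _ l ^ (N₀ + 1) + c₁ * intMap _ f₃ ^ (N₀ + 1) +
        c₂ * intMap _ f₅ ^ (N₀ + 1)) * (intMap _ l * intMap _ f₃ * intMap _ f₅)) * w _ f := by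
    rw [hF] at key
    simp only [forms, Matrix.cons_val_zero, Matrix.cons_val_one, Matrix.cons_val, coe_eq] at key
    simp only [map_mul, map_add, map_pow, map_zero] at key ⊢
    linear_combination key
  have key3 := (base_add_mul_inj.mp key2).2
  rw [mem_sexticIdeal]
  refine H.mem_span_of_mul_pow_mem (m := N₀) (Submodule.mem_span_triple.mpr ⟨c₀, c₁, c₂, ?_⟩)
  refine mul_right_cancel₀ (mul_ne_zero (mul_ne_zero H.ne_zero H.cubic_ne_zero) H.quintic_ne_zero) ?_
  rw [smul_eq_mul, smul_eq_mul, smul_eq_mul, ← key3]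
  ring

/-- For `t = (a + bw)/(ℓf₃f₅) ^ (N + 1)`, the degree `9N + 9` of `a` exceeds the socle degree `9N +
6`, so `a` splits completely; `b` has the socle degree, and `exists_sextic` leaves a sextic. -/
theorem exists_sub_cechHom_mem_pairSum (t) : ∃ q, t - cechHom p f l f₃ f₅ q ∈
    pairSum (fun i => (cover p f l f₃ f₅ i : (surface (ZMod p) f).Opens)) := by
  have hm := forms_prod_mem (p := p) (f := f) (l := l) (f₃ := f₃) (f₅ := f₅)
  obtain ⟨N, hN⟩ := exists_fr (𝒜 := grading (ZMod p) f) hm (by norm_num) inf_cover_eq.le inf_cover_eq.ge t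
  obtain ⟨τ, hτ, ht⟩ := hN (N + 1) (by omega)
  obtain ⟨a, b, ha, hb, rfl⟩ := exists_base_of_mem hτ
  have e9 : ((N + 1) • (![1, 3, 5] 0 + ![1, 3, 5] 1 + ![1, 3, 5] 2) : ℕ) = 9 * N + 9 := by
    simp; ring
  rw [e9] at ha hb
  obtain ⟨a₀, a₁, a₂, ha₀, ha₁, ha₂, hae⟩ := exists_isHomogeneous_of_mem_span (H.line.pow (N + 1))
    (H.cubic.pow (N + 1)) (H.quintic.pow (N + 1)) ha (H.mem_span_pow (by omega) ha)
  obtain ⟨r, hr, hbr⟩ := H.exists_sextic (m := N) hb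
  have hrh : (b - r * (intMap (ZMod p) l * intMap (ZMod p) f₃ * intMap (ZMod p) f₅) ^ N).IsHomogeneous
      (9 * N + 6) := by
    refine hb.sub ?_
    have := hr.mul (((H.line.mul H.cubic).mul H.quintic).pow N)
    rwa [show 6 + (1 + 3 + 5) * N = 9 * N + 6 by ring] at this
  obtain ⟨b₀, b₁, b₂, hb₀, hb₁, hb₂, hbe⟩ := exists_isHomogeneous_of_mem_span (H.line.pow (N + 1))
    (H.cubic.pow (N + 1)) (H.quintic.pow (N + 1)) hrh hbr
  obtain ⟨q, rfl⟩ := exists_int_form hr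
  refine ⟨q, ?_⟩
  have hq : cechHom p f l f₃ f₅ q = fr (grading (ZMod p) f) (coe _ f q * w _ f)
    (forms p f l f₃ f₅ 0 * forms p f l f₃ f₅ 1 * forms p f l f₃ f₅ 2)
    (SetLike.mul_mem_graded (coe_mem _ f q) (w_mem _ f)) hm inf_cover_eq.le := rfl
  have hE : (forms p f l f₃ f₅ 0 * forms p f l f₃ f₅ 1 * forms p f l f₃ f₅ 2) ^ (N + 1) ∈
    grading (ZMod p) f ((N + 1) • (![1, 3, 5] 0 + ![1, 3, 5] 1 + ![1, 3, 5] 2)) :=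
    SetLike.pow_mem_graded _ hm
  have hqm : coe (ZMod p) f q * w _ f *
      (forms p f l f₃ f₅ 0 * forms p f l f₃ f₅ 1 * forms p f l f₃ f₅ 2) ^ N ∈
      grading (ZMod p) f ((N + 1) • (![1, 3, 5] 0 + ![1, 3, 5] 1 + ![1, 3, 5] 2)) :=
    mem_of_eq (SetLike.mul_mem_graded (SetLike.mul_mem_graded (coe_mem _ f q) (w_mem _ f))
      (SetLike.pow_mem_graded N hm)) (by simp; ring)
  rw [ht, hq, fr_eq (SetLike.mul_mem_graded (coe_mem _ f q) (w_mem _ f)) hm inf_cover_eq.le hqm hE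
    (le_basicOpen_pow inf_cover_eq.le _) (by ring), fr_sub]
  refine fr_mem_pairSum (𝒜 := grading (ZMod p) f) (e := forms p f l f₃ f₅) forms_mem
    (fun i => (cover_eq i).le) (N := N + 1) (a₀ := base _ f a₀ + base _ f b₀ * w _ f)
    (a₁ := base _ f a₁ + base _ f b₁ * w _ f) (a₂ := base _ f a₂ + base _ f b₂ * w _ f)
    ?_ ?_ ?_ _ _ _ ?_
  · refine add_mem (mem_of_eq (base_mem ha₀) ?_)
      (mem_of_eq (SetLike.mul_mem_graded (base_mem hb₀) (w_mem _ f)) ?_) <;> simp <;> omega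
  · refine add_mem (mem_of_eq (base_mem ha₁) ?_)
      (mem_of_eq (SetLike.mul_mem_graded (base_mem hb₁) (w_mem _ f)) ?_) <;> simp <;> omega
  · refine add_mem (mem_of_eq (base_mem ha₂) ?_)
      (mem_of_eq (SetLike.mul_mem_graded (base_mem hb₂) (w_mem _ f)) ?_) <;> simp <;> omega
  · have hae' := congrArg (base (ZMod p) f) hae
    have hbe' := congrArg (base (ZMod p) f) hbe
    simp only [forms, Matrix.cons_val_zero, Matrix.cons_val_one, Matrix.cons_val, coe_eq]
    simp only [map_mul, map_add, map_pow, map_sub] at hae' hbe' ⊢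
    linear_combination (base (ZMod p) f (intMap (ZMod p) l) * base (ZMod p) f (intMap (ZMod p) f₃) *
      base (ZMod p) f (intMap (ZMod p) f₅)) ^ (N + 1) * (hae' + w _ f * hbe')

theorem exists_notMem_sexticIdeal : ∃ q : Form 6, q ∉ sexticIdeal p l f₃ f₅ := by
  obtain ⟨r, hr, h⟩ := H.exists_sextic_notMem
  obtain ⟨q, rfl⟩ := exists_int_form hr
  exact ⟨q, fun hq => h (mem_sexticIdeal.mp hq)⟩

omit H in
-- The triple intersection is then itself one of the pairwise intersections.
theorem _root_.Cech.mem_pairSum_of_eq {X : Scheme.{0}} {U : Fin 3 → X.Opens} {i j : Fin 3}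
    (hij : i < j) (h : U i = U j) (t : Γ(X, U 0 ⊓ U 1 ⊓ U 2)) : t ∈ pairSum U := by
  rw [mem_pairSum]
  by_cases h2 : j = 2
  · have hle : U 0 ⊓ U 1 ≤ U 0 ⊓ U 1 ⊓ U 2 := by
      subst h2
      have : i = 0 ∨ i = 1 := by omega
      rcases this with rfl | rfl
      · exact le_inf le_rfl (inf_le_left.trans h.le)
      · exact le_inf le_rfl (inf_le_right.trans h.le)
    exact ⟨0, 0, res X hle t, by simp⟩
  · have : i = 0 ∧ j = 1 := by omega
    obtain ⟨rfl, rfl⟩ := this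
    refine ⟨res X (le_inf (le_inf (inf_le_left.trans h.ge) inf_le_left) inf_le_right) t, 0, 0,
      by simp⟩

/-- If two of the three sets coincided, every fraction would lie in `pairSum`, and so every sextic
in the ideal. -/
theorem cover_injective : Function.Injective (cover p f l f₃ f₅) := by
  obtain ⟨q, hq⟩ := exists_notMem_sexticIdeal H
  have key {i j : Fin 3} (hij : i < j) : cover p f l f₃ f₅ i ≠ cover p f l f₃ f₅ j := fun h =>
    hq (mem_of_cechHom_mem_pairSum (f := f) H (mem_pairSum_of_eq hij (congrArg Subtype.val h) _))
  intro i j h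
  rcases lt_trichotomy i j with hij | hij | hij
  exacts [absurd h (key hij), hij, absurd h.symm (key hij)]

theorem iSup_cover : ⨆ i, (cover p f l f₃ f₅ i : (surface (ZMod p) f).Opens) = ⊤ := by
  rw [← sup_openOf_eq_top (f := f) H]
  refine le_antisymm (iSup_le fun i => ?_) (sup_le (sup_le ?_ ?_) ?_)
  · fin_cases i
    exacts [le_sup_left.trans le_sup_left, le_sup_right.trans le_sup_left, le_sup_right]
  exacts [le_iSup (fun i => (cover p f l f₃ f₅ i : (surface (ZMod p) f).Opens)) 0,
    le_iSup (fun i => (cover p f l f₃ f₅ i : (surface (ZMod p) f).Opens)) 1,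
    le_iSup (fun i => (cover p f l f₃ f₅ i : (surface (ZMod p) f).Opens)) 2]

omit H in
theorem p_nsmul_section {U : (surface (ZMod p) f).Opens} (s : Γ(surface (ZMod p) f, U)) :
    p • s = 0 := by
  have h1 : (1 : CoordRing (ZMod p) f) ∈ grading (ZMod p) f 0 := SetLike.GradedOne.one_mem
  have hU : U ≤ Proj.basicOpen (grading (ZMod p) f) 1 := by simp
  have hp : ((p : ℤ) • (1 : CoordRing (ZMod p) f)) = 0 := by
    rw [zsmul_eq_mul, mul_one, Int.cast_natCast, ← map_natCast (algebraMap (ZMod p) _),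
      CharP.cast_eq_zero, map_zero]
  have h : (p : ℤ) • fr (grading (ZMod p) f) 1 1 h1 h1 hU = 0 := by
    rw [fr_zsmul, ← fr_zero h1 hU]
    exact fr_congr _ _ _ _ hp
  rw [fr_self, natCast_zsmul] at h
  rw [← one_mul s, ← smul_mul_assoc, h, zero_mul]

theorem exists_equiv_H2 (hp : p ≠ 2) (ε : ℤˣ) :
    ∃ Φ : (Form 6 ⧸ sexticIdeal p l f₃ f₅) ≃+ H2 (surface (ZMod p) f), ∀ q : Form 6,
      ∃ z, Represents z (Φ (QuotientAddGroup.mk q)) ∧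
        2 • z (cover p f l f₃ f₅ 0) (cover p f l f₃ f₅ 1) (cover p f l f₃ f₅ 2) =
          (ε : ℤ) • cechHom p f l f₃ f₅ q := by
  -- With `p = 2m + 1`, the integer `-m` acts as `1/2` on sections, which are killed by `p`.
  obtain ⟨m, hm⟩ := (Fact.out : p.Prime).odd_of_ne_two hp
  have hM {M : Type} [AddCommGroup M] (s : M) (hs : p • s = 0) : 2 • (-(m : ℤ)) • s = s := by
    rw [hm, add_smul, one_smul, mul_smul] at hs
    rw [neg_smul, smul_neg, natCast_zsmul]
    exact neg_eq_of_add_eq_zero_right hs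
  have h2 (s : Γ(surface (ZMod p) f, (cover p f l f₃ f₅ 0 : (surface (ZMod p) f).Opens) ⊓
      cover p f l f₃ f₅ 1 ⊓ cover p f l f₃ f₅ 2)) : 2 • (-(m : ℤ)) • s = s :=
    hM s (p_nsmul_section s)
  have hε (s : Γ(surface (ZMod p) f, (cover p f l f₃ f₅ 0 : (surface (ZMod p) f).Opens) ⊓
      cover p f l f₃ f₅ 1 ⊓ cover p f l f₃ f₅ 2)) : (ε : ℤ) • (ε : ℤ) • s = s := by
    rw [smul_smul, ← Units.val_mul, Int.units_mul_self, Units.val_one, one_smul]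
  obtain ⟨Φ, hΦ⟩ := Cech.exists_equiv_H2 (cover p f l f₃ f₅) (cover_injective H) (iSup_cover H)
    (sexticIdeal p l f₃ f₅) ((-(m : ℤ) * (ε : ℤ)) • cechHom p f l f₃ f₅) (fun q => by
      refine ⟨fun h => mem_of_cechHom_mem_pairSum (f := f) H ?_, fun h =>
        zsmul_mem (cechHom_mem_pairSum_of_mem H h) _⟩
      have h' := zsmul_mem (nsmul_mem h 2) (ε : ℤ)
      rwa [AddMonoidHom.smul_apply, mul_smul, h2, hε] at h') (fun t => by
      obtain ⟨q, hq⟩ := exists_sub_cechHom_mem_pairSum (f := f) H ((ε : ℤ) • 2 • t)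
      refine ⟨q, ?_⟩
      have h' := zsmul_mem hq (-(m : ℤ) * (ε : ℤ))
      rwa [smul_sub, mul_smul, hε, smul_comm, h2] at h')
  refine ⟨Φ, fun q => ?_⟩
  obtain ⟨z, hz, h⟩ := hΦ q
  refine ⟨z, hz, ?_⟩
  rw [h, AddMonoidHom.smul_apply, mul_smul, h2]

end

end DoublePlane

end

noncomputable section

/-! ### The components of the pull-back of a line -/

namespace TernaryForms

variable {k : Type} [Field k]

/-- Let `t` be the top part of `g` and `r` the rest. Then `r(r + 2t) = g² - t²` is homogeneous of
degree `2n`, but its factors have degrees at most `n - 1` and `n`, so one of them vanishes; if `r =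
-2t`, then `r` is homogeneous of degree `n` and again zero. -/
theorem isHomogeneous_of_sq {ι : Type} {g : MvPolynomial ι k} {n : ℕ}
    (h : (g ^ 2).IsHomogeneous (2 * n)) : g.IsHomogeneous n := by
  rcases eq_or_ne g 0 with rfl | hg
  · exact isHomogeneous_zero _ _ _
  have hdeg : g.totalDegree = n := by
    have := h.totalDegree (pow_ne_zero 2 hg)
    rw [pow_two, totalDegree_mul_of_isDomain hg hg] at this
    omega
  let r := ∑ i ∈ Finset.range n, homogeneousComponent i g
  have hgr : g = r + homogeneousComponent n g := by
    conv_lhs => rw [← sum_homogeneousComponent g, hdeg, Finset.sum_range_succ]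
  have hn := homogeneousComponent_isHomogeneous n g
  have hrle : r.totalDegree ≤ n - 1 := by
    refine totalDegree_finsetSum_le fun i hi => (homogeneousComponent_isHomogeneous i
      g).totalDegree_le.trans ?_
    have := Finset.mem_range.mp hi
    omega
  have hn0 : r ≠ 0 → n ≠ 0 := by
    rintro hr0 rfl
    exact hr0 (by simp [r])
  clear_value r
  generalize homogeneousComponent n g = t at hgr hn
  suffices hr : r = 0 by
    rw [hgr, hr, zero_add]
    exact hn
  have hrd {m : ℕ} {q : MvPolynomial ι k} (hq : q.IsHomogeneous m) (hm : n ≤ m) (h' : q = r) :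
      r = 0 := by
    by_contra hr0
    have h1 := (h' ▸ hq : r.IsHomogeneous m).totalDegree hr0
    have h3 := hn0 hr0
    omega
  by_contra hr0
  have hprod : (r * (r + 2 * t)).IsHomogeneous (2 * n) := by
    have e : r * (r + 2 * t) = g ^ 2 - t ^ 2 := by
      linear_combination -(r + t + g) * hgr
    rw [e]
    exact h.sub (by rw [mul_comm 2 n]; exact hn.pow 2)
  rcases eq_or_ne (r + 2 * t) 0 with h0 | h0
  · refine hr0 (hrd (q := -(2 * t)) (m := n) ?_ le_rfl
      (by linear_combination -h0))
    rw [two_mul]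
    exact (hn.add hn).neg
  · have h1 := hprod.totalDegree (mul_ne_zero hr0 h0)
    rw [totalDegree_mul_of_isDomain hr0 h0] at h1
    have h3 := hn0 hr0
    have h4 : (r + 2 * t).totalDegree ≤ n := by
      refine (totalDegree_add _ _).trans (max_le (by omega) ?_)
      rw [two_mul]
      exact (hn.add hn).totalDegree_le
    omega

end TernaryForms

namespace QuadraticAlgebra

/-- The norm is multiplicative, so only elements of norm zero matter. If `a² = F b²` with `b ≠ 0`,
then `b ∣ a` because `C` is integrally closed, and `F` is a square. -/
theorem isDomain_of_not_isSquare {C : Type} [CommRing C] [IsDomain C] [UniqueFactorizationMonoid C]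
    {F : C} (hF : ¬ ∃ c, F = c ^ 2) : IsDomain (QuadraticAlgebra C F 0) := by
  have hnorm (x : QuadraticAlgebra C F 0) (h : x.re ^ 2 = F * x.im ^ 2) : x = 0 := by
    have him : x.im = 0 := by
      by_contra him
      obtain ⟨c, hc⟩ : x.im ∣ x.re :=
        (IsIntegrallyClosed.pow_dvd_pow_iff two_ne_zero).mp ⟨F, by rw [h, mul_comm]⟩
      refine hF ⟨c, mul_right_cancel₀ (pow_ne_zero 2 him) ?_⟩
      rw [← h, hc]
      ring
    rw [him, zero_pow two_ne_zero, mul_zero] at h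
    ext
    · exact pow_eq_zero_iff two_ne_zero |>.mp h
    · exact him
  have : NoZeroDivisors (QuadraticAlgebra C F 0) := by
    constructor
    intro x y hxy
    have hre := congrArg QuadraticAlgebra.re hxy
    have him := congrArg QuadraticAlgebra.im hxy
    simp only [re_mul, im_mul, re_zero, im_zero, zero_mul, add_zero] at hre him
    have : (x.re ^ 2 - F * x.im ^ 2) * (y.re ^ 2 - F * y.im ^ 2) = 0 := by
      linear_combination (x.re * y.re + F * x.im * y.im) * hre -
        F * (x.re * y.im + x.im * y.re) * him
    rcases mul_eq_zero.mp this with h | h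
    · exact Or.inl (hnorm x (sub_eq_zero.mp h))
    · exact Or.inr (hnorm y (sub_eq_zero.mp h))
  exact NoZeroDivisors.to_isDomain _

end QuadraticAlgebra

namespace DoublePlane

open TernaryForms

section LiftHom

variable {R D : Type} [CommRing R] [CommRing D] [Algebra R D] {f : Form 6}
  (π : MvPolynomial (Fin 3) R →ₐ[R] D) (v : D) (hv : v ^ 2 = π (intMap R f))

/-- The homomorphism which extends `π` and sends `w` to `v`. -/
def liftHom : CoordRing R f →+* D :=
  Ideal.Quotient.lift (relIdeal R f)
    (aeval (R := R) (Fin.lastCases (motive := fun _ => D) v fun i => π (X i))).toRingHom (by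
    suffices relIdeal R f ≤ RingHom.ker
      (aeval (R := R) (Fin.lastCases (motive := fun _ => D) v fun i => π (X i))).toRingHom from
      fun x hx => this hx
    rw [relIdeal, Ideal.span_le, Set.singleton_subset_iff]
    change aeval (R := R) (Fin.lastCases (motive := fun _ => D) v fun i => π (X i))
      (X (Fin.last 3) ^ 2 - rename Fin.castSucc (intMap R f)) = 0
    rw [map_sub, map_pow, aeval_X, Fin.lastCases_last, hv, aeval_rename, sub_eq_zero]
    conv_lhs => rw [aeval_unique π]
    congr 2
    funext i
    simp)

theorem liftHom_base (a : MvPolynomial (Fin 3) R) : liftHom π v hv (base R f a) = π a := by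
  change aeval (R := R) (Fin.lastCases (motive := fun _ => D) v fun i => π (X i))
    (rename Fin.castSucc a) = _
  rw [aeval_rename]
  conv_rhs => rw [aeval_unique π]
  congr 2
  funext i
  simp

theorem liftHom_w : liftHom π v hv (w R f) = v := by
  change aeval (R := R) (Fin.lastCases (motive := fun _ => D) v fun i => π (X i))
    (X (Fin.last 3)) = _
  rw [aeval_X, Fin.lastCases_last]

end LiftHom

variable {R : Type} [CommRing R] {f : Form 6}

/-- The zero set of a homogeneous prime ideal is irreducible. -/
theorem isIrreducible_zeroLocus {P : Ideal (CoordRing R f)} [P.IsPrime]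
    (hP : P.IsHomogeneous (grading R f)) {i : Fin 3} (hi : base R f (X i) ∉ P) :
    IsIrreducible {y : surface R f | P ≤ y.asHomogeneousIdeal.toIdeal} := by
  let x : ProjectiveSpectrum (grading R f) := ⟨⟨P, hP⟩, ‹_›, fun h => hi (h (HomogeneousIdeal.mem_irrelevant_of_mem _
    one_pos (base_mem (isHomogeneous_X _ _))))⟩
  have : {y : surface R f | P ≤ y.asHomogeneousIdeal.toIdeal} = closure {x} := by
    ext y
    exact ProjectiveSpectrum.le_iff_mem_closure _ x y
  rw [this]
  exact isIrreducible_singleton.closure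

theorem IsComponentOf.eq_of_isIrreducible {X : Scheme.{0}} {Z F T : Closeds X}
    (hZ : IsComponentOf Z F) (hT : IsIrreducible (T : Set X)) (hTF : T ≤ F) (hZT : Z ≤ T) :
    Z = T :=
  hZ.eq_of_le ⟨hT, hTF⟩ hZT

variable {p : ℕ} [Fact p.Prime] {l : Form 1}

theorem mem_compl_basicOpen {a : CoordRing R f} {y : surface R f} :
    y ∈ (Proj.basicOpen (grading R f) a).compl ↔ a ∈ y.asHomogeneousIdeal := by
  change ¬ (y ∈ Proj.basicOpen (grading R f) a) ↔ _
  rw [Proj.mem_basicOpen, not_not]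

theorem mem_vanish {a b : CoordRing R f} {y : surface R f} :
    y ∈ vanish R f a b ↔ a ∈ y.asHomogeneousIdeal ∧ b ∈ y.asHomogeneousIdeal := by
  change ¬ (y ∈ Proj.basicOpen (grading R f) a ⊔ Proj.basicOpen (grading R f) b) ↔ _
  rw [Opens.mem_sup, Proj.mem_basicOpen, Proj.mem_basicOpen]
  tauto

theorem exists_X_ne_zero {k : Type} [Field k] {π : MvPolynomial (Fin 3) k →ₐ[k] MvPolynomial (Fin 2) k}
    {σ : MvPolynomial (Fin 2) k →ₐ[k] MvPolynomial (Fin 3) k} (h : ∀ q, π (σ q) = q)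
    (hσ : ∀ j, ∃ m, σ (X j) = X m) : ∃ i, π (X i) ≠ 0 := by
  obtain ⟨m, hm⟩ := hσ 0
  refine ⟨m, ?_⟩
  rw [← hm, h]
  exact X_ne_zero _

/-- If the pull-back of a line is reducible, then the restriction of the sextic to the line is a
square. -/
theorem exists_eq_sq (hl : intMap (ZMod p) l ≠ 0) {Z : Closeds (surface (ZMod p) f)}
    (hZ : IsComponentOf Z (Proj.basicOpen (grading (ZMod p) f) (coe (ZMod p) f l)).compl)
    (hZ' : Z ≠ (Proj.basicOpen (grading (ZMod p) f) (coe (ZMod p) f l)).compl) :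
    ∃ g : MvPolynomial (Fin 3) (ZMod p), g.IsHomogeneous 3 ∧
      intMap (ZMod p) l ∣ intMap (ZMod p) f - g ^ 2 := by
  obtain ⟨π, σ, h1, h2, h3, h4, h5, h6⟩ := exists_elimination (intMap_isHomogeneous _ l) hl
  by_cases hsq : ∃ c, π (intMap (ZMod p) f) = c ^ 2
  · obtain ⟨c, hc⟩ := hsq
    refine ⟨σ c, h5 3 c (isHomogeneous_of_sq (n := 3) ?_), ?_⟩
    · rw [← hc]
      exact h4 6 _ (intMap_isHomogeneous _ f)
    · rw [← map_pow, ← hc]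
      exact h2 _
  -- The coordinate ring of the pull-back is the extension of the binary forms by a root of a
  -- nonsquare, a domain; so `(ℓ)` is prime and the pull-back irreducible.
  · exfalso
    have := QuadraticAlgebra.isDomain_of_not_isSquare hsq
    let π' : MvPolynomial (Fin 3) (ZMod p) →ₐ[ZMod p]
        QuadraticAlgebra (MvPolynomial (Fin 2) (ZMod p)) (π (intMap (ZMod p) f)) 0 :=
      (IsScalarTower.toAlgHom (ZMod p) (MvPolynomial (Fin 2) (ZMod p)) _).comp π
    have hπ' (a) : π' a = ⟨π a, 0⟩ := rfl
    let φ : CoordRing (ZMod p) f →+* QuadraticAlgebra (MvPolynomial (Fin 2) (ZMod p))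
        (π (intMap (ZMod p) f)) 0 := liftHom π' ⟨0, 1⟩ (by
      rw [hπ', pow_two]
      ext <;> simp)
    have hker : RingHom.ker φ = Ideal.span {coe (ZMod p) f l} := by
      apply le_antisymm
      · intro x hx
        obtain ⟨a, b, rfl⟩ := exists_base x
        rw [RingHom.mem_ker, map_add, map_mul, liftHom_base, liftHom_base, liftHom_w, hπ',
          hπ'] at hx
        have ha := congrArg QuadraticAlgebra.re hx
        have hb := congrArg QuadraticAlgebra.im hx
        simp only [QuadraticAlgebra.re_add, QuadraticAlgebra.im_add, QuadraticAlgebra.re_mul,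
          QuadraticAlgebra.im_mul, QuadraticAlgebra.re_zero, QuadraticAlgebra.im_zero, mul_zero,
          mul_one, add_zero, zero_add] at ha hb
        obtain ⟨a', ha'⟩ := h2 a
        obtain ⟨b', hb'⟩ := h2 b
        rw [ha, map_zero, sub_zero] at ha'
        rw [hb, map_zero, sub_zero] at hb'
        rw [Ideal.mem_span_singleton, ha', hb', map_mul, map_mul, coe_eq]
        exact ⟨base _ f a' + base _ f b' * w _ f, by ring⟩
      · rw [Ideal.span_le, Set.singleton_subset_iff]
        change φ (coe (ZMod p) f l) = 0
        rw [coe_eq, liftHom_base, hπ', h3]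
        rfl
    have hprime := RingHom.ker_isPrime φ
    rw [hker] at hprime
    obtain ⟨i, hi⟩ := exists_X_ne_zero h1 h6
    have hirr := isIrreducible_zeroLocus (f := f) (i := i)
      (Ideal.homogeneous_span _ {coe (ZMod p) f l} (by rintro _ rfl; exact ⟨1, coe_mem _ _ l⟩)) (by
        rw [← hker, RingHom.mem_ker, liftHom_base, hπ']
        intro h0
        exact hi (congrArg QuadraticAlgebra.re h0))
    refine hZ' (hZ.eq_of_isIrreducible ?_ le_rfl hZ.prop.2)
    convert hirr using 1
    ext y
    refine mem_compl_basicOpen.trans ?_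
    rw [Set.mem_ofPred_eq, Ideal.span_singleton_le_iff_mem]
    rfl

/-- The cubic and the degree 5 part of the cofactor of `ℓ` lift coefficientwise; the remaining
difference is divisible by `p`, and the degree 6 part of the quotient is `G`. -/
theorem exists_forms (hl : intMap (ZMod p) l ≠ 0) {Z : Closeds (surface (ZMod p) f)}
    (hZ : IsComponentOf Z (Proj.basicOpen (grading (ZMod p) f) (coe (ZMod p) f l)).compl)
    (hZ' : Z ≠ (Proj.basicOpen (grading (ZMod p) f) (coe (ZMod p) f l)).compl) :
    ∃ (f₃ : Form 3) (f₅ : Form 5) (G : Form 6),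
      (f : MvPolynomial (Fin 3) ℤ) = f₃ ^ 2 + l * f₅ + p * G := by
  obtain ⟨g, hg, h⟩ := exists_eq_sq hl hZ hZ'
  obtain ⟨f₃, rfl⟩ := exists_int_form hg
  obtain ⟨c, hc⟩ := h
  obtain ⟨b, hb, hbc⟩ := coe_homogeneousComponent_mul (n := 6) (intMap_isHomogeneous (ZMod p) l) c
  rw [mul_comm, ← hc, homogeneousComponent_eq_self ((intMap_isHomogeneous _ f).sub (hg.pow 2))] at hbc
  obtain ⟨f₅, rfl⟩ := exists_int_form (d := 5) hb
  have hhom : ((f : MvPolynomial (Fin 3) ℤ) - (f₃ : MvPolynomial (Fin 3) ℤ) ^ 2 -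
      (l : MvPolynomial (Fin 3) ℤ) * (f₅ : MvPolynomial (Fin 3) ℤ)).IsHomogeneous 6 :=
    (IsHomogeneous.sub f.2 (IsHomogeneous.pow f₃.2 2)).sub (IsHomogeneous.mul l.2 f₅.2)
  have hdvd : C (p : ℤ) ∣ (f : MvPolynomial (Fin 3) ℤ) - (f₃ : MvPolynomial (Fin 3) ℤ) ^ 2 -
      (l : MvPolynomial (Fin 3) ℤ) * (f₅ : MvPolynomial (Fin 3) ℤ) := by
    rw [C_dvd_iff_zmod, map_sub, map_sub, map_mul, map_pow]
    linear_combination hbc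
  obtain ⟨G, hG⟩ := hdvd
  refine ⟨f₃, f₅, ⟨homogeneousComponent 6 G, homogeneousComponent_isHomogeneous 6 G⟩, ?_⟩
  have : C (p : ℤ) * homogeneousComponent 6 G = (f : MvPolynomial (Fin 3) ℤ) - (f₃ : MvPolynomial (Fin 3) ℤ) ^ 2 -
      (l : MvPolynomial (Fin 3) ℤ) * (f₅ : MvPolynomial (Fin 3) ℤ) := by
    rw [← homogeneousComponent_C_mul, ← hG, homogeneousComponent_eq_self hhom]
  rw [map_natCast] at this
  linear_combination -this

section

variable {f₃ : Form 3} {f₅ : Form 5} {G : Form 6}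

theorem intMap_sextic (h : (f : MvPolynomial (Fin 3) ℤ) = f₃ ^ 2 + l * f₅ + p * G) :
    intMap (ZMod p) f = intMap (ZMod p) f₃ ^ 2 + intMap (ZMod p) l * intMap (ZMod p) f₅ := by
  rw [h]
  simp

/-- The ideal of one of the two components is prime. -/
theorem isPrime_span_pair (hl : intMap (ZMod p) l ≠ 0)
    (h : (f : MvPolynomial (Fin 3) ℤ) = f₃ ^ 2 + l * f₅ + p * G) (ε : ℤˣ) :
    (Ideal.span {coe (ZMod p) f l, w (ZMod p) f + (ε : ℤ) • coe (ZMod p) f f₃}).IsPrime ∧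
      (∃ i, base (ZMod p) f (X i) ∉
        Ideal.span {coe (ZMod p) f l, w (ZMod p) f + (ε : ℤ) • coe (ZMod p) f f₃}) ∧
      ∀ b, base (ZMod p) f b ∈
        Ideal.span {coe (ZMod p) f l, w (ZMod p) f + (ε : ℤ) • coe (ZMod p) f f₃} →
        intMap (ZMod p) l ∣ b := by
  obtain ⟨π, σ, h1, h2, h3, h4, h5, h6⟩ := exists_elimination (intMap_isHomogeneous _ l) hl
  have hε : ((ε : ℤ) : MvPolynomial (Fin 2) (ZMod p)) ^ 2 = 1 := by
    rw [← Int.cast_pow, ← Units.val_pow_eq_pow_val, Int.units_sq, Units.val_one, Int.cast_one]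
  -- Restriction to the line with `w ↦ -εf₃`. The ideal is the kernel of this map to a domain.
  let φ : CoordRing (ZMod p) f →+* MvPolynomial (Fin 2) (ZMod p) :=
    liftHom π (-(((ε : ℤ) : MvPolynomial (Fin 2) (ZMod p)) * π (intMap (ZMod p) f₃))) (by
      rw [intMap_sextic h, map_add, map_mul, h3, map_pow, neg_sq, mul_pow, hε]
      ring)
  have hker : RingHom.ker φ =
      Ideal.span {coe (ZMod p) f l, w (ZMod p) f + (ε : ℤ) • coe (ZMod p) f f₃} := by
    apply le_antisymm
    · intro x hx
      obtain ⟨a, b, rfl⟩ := exists_base x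
      rw [RingHom.mem_ker, map_add, map_mul, liftHom_base, liftHom_base, liftHom_w] at hx
      obtain ⟨c, hc⟩ := h2 (a - b * ((ε : ℤ) : MvPolynomial (Fin 3) (ZMod p)) * intMap (ZMod p) f₃)
      have h0 : π (a - b * ((ε : ℤ) : MvPolynomial (Fin 3) (ZMod p)) * intMap (ZMod p) f₃) = 0 := by
        rw [map_sub, map_mul, map_mul, map_intCast]
        linear_combination hx
      rw [h0, map_zero, sub_zero] at hc
      have hc' := congrArg (base (ZMod p) f) hc
      simp only [map_sub, map_mul, map_intCast] at hc'
      refine Ideal.mem_span_pair.mpr ⟨base _ f c, base _ f b, ?_⟩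
      rw [coe_eq, coe_eq, zsmul_eq_mul]
      linear_combination -hc'
    · rw [Ideal.span_le, Set.insert_subset_iff, Set.singleton_subset_iff]
      constructor
      · change φ _ = 0
        rw [coe_eq, liftHom_base, h3]
      · change φ _ = 0
        rw [map_add, map_zsmul, coe_eq, liftHom_base, liftHom_w, zsmul_eq_mul]
        ring
  rw [← hker]
  refine ⟨RingHom.ker_isPrime φ, ?_, fun b hb => ?_⟩
  · obtain ⟨i, hi⟩ := exists_X_ne_zero h1 h6
    exact ⟨i, by rwa [RingHom.mem_ker, liftHom_base]⟩
  · rw [RingHom.mem_ker, liftHom_base] at hb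
    simpa [hb] using h2 b

omit [Fact p.Prime] in
theorem add_smul_mem (ε : ℤ) : w (ZMod p) f + ε • coe (ZMod p) f f₃ ∈ grading (ZMod p) f 3 :=
  add_mem (w_mem _ f) (zsmul_mem (coe_mem _ f f₃) _)

theorem isIrreducible_vanish (hl : intMap (ZMod p) l ≠ 0)
    (h : (f : MvPolynomial (Fin 3) ℤ) = f₃ ^ 2 + l * f₅ + p * G) (ε : ℤˣ) :
    IsIrreducible (vanish (ZMod p) f (coe (ZMod p) f l)
      (w (ZMod p) f + (ε : ℤ) • coe (ZMod p) f f₃) : Set (surface (ZMod p) f)) := by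
  obtain ⟨hprime, ⟨i, hi⟩, -⟩ := isPrime_span_pair hl h ε
  have hirr := isIrreducible_zeroLocus (f := f) (i := i)
      (Ideal.homogeneous_span _ {coe (ZMod p) f l, w (ZMod p) f + (ε : ℤ) • coe (ZMod p) f f₃} (by
        rintro _ (rfl | rfl)
        exacts [⟨1, coe_mem _ _ l⟩, ⟨3, add_smul_mem _⟩])) hi
  convert hirr using 1
  ext y
  refine mem_vanish.trans ?_
  rw [Set.mem_ofPred_eq, Ideal.span_le, Set.insert_subset_iff, Set.singleton_subset_iff]
  rfl

/-- Where `ℓ` vanishes, so does `(w + f₃)(w - f₃) = ℓf₅`; an irreducible subset thus lies in one of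
two irreducible loci, and maximality gives equality. -/
theorem exists_sign (hl : intMap (ZMod p) l ≠ 0)
    (h : (f : MvPolynomial (Fin 3) ℤ) = f₃ ^ 2 + l * f₅ + p * G)
    {Z : Closeds (surface (ZMod p) f)}
    (hZ : IsComponentOf Z (Proj.basicOpen (grading (ZMod p) f) (coe (ZMod p) f l)).compl) :
    ∃ ε : ℤˣ, Z = vanish (ZMod p) f (coe (ZMod p) f l)
      (w (ZMod p) f + (ε : ℤ) • coe (ZMod p) f f₃) := by
  have hle (ε : ℤˣ) : vanish (ZMod p) f (coe (ZMod p) f l)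
      (w (ZMod p) f + (ε : ℤ) • coe (ZMod p) f f₃) ≤
      (Proj.basicOpen (grading (ZMod p) f) (coe (ZMod p) f l)).compl := fun y hy =>
    mem_compl_basicOpen.mpr (mem_vanish.mp hy).1
  have hcover : (Z : Set (surface (ZMod p) f)) ⊆ (vanish (ZMod p) f (coe (ZMod p) f l)
      (w (ZMod p) f + ((1 : ℤˣ) : ℤ) • coe (ZMod p) f f₃) : Set (surface (ZMod p) f)) ∪
      vanish (ZMod p) f (coe (ZMod p) f l)
      (w (ZMod p) f + ((-1 : ℤˣ) : ℤ) • coe (ZMod p) f f₃) := by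
    intro y hy
    have hly : coe (ZMod p) f l ∈ y.asHomogeneousIdeal.toIdeal :=
      mem_compl_basicOpen.mp (hZ.prop.2 hy)
    have : y.asHomogeneousIdeal.toIdeal.IsPrime := y.isPrime
    have hmul : (w (ZMod p) f + ((1 : ℤˣ) : ℤ) • coe (ZMod p) f f₃) *
        (w (ZMod p) f + ((-1 : ℤˣ) : ℤ) • coe (ZMod p) f f₃) ∈ y.asHomogeneousIdeal.toIdeal := by
      have e : (w (ZMod p) f + ((1 : ℤˣ) : ℤ) • coe (ZMod p) f f₃) *
        (w (ZMod p) f + ((-1 : ℤˣ) : ℤ) • coe (ZMod p) f f₃) =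
          coe (ZMod p) f f₅ * coe (ZMod p) f l := by
        have := w_sq (R := ZMod p) (f := f)
        rw [intMap_sextic h, map_add, map_mul, map_pow] at this
        simp only [coe_eq, Units.val_neg, Units.val_one, neg_smul, one_smul]
        linear_combination this
      rw [e]
      exact Ideal.mul_mem_left _ _ hly
    rcases this.mem_or_mem hmul with h' | h'
    · exact Or.inl (mem_vanish.mpr ⟨hly, h'⟩)
    · exact Or.inr (mem_vanish.mpr ⟨hly, h'⟩)
  rcases isPreirreducible_iff_isClosed_union_isClosed.mp hZ.prop.1.2 _ _ (Closeds.isClosed _)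
    (Closeds.isClosed _) hcover with h' | h'
  · exact ⟨1, hZ.eq_of_isIrreducible (isIrreducible_vanish hl h 1) (hle 1) h'⟩
  · exact ⟨-1, hZ.eq_of_isIrreducible (isIrreducible_vanish hl h (-1)) (hle (-1)) h'⟩

end

end DoublePlane

end

noncomputable section

/-! ### Uniqueness of the obstruction -/

namespace Cech

variable {X Y : Scheme.{0}} (i : X ⟶ Y)

/-- The pull-back of functions. -/
def pull {V : Y.Opens} {U : X.Opens} (e : U ≤ i ⁻¹ᵁ V) : Γ(Y, V) →+* Γ(X, U) := (i.appLE V U e).hom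

theorem res_pull {V : Y.Opens} {U U' : X.Opens} (e : U ≤ i ⁻¹ᵁ V) (h : U' ≤ U) (x : Γ(Y, V)) :
    res X h (pull i e x) = pull i (h.trans e) x := by
  rw [pull, res, ← CommRingCat.comp_apply, Scheme.Hom.appLE_map]
  rfl

theorem pull_res {V V' : Y.Opens} {U : X.Opens} (h : V' ≤ V) (e : U ≤ i ⁻¹ᵁ V') (x : Γ(Y, V)) :
    pull i e (res Y h x) = pull i (e.trans (fun _ hx => h hx)) x := by
  rw [pull, res, ← CommRingCat.comp_apply, Scheme.Hom.map_appLE]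
  rfl

/-- Localization preserves nonzerodivisors, and `V`, which need not be affine, is covered by basic
open sets of `U`. -/
theorem res_mem_nonZeroDivisors {U V : X.Opens} (hU : IsAffineOpen U) (h : V ≤ U) {s : Γ(X, U)}
    (hs : s ∈ nonZeroDivisors Γ(X, U)) : res X h s ∈ nonZeroDivisors Γ(X, V) := by
  rw [mem_nonZeroDivisors_iff_right]
  intro x hx
  have hcov (y : V) : ∃ f : Γ(X, U), X.basicOpen f ≤ V ∧ (y : X) ∈ X.basicOpen f :=
    hU.exists_basicOpen_le y (h y.2)
  choose f hf hyf using hcov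
  refine eq_of_res (U := fun y => X.basicOpen (f y)) hf
    (fun y hy => Opens.mem_iSup.mpr ⟨⟨y, hy⟩, hyf _⟩) fun y => ?_
  rw [map_zero]
  have hfU := X.basicOpen_le (f y)
  let _ : Algebra Γ(X, U) Γ(X, X.basicOpen (f y)) := (res X hfU).toAlgebra
  have : IsLocalization.Away (f y) Γ(X, X.basicOpen (f y)) :=
    hU.isLocalization_of_eq_basicOpen (f y) (homOfLE hfU) rfl
  have hs' := IsLocalization.map_nonZeroDivisors_le (Submonoid.powers (f y))
    Γ(X, X.basicOpen (f y)) ⟨s, hs, rfl⟩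
  refine (mem_nonZeroDivisors_iff_right.mp hs') _ ?_
  have := congrArg (res X (hf y)) hx
  rwa [map_mul, res_res, map_zero] at this

/-- The inclusion of the locus `p = 0` in a flat `ℤ/p²`-scheme, by means of a basis of the
topology. -/
structure IsThickening (p : ℕ) (B : Set Y.Opens) : Prop where
  inf_mem : ∀ V ∈ B, ∀ W ∈ B, V ⊓ W ∈ B
  affine : ∀ V ∈ B, IsAffineOpen (i ⁻¹ᵁ V)
  exists_mem : ∀ (x : X) (V : Y.Opens), x ∈ i ⁻¹ᵁ V → ∃ W ∈ B, x ∈ i ⁻¹ᵁ W ∧ W ≤ V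
  surjective : ∀ V ∈ B, Function.Surjective (pull i (le_refl (i ⁻¹ᵁ V)))
  exists_eq_mul : ∀ V ∈ B, ∀ s, pull i (le_refl (i ⁻¹ᵁ V)) s = 0 →
    ∃ t, s = (p : Γ(Y, V)) * t
  eq_zero_of_mul : ∀ V ∈ B, ∀ s : Γ(Y, V), (p : Γ(Y, V)) * s = 0 →
    pull i (le_refl (i ⁻¹ᵁ V)) s = 0
  sq_eq_zero : ∀ V ∈ B, (p : Γ(Y, V)) * (p : Γ(Y, V)) = 0

namespace IsThickening

variable {i} {p : ℕ} {B : Set Y.Opens} (T : IsThickening i p B)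

include T

/-- If `a b = 1 + p t`, then `b (1 - p t)` is an inverse of `a`, since `p² = 0`. -/
theorem exists_unit {V : Y.Opens} (hV : V ∈ B) (u : (Γ(X, i ⁻¹ᵁ V))ˣ) :
    ∃ v : (Γ(Y, V))ˣ, pull i (le_refl (i ⁻¹ᵁ V)) v = u := by
  obtain ⟨a, ha⟩ := T.surjective V hV u
  obtain ⟨b, hb⟩ := T.surjective V hV ↑u⁻¹
  obtain ⟨t, ht⟩ := T.exists_eq_mul V hV (a * b - 1) (by
    rw [map_sub, map_mul, ha, hb, map_one, Units.mul_inv, sub_self])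
  have hab : a * (b * (1 - p * t)) = 1 := by
    linear_combination (1 - (p : Γ(Y, V)) * t) * ht - t ^ 2 * T.sq_eq_zero V hV
  exact ⟨Units.mkOfMulEqOne _ _ hab, ha⟩

end IsThickening

end Cech

open Cech

variable {X Y : Scheme.{0}} {i : X ⟶ Y} {p : ℕ} {B : Set Y.Opens} {I : X.IdealSheafData}

theorem LiftingDatum.exists_refinement [CompactSpace X] (T : IsThickening i p B)
    (D D' : LiftingDatum i p I) :
    ∃ (K : Type) (_ : Finite K) (W : K → Y.Opens) (_ : ∀ k, W k ∈ B) (_ : ⨆ k, i ⁻¹ᵁ W k = ⊤)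
      (τ : K → D.ι) (τ' : K → D'.ι), (∀ k, W k ≤ D.V (τ k)) ∧ ∀ k, W k ≤ D'.V (τ' k) := by
  have h (x : X) : ∃ W ∈ B, x ∈ i ⁻¹ᵁ W ∧ ∃ a a', W ≤ D.V a ∧ W ≤ D'.V a' := by
    have hx : x ∈ (⊤ : X.Opens) := trivial
    obtain ⟨a, ha⟩ := Opens.mem_iSup.mp (D.cover ▸ hx)
    obtain ⟨a', ha'⟩ := Opens.mem_iSup.mp (D'.cover ▸ hx)
    obtain ⟨W, hW, hxW, hle⟩ := T.exists_mem x (D.V a ⊓ D'.V a') ⟨ha, ha'⟩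
    exact ⟨W, hW, hxW, a, a', hle.trans inf_le_left, hle.trans inf_le_right⟩
  choose W hW hxW τ τ' hτ hτ' using h
  obtain ⟨t, ht⟩ := isCompact_univ.elim_nhds_subcover (fun x => (i ⁻¹ᵁ W x : Set X))
    fun x _ => (i ⁻¹ᵁ W x).isOpen.mem_nhds (hxW x)
  refine ⟨t, inferInstance, fun k => W k, fun k => hW k, top_le_iff.mp fun x _ => ?_,
    fun k => τ k, fun k => τ' k, fun k => hτ k, fun k => hτ' k⟩
  obtain ⟨k, hk, hxk⟩ := Set.mem_iUnion₂.mp (ht.2 (Set.mem_univ x))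
  exact Opens.mem_iSup.mpr ⟨⟨k, hk⟩, hxk⟩

theorem LiftingDatum.span_res (D : LiftingDatum i p I) (a : D.ι) {U : X.Opens}
    (hU : IsAffineOpen U) (h : U ≤ i ⁻¹ᵁ D.V a) :
    Ideal.span {res X h (D.s a)} = I.ideal ⟨U, hU⟩ := by
  have := I.map_ideal (U := ⟨U, hU⟩) (V := ⟨i ⁻¹ᵁ D.V a, D.affine a⟩) h
  rw [← this, ← D.span_s a, Ideal.map_span, Set.image_singleton]
  rfl

theorem LiftingDatum.pull_g_mul (D : LiftingDatum i p I) (a b : D.ι) {U : X.Opens}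
    (h : U ≤ i ⁻¹ᵁ (D.V a ⊓ D.V b)) : pull i h (D.g a b) *
      res X (show U ≤ i ⁻¹ᵁ D.V b from fun _ hx => (h hx).2) (D.s b) =
      res X (show U ≤ i ⁻¹ᵁ D.V a from fun _ hx => (h hx).1) (D.s a) := by
  have := congrArg (res X (show U ≤ i ⁻¹ᵁ D.V a ⊓ i ⁻¹ᵁ D.V b from h)) (D.g_lifts a b)
  rw [map_mul, res_res, res_res] at this
  rw [← this]
  congr 1
  exact (res_pull i (U := i ⁻¹ᵁ D.V a ⊓ i ⁻¹ᵁ D.V b) le_rfl h _).symm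

theorem LiftingDatum.res_c_spec (D : LiftingDatum i p I) (a b e : D.ι) {O : Y.Opens}
    (h : O ≤ D.V a ⊓ D.V b ⊓ D.V e) :
    res Y (h.trans leI) (D.g a b : Γ(Y, D.V a ⊓ D.V b)) *
      res Y (h.trans leI) (D.g b e : Γ(Y, D.V b ⊓ D.V e)) =
      res Y (h.trans leI) (D.g a e : Γ(Y, D.V a ⊓ D.V e)) *
        (1 + (p : Γ(Y, O)) * res Y h (D.c a b e)) := by
  have := congrArg (res Y h) (D.c_spec a b e)
  simpa only [map_mul, map_add, map_one, map_natCast, res_res] using this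

/-- Because `p² = 0`, factors `1 + p x` multiply by adding the `x`: a change of frames by `v`
changes `c` by the coboundary of `β`. -/
theorem mul_sub_coboundary_eq_zero {A : Type} [CommRing A] {p g₁₂ g₂₃ g₁₃ c g₁₂' g₂₃' g₁₃' c' v₁ v₂
    v₃ β₁₂ β₂₃ β₁₃ : A} (hp : p * p = 0) (h : g₁₂ * g₂₃ = g₁₃ * (1 + p * c))
    (h' : g₁₂' * g₂₃' = g₁₃' * (1 + p * c')) (h₁₂ : g₁₂ * v₂ = g₁₂' * v₁ * (1 + p * β₁₂))
    (h₂₃ : g₂₃ * v₃ = g₂₃' * v₂ * (1 + p * β₂₃)) (h₁₃ : g₁₃ * v₃ = g₁₃' * v₁ * (1 + p * β₁₃))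
    (hg : IsUnit g₁₃') (hv₁ : IsUnit v₁) (hv₂ : IsUnit v₂) :
    p * (c - c' - (β₂₃ - β₁₃ + β₁₂)) = 0 := by
  have key : (g₁₃' * v₁ * v₂) * ((1 + p * β₁₃) * (1 + p * c) -
      (1 + p * c') * ((1 + p * β₁₂) * (1 + p * β₂₃))) = (g₁₃' * v₁ * v₂) * 0 := by
    linear_combination -v₂ * (1 + p * c) * h₁₃ - v₃ * v₂ * h + g₂₃ * v₃ * h₁₂ +
      g₁₂' * v₁ * (1 + p * β₁₂) * h₂₃ + v₁ * v₂ * (1 + p * β₁₂) * (1 + p * β₂₃) * h'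
  have := ((hg.mul hv₁).mul hv₂).mul_left_cancel key
  linear_combination this - (β₁₃ * c - β₁₂ * β₂₃ - c' * (β₁₂ + β₂₃) - p * c' * β₁₂ * β₂₃) * hp

/-- The two cocycles of lifting data on a common refinement are cohomologous. -/
theorem LiftingDatum.sub_mem_range (T : IsThickening i p B) (D D' : LiftingDatum i p I) {K : Type}
    {W : K → Y.Opens} (hW : ∀ k, W k ∈ B) {τ : K → D.ι} {τ' : K → D'.ι}
    (hτ : ∀ k, W k ≤ D.V (τ k)) (hτ' : ∀ k, W k ≤ D'.V (τ' k)) :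
    ((fun a b e => pull i (V := D.V (τ a) ⊓ D.V (τ b) ⊓ D.V (τ e))
        (U := i ⁻¹ᵁ W a ⊓ i ⁻¹ᵁ W b ⊓ i ⁻¹ᵁ W e)
        (fun _ hx => ⟨⟨hτ a hx.1.1, hτ b hx.1.2⟩, hτ e hx.2⟩)
        (D.c (τ a) (τ b) (τ e)) : C2 X (fun k => i ⁻¹ᵁ W k)) -
      fun a b e => pull i (V := D'.V (τ' a) ⊓ D'.V (τ' b) ⊓ D'.V (τ' e))
        (U := i ⁻¹ᵁ W a ⊓ i ⁻¹ᵁ W b ⊓ i ⁻¹ᵁ W e)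
        (fun _ hx => ⟨⟨hτ' a hx.1.1, hτ' b hx.1.2⟩, hτ' e hx.2⟩)
        (D'.c (τ' a) (τ' b) (τ' e))) ∈ (d1 X (fun k => i ⁻¹ᵁ W k)).range := by
  have hκ (k) : i ⁻¹ᵁ W k ≤ i ⁻¹ᵁ D.V (τ k) := fun _ hx => hτ k hx
  have hκ' (k) : i ⁻¹ᵁ W k ≤ i ⁻¹ᵁ D'.V (τ' k) := fun _ hx => hτ' k hx
  have haff k := T.affine _ (hW k)
  -- comparison of the local equations
  have hu (k) : ∃ u : (Γ(X, i ⁻¹ᵁ W k))ˣ,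
      res X (hκ k) (D.s (τ k)) = u * res X (hκ' k) (D'.s (τ' k)) := by
    have h : Ideal.span {res X (hκ k) (D.s (τ k))} = Ideal.span {res X (hκ' k) (D'.s (τ' k))} :=
      (D.span_res _ (haff k) (hκ k)).trans (D'.span_res _ (haff k) (hκ' k)).symm
    obtain ⟨a, ha⟩ := Ideal.mem_span_singleton'.mp (h.le (Ideal.mem_span_singleton_self _))
    obtain ⟨b, hb⟩ := Ideal.mem_span_singleton'.mp (h.ge (Ideal.mem_span_singleton_self _))
    have hreg := res_mem_nonZeroDivisors (D.affine _) (hκ k) (D.regular (τ k))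
    have hab : a * b = 1 := by
      rw [← sub_eq_zero]
      refine mem_nonZeroDivisors_iff_right.mp hreg _ ?_
      linear_combination a * hb + ha
    exact ⟨Units.mkOfMulEqOne _ _ hab, ha.symm⟩
  choose u hu using hu
  -- The ratios of the local equations lift to units. After this change of frames the two systems of
  -- transition functions agree modulo `p`, which yields `β`.
  choose v hv using fun k => T.exists_unit (hW k) (u k)
  have hβ (k m) : ∃ β : Γ(Y, W k ⊓ W m),
      res Y (inf_le_inf (hτ k) (hτ m)) (D.g (τ k) (τ m)) * res Y inf_le_right (v m) =
        res Y (inf_le_inf (hτ' k) (hτ' m)) (D'.g (τ' k) (τ' m)) * res Y inf_le_left (v k) *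
          (1 + (p : Γ(Y, W k ⊓ W m)) * β) := by
    have hWW := T.inf_mem _ (hW k) _ (hW m)
    have hreg := res_mem_nonZeroDivisors (D'.affine _)
      (show i ⁻¹ᵁ (W k ⊓ W m) ≤ i ⁻¹ᵁ D'.V (τ' m) from fun _ hx => hτ' m hx.2)
      (D'.regular (τ' m))
    obtain ⟨t, ht⟩ := T.exists_eq_mul _ hWW
      (res Y (inf_le_inf (hτ k) (hτ m)) (D.g (τ k) (τ m)) * res Y inf_le_right (v m) -
        res Y (inf_le_inf (hτ' k) (hτ' m)) (D'.g (τ' k) (τ' m)) * res Y inf_le_left (v k)) (by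
      refine mem_nonZeroDivisors_iff_right.mp hreg _ ?_
      have e1 := D.pull_g_mul (τ k) (τ m)
        (show i ⁻¹ᵁ (W k ⊓ W m) ≤ _ from fun _ hx => ⟨hτ k hx.1, hτ m hx.2⟩)
      have e2 := D'.pull_g_mul (τ' k) (τ' m)
        (show i ⁻¹ᵁ (W k ⊓ W m) ≤ _ from fun _ hx => ⟨hτ' k hx.1, hτ' m hx.2⟩)
      have e3 := congrArg (res X (show i ⁻¹ᵁ (W k ⊓ W m) ≤ i ⁻¹ᵁ W k from fun _ hx => hx.1)) (hu k)
      have e4 := congrArg (res X (show i ⁻¹ᵁ (W k ⊓ W m) ≤ i ⁻¹ᵁ W m from fun _ hx => hx.2)) (hu m)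
      rw [← hv] at e3 e4
      simp only [map_mul, map_sub, res_res, res_pull, pull_res] at e3 e4 ⊢
      rw [e4] at e1
      rw [e3, ← e2] at e1
      linear_combination e1)
    let q := D'.g (τ' k) (τ' m)
    refine ⟨res Y (inf_le_inf (hτ' k) (hτ' m)) ↑q⁻¹ * res Y inf_le_left ↑(v k)⁻¹ * t, ?_⟩
    have e1 := congrArg (res Y (inf_le_inf (hτ' k) (hτ' m))) q.mul_inv
    have e2 := congrArg (res Y (inf_le_left : W k ⊓ W m ≤ W k)) (v k).mul_inv
    simp only [map_mul, map_one] at e1 e2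
    linear_combination ht - (p : Γ(Y, W k ⊓ W m)) * t *
      (res Y inf_le_left (v k : Γ(Y, W k)) * res Y inf_le_left (↑(v k)⁻¹ : Γ(Y, W k))) * e1 -
      (p : Γ(Y, W k ⊓ W m)) * t * e2
  choose β hβ using hβ
  refine mem_range_d1.mpr ⟨fun k m => pull i (V := W k ⊓ W m) (U := i ⁻¹ᵁ W k ⊓ i ⁻¹ᵁ W m)
    le_rfl (β k m), fun a b e => ?_⟩
  have r₁ := res_pull i (V := W b ⊓ W e) (U := i ⁻¹ᵁ W b ⊓ i ⁻¹ᵁ W e) le_rfl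
    (leI : i ⁻¹ᵁ W a ⊓ i ⁻¹ᵁ W b ⊓ i ⁻¹ᵁ W e ≤ _) (β b e)
  have r₂ := res_pull i (V := W a ⊓ W e) (U := i ⁻¹ᵁ W a ⊓ i ⁻¹ᵁ W e) le_rfl
    (leI : i ⁻¹ᵁ W a ⊓ i ⁻¹ᵁ W b ⊓ i ⁻¹ᵁ W e ≤ _) (β a e)
  have r₃ := res_pull i (V := W a ⊓ W b) (U := i ⁻¹ᵁ W a ⊓ i ⁻¹ᵁ W b) le_rfl
    (leI : i ⁻¹ᵁ W a ⊓ i ⁻¹ᵁ W b ⊓ i ⁻¹ᵁ W e ≤ _) (β a b)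
  refine Eq.trans ?_ (congrArg₂ (· + ·) (congrArg₂ (· - ·) r₁ r₂) r₃).symm
  have hO := T.inf_mem _ (T.inf_mem _ (hW a) _ (hW b)) _ (hW e)
  have hle : W a ⊓ W b ⊓ W e ≤ D.V (τ a) ⊓ D.V (τ b) ⊓ D.V (τ e) :=
    inf_le_inf (inf_le_inf (hτ a) (hτ b)) (hτ e)
  have hle' : W a ⊓ W b ⊓ W e ≤ D'.V (τ' a) ⊓ D'.V (τ' b) ⊓ D'.V (τ' e) :=
    inf_le_inf (inf_le_inf (hτ' a) (hτ' b)) (hτ' e)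
  have h₁₂ := congrArg (res Y (leI : W a ⊓ W b ⊓ W e ≤ _)) (hβ a b)
  have h₂₃ := congrArg (res Y (leI : W a ⊓ W b ⊓ W e ≤ _)) (hβ b e)
  have h₁₃ := congrArg (res Y (leI : W a ⊓ W b ⊓ W e ≤ _)) (hβ a e)
  simp only [map_mul, map_add, map_one, map_natCast, res_res] at h₁₂ h₂₃ h₁₃
  have := T.eq_zero_of_mul _ hO _ (mul_sub_coboundary_eq_zero (T.sq_eq_zero _ hO)
    (D.res_c_spec _ _ _ hle) (D'.res_c_spec _ _ _ hle') h₁₂ h₂₃ h₁₃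
    ((D'.g _ _).isUnit.map _) ((v a).isUnit.map _) ((v b).isUnit.map _))
  simp only [map_sub, map_add, pull_res] at this
  exact sub_eq_zero.mp this

theorem IsObstruction.unique [X.IsSeparated] [CompactSpace X] (T : IsThickening i p B)
    {θ θ' : H2 X} (h : IsObstruction i p I θ) (h' : IsObstruction i p I θ') : θ = θ' := by
  obtain ⟨D, h⟩ := (isObstruction_iff _ _ _ _).mp h
  obtain ⟨D', h'⟩ := (isObstruction_iff _ _ _ _).mp h'
  obtain ⟨K, _, W, hW, hcov, τ, τ', hτ, hτ'⟩ := D.exists_refinement T D'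
  have r := h.refine (fun k => ⟨i ⁻¹ᵁ W k, T.affine _ (hW k)⟩) τ fun k _ hx => hτ k hx
  have r' := h'.refine (fun k => ⟨i ⁻¹ᵁ W k, T.affine _ (hW k)⟩) τ' fun k _ hx => hτ' k hx
  refine r.unique hcov r' ?_
  convert D.sub_mem_range T D' hW hτ hτ' using 2
  · funext a b e
    exact res_pull i _ _ _
  · funext a b e
    exact res_pull i _ _ _

end

noncomputable section

/-! ### The surface over `ℤ/p²` as a thickening of the surface over `𝔽_p` -/

namespace DoublePlane

open Cech ProjFraction

theorem _root_.ProjFraction.natCast_mul_fr {A σ : Type} [CommRing A] [SetLike σ A]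
    [AddSubgroupClass σ A] {𝒜 : ℕ → σ} [GradedRing 𝒜] {U : (Proj 𝒜).Opens} {a b : A} {n : ℕ}
    (k : ℕ) (ha : a ∈ 𝒜 n) (hb : b ∈ 𝒜 n) (h : U ≤ Proj.basicOpen 𝒜 b)
    (hka : (k : A) * a ∈ 𝒜 n) :
    (k : Γ(Proj 𝒜, U)) * fr 𝒜 a b ha hb h = fr 𝒜 ((k : A) * a) b hka hb h := by
  rw [← nsmul_eq_mul, ← natCast_zsmul, fr_zsmul]
  exact fr_congr _ _ _ _ (by simp)

variable {p : ℕ} [Fact p.Prime] {f : Form 6}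

theorem natCast_mul_mem {R : Type} [CommRing R] (k : ℕ) {n : ℕ} {a : CoordRing R f}
    (ha : a ∈ grading R f n) : (k : CoordRing R f) * a ∈ grading R f n := by
  rw [← nsmul_eq_mul]
  exact nsmul_mem ha k

theorem preimage_basicOpen (b : CoordRing (ZMod (p ^ 2)) f) :
    reductionIncl p f ⁻¹ᵁ Proj.basicOpen (grading (ZMod (p ^ 2)) f) b =
      Proj.basicOpen (grading (ZMod p) f) (coeffMap (red p) f b) := rfl

theorem pull_fr {V : (surface (ZMod (p ^ 2)) f).Opens} {U : (surface (ZMod p) f).Opens}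
    (e : U ≤ reductionIncl p f ⁻¹ᵁ V) {n : ℕ} {a b : CoordRing (ZMod (p ^ 2)) f}
    (ha : a ∈ grading (ZMod (p ^ 2)) f n) (hb : b ∈ grading (ZMod (p ^ 2)) f n)
    (h : V ≤ Proj.basicOpen (grading (ZMod (p ^ 2)) f) b) :
    pull (reductionIncl p f) e (fr _ a b ha hb h) =
      fr (grading (ZMod p) f) (coeffMap (red p) f a) (coeffMap (red p) f b)
        ((coeffMap (red p) f).map_mem ha) ((coeffMap (red p) f).map_mem hb)
        (fun _ hx => h (e hx)) :=
  map_fr _ _ ha hb h e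

variable (p f)

/-- The open sets defined by a homogeneous element of positive degree. -/
def basicOpens : Set (surface (ZMod (p ^ 2)) f).Opens :=
  {V | ∃ (m : ℕ) (b : CoordRing (ZMod (p ^ 2)) f), 0 < m ∧ b ∈ grading (ZMod (p ^ 2)) f m ∧
    Proj.basicOpen _ b = V}

variable {p f}

/-- A basic open set is the union of those of the homogeneous parts; multiplication by a coordinate
that is nonzero at the point makes the degree positive. -/
theorem exists_basicOpen_le {R : Type} [CommRing R] {V : (surface R f).Opens} {y : surface R f}
    (hy : y ∈ V) : ∃ (m : ℕ) (b : CoordRing R f), 0 < m ∧ b ∈ grading R f m ∧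
      y ∈ Proj.basicOpen (grading R f) b ∧ Proj.basicOpen (grading R f) b ≤ V := by
  obtain ⟨_, ⟨a, rfl⟩, hya, haV⟩ :=
    (Opens.isBasis_iff_nbhd.mp (Proj.isBasis_basicOpen (grading R f))) hy
  have hya' := hya
  rw [Proj.basicOpen_eq_iSup_proj, Opens.mem_iSup] at hya'
  obtain ⟨j, hj⟩ := hya'
  obtain ⟨i, hi⟩ := exists_base_X_notMem y
  refine ⟨j + 1, GradedRing.proj (grading R f) j a * base _ f (X i), j.succ_pos,
    SetLike.mul_mem_graded (SetLike.coe_mem _) (base_mem (isHomogeneous_X _ _)), ?_, ?_⟩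
  · rw [Proj.basicOpen_mul]
    exact ⟨hj, hi⟩
  · rw [Proj.basicOpen_mul]
    refine inf_le_left.trans (le_trans ?_ haV)
    rw [Proj.basicOpen_eq_iSup_proj _ a]
    exact le_iSup (fun j => Proj.basicOpen (grading R f) (GradedRing.proj (grading R f) j a)) j

omit [Fact p.Prime] in
theorem exists_mem_basicOpens (x : surface (ZMod p) f) (V : (surface (ZMod (p ^ 2)) f).Opens)
    (hx : x ∈ reductionIncl p f ⁻¹ᵁ V) :
    ∃ W ∈ basicOpens p f, x ∈ reductionIncl p f ⁻¹ᵁ W ∧ W ≤ V := by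
  obtain ⟨m, b, hm, hb, hxb, hbV⟩ := exists_basicOpen_le (y := reductionIncl p f x) hx
  exact ⟨_, ⟨m, b, hm, hb, rfl⟩, hxb, hbV⟩

theorem pull_surjective {V : (surface (ZMod (p ^ 2)) f).Opens} (hV : V ∈ basicOpens p f) :
    Function.Surjective (pull (reductionIncl p f) (le_refl (reductionIncl p f ⁻¹ᵁ V))) := by
  obtain ⟨m, b, hm, hb, rfl⟩ := hV
  intro t
  have hb' : coeffMap (red p) f b ∈ grading (ZMod p) f m := (coeffMap (red p) f).map_mem hb
  obtain ⟨N, hN⟩ := exists_fr hb' hm (preimage_basicOpen b).le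
    (preimage_basicOpen b).ge t
  obtain ⟨a, ha, rfl⟩ := hN N le_rfl
  obtain ⟨a', ha', rfl⟩ := exists_coeffMap_eq (red p) (ZMod.castHom_surjective _) ha
  refine ⟨fr _ a' (b ^ N) ha' (SetLike.pow_mem_graded N hb) (le_basicOpen_pow le_rfl N), ?_⟩
  rw [pull_fr]
  exact fr_eq _ _ _ _ _ _ (by rw [map_pow])

/-- After multiplication by a power of the denominator the numerator reduces to zero, so it is `p`
times a form; the same power goes into the denominator. -/
theorem exists_eq_mul_of_pull {V : (surface (ZMod (p ^ 2)) f).Opens} (hV : V ∈ basicOpens p f)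
    {s : Γ(surface (ZMod (p ^ 2)) f, V)}
    (hs : pull (reductionIncl p f) (le_refl (reductionIncl p f ⁻¹ᵁ V)) s = 0) :
    ∃ t, s = (p : Γ(surface (ZMod (p ^ 2)) f, V)) * t := by
  obtain ⟨m, b, hm, hb, rfl⟩ := hV
  obtain ⟨n, hN⟩ := exists_fr hb hm le_rfl le_rfl s
  obtain ⟨a, ha, rfl⟩ := hN n le_rfl
  rw [pull_fr] at hs
  have hb' : coeffMap (red p) f b ∈ grading (ZMod p) f m := (coeffMap (red p) f).map_mem hb
  obtain ⟨k, hk⟩ := exists_pow_mul_eq_zero hb' hm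
    (preimage_basicOpen b).le (preimage_basicOpen b).ge _ _ _ hs
  rw [← map_pow, ← map_pow, ← map_mul, ← map_mul] at hk
  have hbn := SetLike.pow_mem_graded n hb
  have hc := SetLike.mul_mem_graded (SetLike.pow_mem_graded k hb)
    (SetLike.pow_mem_graded (m - 1) hbn)
  obtain ⟨y, hy, e⟩ := exists_eq_p_mul (SetLike.mul_mem_graded hc ha) hk
  have hD : Proj.basicOpen (grading (ZMod (p ^ 2)) f) b ≤
      Proj.basicOpen _ (b ^ k * (b ^ n) ^ (m - 1) * b ^ n) :=
    le_basicOpen_mul (le_basicOpen_mul (le_basicOpen_pow le_rfl _)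
      (le_basicOpen_pow (le_basicOpen_pow le_rfl _) _)) (le_basicOpen_pow le_rfl _)
  refine ⟨fr _ y _ hy (SetLike.mul_mem_graded hc hbn) hD, ?_⟩
  rw [natCast_mul_fr p hy _ _ (natCast_mul_mem p hy)]
  exact fr_eq _ _ _ _ _ _ (by rw [← e]; ring)

theorem pull_eq_zero_of_mul {V : (surface (ZMod (p ^ 2)) f).Opens} (hV : V ∈ basicOpens p f)
    {s : Γ(surface (ZMod (p ^ 2)) f, V)} (hs : (p : Γ(surface (ZMod (p ^ 2)) f, V)) * s = 0) :
    pull (reductionIncl p f) (le_refl (reductionIncl p f ⁻¹ᵁ V)) s = 0 := by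
  obtain ⟨m, b, hm, hb, rfl⟩ := hV
  obtain ⟨n, hN⟩ := exists_fr hb hm le_rfl le_rfl s
  obtain ⟨a, ha, rfl⟩ := hN n le_rfl
  rw [natCast_mul_fr p ha _ _ (natCast_mul_mem p ha)] at hs
  obtain ⟨k, hk⟩ := exists_pow_mul_eq_zero hb hm le_rfl le_rfl _ _ _ hs
  have h0 := coeffMap_eq_zero_of_p_mul (x := b ^ k * (b ^ n) ^ (m - 1) * a)
    (by rw [← hk]; ring)
  have hD := (preimage_basicOpen (p := p) (f := f) b).le
  rw [pull_fr, ← fr_zero ((coeffMap (red p) f).map_mem hb) hD]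
  refine fr_eq_of_mul (s := coeffMap (red p) f (b ^ k * (b ^ n) ^ (m - 1))) _ _ _ _ _ _ ?_ ?_
  · rw [map_mul, map_pow, map_pow, map_pow]
    exact le_basicOpen_mul (le_basicOpen_pow hD _) (le_basicOpen_pow (le_basicOpen_pow hD _) _)
  · rw [← mul_assoc, ← map_mul, h0]
    ring

omit [Fact p.Prime] in
theorem p_mul_p (V : (surface (ZMod (p ^ 2)) f).Opens) :
    (p : Γ(surface (ZMod (p ^ 2)) f, V)) * (p : Γ(surface (ZMod (p ^ 2)) f, V)) = 0 := by
  have h1 : (1 : CoordRing (ZMod (p ^ 2)) f) ∈ grading (ZMod (p ^ 2)) f 0 :=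
    SetLike.GradedOne.one_mem
  have hV : V ≤ Proj.basicOpen (grading (ZMod (p ^ 2)) f) 1 := by simp
  have hp : ((p * p : ℕ) : CoordRing (ZMod (p ^ 2)) f) * 1 = 0 := by
    rw [← map_natCast (algebraMap (ZMod (p ^ 2)) _), ← pow_two, CharP.cast_eq_zero, map_zero,
      zero_mul]
  rw [← Nat.cast_mul, ← mul_one ((p * p : ℕ) : Γ(surface (ZMod (p ^ 2)) f, V)), ← fr_self h1 hV,
    natCast_mul_fr _ _ _ _ (natCast_mul_mem _ h1), ← fr_zero h1 hV]
  exact fr_congr _ _ _ _ hp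

variable (p f)

theorem isThickening : IsThickening (reductionIncl p f) p (basicOpens p f) where
  inf_mem := by
    rintro _ ⟨m, b, hm, hb, rfl⟩ _ ⟨n, c, -, hc, rfl⟩
    exact ⟨m + n, b * c, Nat.add_pos_left hm n, SetLike.mul_mem_graded hb hc,
      Proj.basicOpen_mul _ _ _⟩
  affine := by
    rintro _ ⟨m, b, hm, hb, rfl⟩
    rw [preimage_basicOpen]
    exact Proj.isAffineOpen_basicOpen _ _ ((coeffMap (red p) f).map_mem hb) hm
  exists_mem := exists_mem_basicOpens
  surjective _ hV := pull_surjective hV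
  exists_eq_mul _ hV _ hs := exists_eq_mul_of_pull hV hs
  eq_zero_of_mul _ hV _ hs := pull_eq_zero_of_mul hV hs
  sq_eq_zero V _ := p_mul_p V

instance compactSpace (R : Type) [CommRing R] : CompactSpace (surface R f) := by
  refine ⟨?_⟩
  have h := isCompact_iUnion fun i => (Proj.isAffineOpen_basicOpen (grading R f) _
    (base_mem (isHomogeneous_X R i)) one_pos).isCompact
  rwa [← Opens.coe_iSup, iSup_basicOpen_X] at h

end DoublePlane

end

noncomputable section

/-! ### Vanishing ideals on `Proj` -/

theorem AlgebraicGeometry.Scheme.IdealSheafData.mem_vanishingIdeal_ideal {X : Scheme.{0}}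
    (Z : Closeds X) (U : X.affineOpens) (s : Γ(X, U)) :
    s ∈ (Scheme.IdealSheafData.vanishingIdeal Z).ideal U ↔ ∀ y ∈ Z, y ∉ X.basicOpen s := by
  rw [Scheme.IdealSheafData.vanishingIdeal_ideal]
  refine (PrimeSpectrum.mem_vanishingIdeal _ _).trans ?_
  constructor
  · intro h y hy hys
    rw [← U.2.fromSpec_image_basicOpen] at hys
    obtain ⟨q, hq, rfl⟩ := hys
    exact hq (h q hy)
  · intro h q hq
    by_contra hqs
    refine h _ hq ?_
    rw [← U.2.fromSpec_image_basicOpen]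
    exact ⟨q, hqs, rfl⟩

namespace ProjFraction

open Cech

variable {A : Type} [CommRing A] {σ : Type} [SetLike σ A] [AddSubgroupClass σ A] {𝒜 : ℕ → σ}
  [GradedRing 𝒜] {U V : (Proj 𝒜).Opens} {a b e : A} {m n : ℕ}

theorem mem_basicOpen_fr (ha : a ∈ 𝒜 n) (hb : b ∈ 𝒜 n) (h : U ≤ Proj.basicOpen 𝒜 b)
    {y : ProjectiveSpectrum 𝒜} : y ∈ (Proj 𝒜).basicOpen (fr 𝒜 a b ha hb h) ↔ y ∈ U ∧ y ∈ Proj.basicOpen 𝒜 a := by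
  constructor
  · intro hy
    have hle := (Proj 𝒜).basicOpen_le (fr 𝒜 a b ha hb h)
    refine ⟨hle hy, fun hya => ?_⟩
    obtain ⟨t, ht⟩ : ∃ t : Γ(Proj 𝒜, (Proj 𝒜).basicOpen (fr 𝒜 a b ha hb h)),
        fr 𝒜 a b ha hb (hle.trans h) * t = 1 := (RingedSpace.isUnit_res_basicOpen (Proj 𝒜).toRingedSpace
      (fr 𝒜 a b ha hb h)).exists_right_inv
    have hv : value 𝒜 (fr 𝒜 a b ha hb (hle.trans h) * t) y hy = value 𝒜 1 y hy :=
      congrArg (fun s => value 𝒜 s y hy) ht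
    rw [value_mul, value_one, value_fr] at hv
    have hu := IsUnit.of_mul_eq_one _ hv
    have : y.asHomogeneousIdeal.toIdeal.IsPrime := y.isPrime
    rw [Localization.mk_eq_mk', IsLocalization.AtPrime.isUnit_mk'_iff
      (Localization y.asHomogeneousIdeal.toIdeal.primeCompl) y.asHomogeneousIdeal.toIdeal] at hu
    exact hu hya
  · rintro ⟨hyU, hya⟩
    have hu : IsUnit (res (Proj 𝒜) (inf_le_left : U ⊓ Proj.basicOpen 𝒜 a ≤ U)
        (fr 𝒜 a b ha hb h)) := (frUnit ha hb (inf_le_left.trans h) inf_le_right).isUnit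
    have hmem : y ∈ (Proj 𝒜).basicOpen (res (Proj 𝒜) (inf_le_left : U ⊓ Proj.basicOpen 𝒜 a ≤ U)
        (fr 𝒜 a b ha hb h)) := by
      rw [(Proj 𝒜).basicOpen_of_isUnit hu]
      exact ⟨hyU, hya⟩
    rw [res, Scheme.basicOpen_res] at hmem
    exact hmem.2

theorem fr_mem_nonZeroDivisors (he : e ∈ 𝒜 m) (hm : 0 < m) (hU : U ≤ Proj.basicOpen 𝒜 e)
    (hU' : Proj.basicOpen 𝒜 e ≤ U) (ha : a ∈ 𝒜 n) (hb : b ∈ 𝒜 n) (h : U ≤ Proj.basicOpen 𝒜 b)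
    (ha' : a ∈ nonZeroDivisors A) : fr 𝒜 a b ha hb h ∈ nonZeroDivisors Γ(Proj 𝒜, U) := by
  rw [mem_nonZeroDivisors_iff_right]
  intro s hs
  obtain ⟨N, hN⟩ := exists_fr he hm hU hU' s
  obtain ⟨x, hx, rfl⟩ := hN N le_rfl
  rw [fr_mul] at hs
  obtain ⟨k, hk⟩ := exists_pow_mul_eq_zero he hm hU hU' _ _ _ hs
  rw [← mul_assoc] at hk
  have h0 := (mem_nonZeroDivisors_iff_right.mp ha') _ hk
  have heN := le_basicOpen_pow hU N
  rw [← fr_zero (SetLike.pow_mem_graded N he) heN]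
  refine fr_eq_of_mul (s := e ^ k * (e ^ N * b) ^ (m - 1)) _ _ _ _ _ _
    (le_basicOpen_mul (le_basicOpen_pow hU _) (le_basicOpen_pow (le_basicOpen_mul heN h) _)) ?_
  rw [← mul_assoc, h0]
  ring

/-- A function which vanishes where a nonzerodivisor does not is zero. -/
theorem eq_zero_of_res_eq_zero (he : e ∈ 𝒜 m) (hm : 0 < m) (hU : U ≤ Proj.basicOpen 𝒜 e)
    (hU' : Proj.basicOpen 𝒜 e ≤ U) (ha : a ∈ 𝒜 n) (hV : V ≤ U)
    (hV' : U ⊓ Proj.basicOpen 𝒜 a ≤ V) (ha' : a ∈ nonZeroDivisors A) {s : Γ(Proj 𝒜, U)}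
    (hs : res (Proj 𝒜) hV s = 0) : s = 0 := by
  obtain ⟨N, hN⟩ := exists_fr he hm hU hU' s
  obtain ⟨x, hx, rfl⟩ := hN N le_rfl
  have hs' := congrArg (res (Proj 𝒜) hV') hs
  rw [res_fr, res_fr, map_zero] at hs'
  have hea := SetLike.mul_mem_graded he ha
  obtain ⟨k, hk⟩ := exists_pow_mul_eq_zero hea (Nat.add_pos_left hm n)
    (le_basicOpen_mul (inf_le_left.trans hU) inf_le_right)
    (by rw [Proj.basicOpen_mul]; exact inf_le_inf_right _ hU') _ _ _ hs'
  have h0 : e ^ k * (e ^ N) ^ (m + n - 1) * x = 0 := by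
    refine (mem_nonZeroDivisors_iff_right.mp (pow_mem ha' k)) _ ?_
    rw [← hk]
    ring
  have heN := le_basicOpen_pow hU N
  rw [← fr_zero (SetLike.pow_mem_graded N he) heN]
  refine fr_eq_of_mul (s := e ^ k * (e ^ N) ^ (m + n - 1)) _ _ _ _ _ _
    (le_basicOpen_mul (le_basicOpen_pow hU _) (le_basicOpen_pow heN _)) ?_
  rw [← mul_assoc, h0]
  ring

/-- The vanishing ideal of `Z` on `D(e)` is generated by `g / b` as soon as the ideal `P` of `Z`
agrees on `D(e)` with the ideal generated by `g`. -/
theorem span_fr_eq_ideal (he : e ∈ 𝒜 m) (hm : 0 < m) (hU : U ≤ Proj.basicOpen 𝒜 e)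
    (hU' : Proj.basicOpen 𝒜 e ≤ U) (hUa : IsAffineOpen U) {Z : Closeds (Proj 𝒜)} {P : Ideal A}
    (hP : ∀ x, (∀ y ∈ Z, x ∈ y.asHomogeneousIdeal) → x ∈ P) {g v : A} {k : ℕ}
    (hv : v ∈ 𝒜 k) (hUv : U ≤ Proj.basicOpen 𝒜 v) (hg : g ∈ 𝒜 n) (hb : b ∈ 𝒜 n)
    (h : U ≤ Proj.basicOpen 𝒜 b) (hgZ : ∀ y ∈ Z, y ∈ U → g ∈ y.asHomogeneousIdeal)
    (hvP : ∀ x ∈ P, v * x ∈ Ideal.span {g}) :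
    Ideal.span {fr 𝒜 g b hg hb h} =
      (Scheme.IdealSheafData.vanishingIdeal Z).ideal ⟨U, hUa⟩ := by
  apply le_antisymm
  · rw [Ideal.span_le, Set.singleton_subset_iff, SetLike.mem_coe,
      Scheme.IdealSheafData.mem_vanishingIdeal_ideal]
    intro y hy hys
    have h' := (mem_basicOpen_fr hg hb h).mp hys
    exact h'.2 (hgZ y hy h'.1)
  · intro s hs
    rw [Scheme.IdealSheafData.mem_vanishingIdeal_ideal] at hs
    obtain ⟨N, hN⟩ := exists_fr he hm hU hU' s
    obtain ⟨x, hx, rfl⟩ := hN N le_rfl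
    -- On `Z ∩ D(e)` the numerator vanishes, and off `D(e)` the factor `e` does.
    have hex : e * x ∈ P := by
      refine hP _ fun y hy => ?_
      by_cases hye : y ∈ Proj.basicOpen 𝒜 e
      · by_contra hyx
        refine hs y hy ((mem_basicOpen_fr _ _ _).mpr ⟨hU' hye, fun hx => hyx ?_⟩)
        exact Ideal.mul_mem_left _ _ hx
      · exact Ideal.mul_mem_right _ _ (not_not.mp hye)
    obtain ⟨c, hc⟩ := Ideal.mem_span_singleton'.mp (hvP _ hex)
    have hvex := SetLike.mul_mem_graded hv (SetLike.mul_mem_graded he hx)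
    -- The cofactor `c` need not be homogeneous; the part of `b c` of the right degree is taken
    -- instead.
    obtain ⟨c', hcm, hc'⟩ : ∃ c' ∈ 𝒜 (k + (m + N • m)), g * c' = b * (v * (e * x)) := by
      refine ⟨DirectSum.decompose 𝒜 (b * c) (k + (m + N • m)), SetLike.coe_mem _, ?_⟩
      rw [← DirectSum.coe_decompose_mul_add_of_left_mem 𝒜 hg,
        ← DirectSum.decompose_of_mem_same 𝒜 (SetLike.mul_mem_graded hb hvex), ← hc]
      congr 3
      ring
    have hveN := SetLike.mul_mem_graded hv (SetLike.mul_mem_graded he (SetLike.pow_mem_graded N he))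
    refine Ideal.mem_span_singleton'.mpr ⟨fr 𝒜 c' (v * (e * e ^ N)) hcm hveN
      (le_basicOpen_mul hUv (le_basicOpen_mul hU (le_basicOpen_pow hU N))), ?_⟩
    rw [fr_mul]
    exact fr_eq _ _ _ _ _ _ (by linear_combination e ^ N * hc')

end ProjFraction

end

noncomputable section

/-! ### Lifted transition functions for one of the two components -/

namespace DoublePlane

open Cech ProjFraction

section Defs

variable (R : Type) [CommRing R] (f : Form 6) (l : Form 1) (f₃ : Form 3) (f₅ : Form 5) (ε : ℤˣ)

/-- The form `w + ε f₃`, which vanishes on the component. -/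
def wAdd : CoordRing R f := w R f + (ε : ℤ) • coe R f f₃

/-- The form `w - ε f₃`, which vanishes on the other component. -/
def wSub : CoordRing R f := w R f - (ε : ℤ) • coe R f f₃

/-- The forms which define an open covering on which the component is principal. -/
def patchForm : Fin 4 → CoordRing R f :=
  ![coe R f l, coe R f f₃ * wAdd R f f₃ ε, coe R f f₃ * wSub R f f₃ ε, coe R f f₅]

/-- The equation of the component on the members of the covering is the unit form, `ℓ` or
`w + ε f₃`; this is the number of the form. -/
def patchClass : Fin 4 → Fin 3 := ![0, 0, 1, 2]

/-- The three equations. -/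
def eqnForm : Fin 3 → CoordRing R f := ![1, coe R f l, wAdd R f f₃ ε]

/-- The degrees of the equations. -/
abbrev eqnDeg : Fin 3 → ℕ := ![0, 1, 3]

/-- The numerators of the transition functions `transForm i j / transForm j i`. -/
def transForm : Fin 3 → Fin 3 → CoordRing R f :=
  ![![1, 1, 1], ![coe R f l, 1, wSub R f f₃ ε], ![wAdd R f f₃ ε, coe R f f₅, 1]]

/-- The degrees of the numerators. -/
abbrev transDeg : Fin 3 → Fin 3 → ℕ := ![![0, 0, 0], ![1, 0, 3], ![3, 5, 0]]

/-- The open covering. -/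
def patch (a : Fin 4 × Fin 3) : (surface R f).Opens :=
  -- The coordinate supplies a denominator that turns an equation of positive degree into a
  -- function.
  Proj.basicOpen (grading R f) (patchForm R f l f₃ f₅ ε a.1 * base R f (X a.2))

end Defs

section General

variable {R : Type} [CommRing R] {f : Form 6} {l : Form 1} {f₃ : Form 3} {f₅ : Form 5} {ε : ℤˣ}

theorem wAdd_mem : wAdd R f f₃ ε ∈ grading R f 3 :=
  add_mem (w_mem _ f) (zsmul_mem (coe_mem _ f f₃) _)

theorem wSub_mem : wSub R f f₃ ε ∈ grading R f 3 :=
  sub_mem (w_mem _ f) (zsmul_mem (coe_mem _ f f₃) _)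

theorem one_mem_grading : (1 : CoordRing R f) ∈ grading R f 0 := SetLike.GradedOne.one_mem

theorem patchForm_mem (i : Fin 4) :
    patchForm R f l f₃ f₅ ε i ∈ grading R f (![1, 6, 6, 5] i) := by
  fin_cases i
  exacts [coe_mem _ _ l, SetLike.mul_mem_graded (coe_mem _ _ f₃) wAdd_mem,
    SetLike.mul_mem_graded (coe_mem _ _ f₃) wSub_mem, coe_mem _ _ f₅]

theorem eqnForm_mem (i : Fin 3) : eqnForm R f l f₃ ε i ∈ grading R f (eqnDeg i) := by
  fin_cases i
  exacts [one_mem_grading, coe_mem _ _ l, wAdd_mem]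

theorem transForm_mem (i j : Fin 3) :
    transForm R f l f₃ f₅ ε i j ∈ grading R f (transDeg i j) := by
  fin_cases i <;> fin_cases j
  exacts [one_mem_grading, one_mem_grading, one_mem_grading, coe_mem _ _ l, one_mem_grading,
    wSub_mem, wAdd_mem, coe_mem _ _ f₅, one_mem_grading]

theorem base_X_pow_mem (i : Fin 3) (k : ℕ) : base R f (X i) ^ k ∈ grading R f k := by
  simpa using SetLike.pow_mem_graded k (base_mem (f := f) (isHomogeneous_X R i))

theorem patch_mem (a : Fin 4 × Fin 3) : patchForm R f l f₃ f₅ ε a.1 * base R f (X a.2) ∈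
    grading R f (![1, 6, 6, 5] a.1 + 1) :=
  SetLike.mul_mem_graded (patchForm_mem _) (base_mem (isHomogeneous_X _ _))

theorem transForm_mul_mem (i j : Fin 3) (m : Fin 3) :
    transForm R f l f₃ f₅ ε i j * base R f (X m) ^ eqnDeg j ∈
      grading R f (transDeg i j + eqnDeg j) :=
  SetLike.mul_mem_graded (transForm_mem _ _) (base_X_pow_mem _ _)

theorem transDeg_add (i j : Fin 3) : transDeg j i + eqnDeg i = transDeg i j + eqnDeg j := by
  revert i j; decide

theorem patch_le_patchForm (a : Fin 4 × Fin 3) : patch R f l f₃ f₅ ε a ≤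
    Proj.basicOpen (grading R f) (patchForm R f l f₃ f₅ ε a.1) := by
  rw [patch, Proj.basicOpen_mul]
  exact inf_le_left

theorem patch_le_X (a : Fin 4 × Fin 3) : patch R f l f₃ f₅ ε a ≤
    Proj.basicOpen (grading R f) (base R f (X a.2)) := by
  rw [patch, Proj.basicOpen_mul]
  exact inf_le_right

variable {p : ℕ} {G : Form 6} (h : (f : MvPolynomial (Fin 3) ℤ) = f₃ ^ 2 + l * f₅ + p * G)

theorem units_cast_sq : ((ε : ℤ) : CoordRing R f) ^ 2 = 1 := by
  rw [← Int.cast_pow, ← Units.val_pow_eq_pow_val, Int.units_sq, Units.val_one, Int.cast_one]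

include h

theorem wAdd_mul_wSub : wAdd R f f₃ ε * wSub R f f₃ ε =
    coe R f l * coe R f f₅ + (p : CoordRing R f) * coe R f G := by
  have hw := w_sq (R := R) (f := f)
  rw [← coe_eq, h, map_add, map_add, map_mul, map_mul, map_pow, map_natCast] at hw
  rw [wAdd, wSub, zsmul_eq_mul]
  linear_combination hw - coe R f f₃ ^ 2 * units_cast_sq (R := R) (f := f) (ε := ε)

/-- For distinct indices in even order the two products are `(w + εf₃)(w - εf₃)` and `ℓf₅`, with
quotient `1 + pG/(ℓf₅)`. In odd order they are exchanged, and the inverse `1 - pG/(ℓf₅)` requires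
`p² = 0`. -/
theorem transForm_cocycle (hp : (p : CoordRing R f) ^ 2 = 0) (i j k : Fin 3) :
    transForm R f l f₃ f₅ ε i j * transForm R f l f₃ f₅ ε j k * transForm R f l f₃ f₅ ε k i *
      (coe R f l * coe R f f₅) =
    transForm R f l f₃ f₅ ε j i * transForm R f l f₃ f₅ ε k j * transForm R f l f₃ f₅ ε i k *
      (coe R f l * coe R f f₅ + (p : CoordRing R f) * (triSign i j k • coe R f G)) := by
  have hw := wAdd_mul_wSub (R := R) (ε := ε) h
  fin_cases i <;> fin_cases j <;> fin_cases k <;>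
    simp [transForm, triSign] <;> first
      | ring1
      | linear_combination (coe R f l * coe R f f₅) * hw
      | linear_combination -(coe R f l * coe R f f₅ - (p : CoordRing R f) * coe R f G) * hw +
          coe R f G ^ 2 * hp

theorem transForm_mul_eqnForm (hp : (p : CoordRing R f) = 0) (i j : Fin 3) :
    transForm R f l f₃ f₅ ε i j * eqnForm R f l f₃ ε j =
      transForm R f l f₃ f₅ ε j i * eqnForm R f l f₃ ε i := by
  have hw := wAdd_mul_wSub (R := R) (ε := ε) h
  rw [hp] at hw
  fin_cases i <;> fin_cases j <;> simp [transForm, eqnForm] <;> first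
      | linear_combination hw
      | linear_combination -hw

omit h in
theorem transForm_cocycle_of_eq_zero {i j k : Fin 3} (hijk : triSign i j k = 0) :
    transForm R f l f₃ f₅ ε i j * transForm R f l f₃ f₅ ε j k * transForm R f l f₃ f₅ ε k i =
    transForm R f l f₃ f₅ ε j i * transForm R f l f₃ f₅ ε k j * transForm R f l f₃ f₅ ε i k := by
  have : i = j ∨ j = k ∨ i = k := by
    revert i j k; decide
  rcases this with rfl | rfl | rfl <;> ring

/-- The products `(w + εf₃)(w - εf₃)` and `ℓf₅` differ by the nilpotent `p G`, which lies in every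
prime. -/
theorem mem_basicOpen_iff (hp : (p : CoordRing R f) ^ 2 = 0) (y : surface R f) :
    y ∈ Proj.basicOpen (grading R f) (wAdd R f f₃ ε) ∧
      y ∈ Proj.basicOpen (grading R f) (wSub R f f₃ ε) ↔
    y ∈ Proj.basicOpen (grading R f) (coe R f l) ∧
      y ∈ Proj.basicOpen (grading R f) (coe R f f₅) := by
  have hw := wAdd_mul_wSub (R := R) (ε := ε) h
  have hprime : y.asHomogeneousIdeal.toIdeal.IsPrime := y.isPrime
  have hpy : (p : CoordRing R f) * coe R f G ∈ y.asHomogeneousIdeal.toIdeal :=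
    Ideal.mul_mem_right _ _ (hprime.mem_of_pow_mem 2 (hp ▸ zero_mem _))
  have key : wAdd R f f₃ ε * wSub R f f₃ ε ∈ y.asHomogeneousIdeal.toIdeal ↔
      coe R f l * coe R f f₅ ∈ y.asHomogeneousIdeal.toIdeal := by
    rw [hw]
    exact Ideal.add_mem_iff_left _ hpy
  rw [hprime.mul_mem_iff_mem_or_mem, hprime.mul_mem_iff_mem_or_mem] at key
  change ¬ _ ∧ ¬ _ ↔ ¬ _ ∧ ¬ _
  rw [← not_or, ← not_or]
  exact not_congr key

theorem le_transForm (hp : (p : CoordRing R f) ^ 2 = 0) {O : (surface R f).Opens}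
    {a b : Fin 4 × Fin 3} (ha : O ≤ patch R f l f₃ f₅ ε a) (hb : O ≤ patch R f l f₃ f₅ ε b) :
    O ≤ Proj.basicOpen (grading R f)
      (transForm R f l f₃ f₅ ε (patchClass a.1) (patchClass b.1)) := by
  intro y hy
  have h1 := patch_le_patchForm a (ha hy)
  have h2 := patch_le_patchForm b (hb hy)
  have h3 := mem_basicOpen_iff (ε := ε) h hp y
  clear ha hb
  generalize a.1 = i at *
  generalize b.1 = j at *
  fin_cases i <;> fin_cases j <;>
    simp only [patchForm, patchClass, transForm, Fin.zero_eta, Fin.mk_one, Fin.reduceFinMk,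
      Matrix.cons_val_zero, Matrix.cons_val_one, Matrix.cons_val, Proj.basicOpen_mul,
      Proj.basicOpen_one, Opens.mem_inf, Opens.mem_top] at h1 h2 ⊢ <;> tauto

/-- Three different classes involve the patches of `f₃(w - εf₃)` and `f₅`, and that of `ℓ` or of
`f₃(w + εf₃)`; in the last case both `w ± εf₃` are nonzero, hence `ℓf₅` is. -/
theorem le_coe_mul_coe (hp : (p : CoordRing R f) ^ 2 = 0) {O : (surface R f).Opens}
    {a b e : Fin 4 × Fin 3} (ha : O ≤ patch R f l f₃ f₅ ε a) (hb : O ≤ patch R f l f₃ f₅ ε b)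
    (he : O ≤ patch R f l f₃ f₅ ε e)
    (hs : triSign (patchClass a.1) (patchClass b.1) (patchClass e.1) ≠ 0) :
    O ≤ Proj.basicOpen (grading R f) (coe R f l * coe R f f₅) := by
  intro y hy
  have h1 := patch_le_patchForm a (ha hy)
  have h2 := patch_le_patchForm b (hb hy)
  have h4 := patch_le_patchForm e (he hy)
  have h3 := mem_basicOpen_iff (ε := ε) h hp y
  clear ha hb he
  generalize a.1 = i at *
  generalize b.1 = j at *
  generalize e.1 = k at *
  fin_cases i <;> fin_cases j <;> fin_cases k <;> first
    | exact absurd (by decide) hs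
    | simp only [patchForm, Fin.zero_eta, Fin.mk_one, Fin.reduceFinMk,
      Matrix.cons_val_zero, Matrix.cons_val_one, Matrix.cons_val, Proj.basicOpen_mul,
      Opens.mem_inf] at h1 h2 h4 ⊢
      tauto

end General

end DoublePlane

end

noncomputable section

/-! ### A lifting datum for the component -/

namespace DoublePlane

open Cech ProjFraction TernaryForms

variable {p : ℕ} {f : Form 6} {l : Form 1} {f₃ : Form 3} {f₅ : Form 5} {G : Form 6} {ε : ℤˣ}

theorem natCast_sq_eq_zero : (p : CoordRing (ZMod (p ^ 2)) f) ^ 2 = 0 := by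
  rw [← Nat.cast_pow, ← map_natCast (algebraMap (ZMod (p ^ 2)) _), CharP.cast_eq_zero, map_zero]

theorem natCast_eq_zero : (p : CoordRing (ZMod p) f) = 0 := by
  rw [← map_natCast (algebraMap (ZMod p) _), CharP.cast_eq_zero, map_zero]

variable [Fact p.Prime]

theorem coeffMap_wAdd : coeffMap (red p) f (wAdd (ZMod (p ^ 2)) f f₃ ε) = wAdd (ZMod p) f f₃ ε := by
  rw [wAdd, wAdd, map_add, map_zsmul, coeffMap_w, coeffMap_coe]

theorem coeffMap_wSub : coeffMap (red p) f (wSub (ZMod (p ^ 2)) f f₃ ε) = wSub (ZMod p) f f₃ ε := by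
  rw [wSub, wSub, map_sub, map_zsmul, coeffMap_w, coeffMap_coe]

theorem coeffMap_patchForm (i : Fin 4) :
    coeffMap (red p) f (patchForm (ZMod (p ^ 2)) f l f₃ f₅ ε i) =
      patchForm (ZMod p) f l f₃ f₅ ε i := by
  fin_cases i <;> simp [patchForm, coeffMap_coe, coeffMap_wAdd, coeffMap_wSub]

theorem coeffMap_transForm (i j : Fin 3) :
    coeffMap (red p) f (transForm (ZMod (p ^ 2)) f l f₃ f₅ ε i j) =
      transForm (ZMod p) f l f₃ f₅ ε i j := by
  fin_cases i <;> fin_cases j <;>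
    simp [transForm, coeffMap_coe, coeffMap_wAdd, coeffMap_wSub]

theorem preimage_patch (a : Fin 4 × Fin 3) :
    reductionIncl p f ⁻¹ᵁ patch (ZMod (p ^ 2)) f l f₃ f₅ ε a = patch (ZMod p) f l f₃ f₅ ε a := by
  rw [patch, preimage_basicOpen, map_mul, coeffMap_patchForm, coeffMap_base, map_X, patch]

omit [Fact p.Prime] in
theorem isAffineOpen_patch {R : Type} [CommRing R] (a : Fin 4 × Fin 3) :
    IsAffineOpen (patch R f l f₃ f₅ ε a) :=
  Proj.isAffineOpen_basicOpen _ _ (patch_mem a) (Nat.succ_pos _)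

theorem isUnit_two (hp : p ≠ 2) : IsUnit (2 : CoordRing (ZMod p) f) := by
  have h2 : (2 : ZMod p) ≠ 0 := by
    intro h
    have : ((2 : ℕ) : ZMod p) = 0 := by exact_mod_cast h
    rw [ZMod.natCast_eq_zero_iff] at this
    exact hp ((Nat.prime_dvd_prime_iff_eq Fact.out Nat.prime_two).mp this)
  have := h2.isUnit.map (algebraMap (ZMod p) (CoordRing (ZMod p) f))
  rwa [map_ofNat] at this

section

variable (H : IsCompleteIntersection (intMap (ZMod p) l) (intMap (ZMod p) f₃)
  (intMap (ZMod p) f₅))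

include H

theorem coe_mem_nonZeroDivisors : coe (ZMod p) f l ∈ nonZeroDivisors (CoordRing (ZMod p) f) ∧
    coe (ZMod p) f f₃ ∈ nonZeroDivisors (CoordRing (ZMod p) f) ∧
    coe (ZMod p) f f₅ ∈ nonZeroDivisors (CoordRing (ZMod p) f) :=
  ⟨base_mem_nonZeroDivisors (mem_nonZeroDivisors_of_ne_zero H.ne_zero),
    base_mem_nonZeroDivisors (mem_nonZeroDivisors_of_ne_zero H.cubic_ne_zero),
    base_mem_nonZeroDivisors (mem_nonZeroDivisors_of_ne_zero H.quintic_ne_zero)⟩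

/-- Where all four forms vanish, so do `ℓ` and `f₅`; if `f₃` did not, both `w ± εf₃` would vanish
and with them `2f₃`. So `ℓ, f₃, f₅` would have a common zero. -/
theorem iSup_patch (hp : p ≠ 2) : ⨆ a, patch (ZMod p) f l f₃ f₅ ε a = ⊤ := by
  refine top_le_iff.mp fun y _ => ?_
  have hprime : y.asHomogeneousIdeal.toIdeal.IsPrime := y.isPrime
  obtain ⟨m, hm⟩ := exists_base_X_notMem y
  suffices ∃ i, patchForm (ZMod p) f l f₃ f₅ ε i ∉ y.asHomogeneousIdeal.toIdeal by
    obtain ⟨i, hi⟩ := this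
    exact Opens.mem_iSup.mpr ⟨(i, m), fun h => (hprime.mem_or_mem h).elim hi hm⟩
  by_contra! hy
  have h0 : coe (ZMod p) f l ∈ y.asHomogeneousIdeal.toIdeal := hy 0
  have h1 := hprime.mem_or_mem (hy 1)
  have h2 := hprime.mem_or_mem (hy 2)
  have h5 : coe (ZMod p) f f₅ ∈ y.asHomogeneousIdeal.toIdeal := hy 3
  have h3 : coe (ZMod p) f f₃ ∈ y.asHomogeneousIdeal.toIdeal := by
    rcases h1 with h | h1
    · exact h
    rcases h2 with h | h2
    · exact h
    have hd := Ideal.mul_mem_left _ ((ε : ℤ) : CoordRing (ZMod p) f) (sub_mem h1 h2)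
    have e : ((ε : ℤ) : CoordRing (ZMod p) f) * (wAdd (ZMod p) f f₃ ε - wSub (ZMod p) f f₃ ε) =
        2 * coe (ZMod p) f f₃ := by
      rw [wAdd, wSub, zsmul_eq_mul]
      linear_combination 2 * coe (ZMod p) f f₃ * units_cast_sq (R := ZMod p) (f := f) (ε := ε)
    rw [e] at hd
    exact (Ideal.unit_mul_mem_iff_mem _ (isUnit_two hp)).mp hd
  have htop : y ∈ (⊤ : (surface (ZMod p) f).Opens) := trivial
  rw [← sup_openOf_eq_top (f := f) H] at htop
  rcases htop with (h | h) | h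
  exacts [h h0, h h3, h h5]

variable (h : (f : MvPolynomial (Fin 3) ℤ) = f₃ ^ 2 + l * f₅ + p * G)

include h

/-- The only case with content is `w + εf₃`, a factor of the nonzerodivisor `ℓf₅`. -/
theorem eqnForm_mem_nonZeroDivisors (i : Fin 3) :
    eqnForm (ZMod p) f l f₃ ε i ∈ nonZeroDivisors (CoordRing (ZMod p) f) := by
  obtain ⟨h0, -, h5⟩ := coe_mem_nonZeroDivisors (f := f) H
  have hw := wAdd_mul_wSub (R := ZMod p) (ε := ε) h
  rw [natCast_eq_zero, zero_mul, add_zero] at hw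
  fin_cases i
  · exact one_mem _
  · exact h0
  · have := mul_mem h0 h5
    rw [← hw, mul_mem_nonZeroDivisors] at this
    exact this.1

end

variable (h : (f : MvPolynomial (Fin 3) ℤ) = f₃ ^ 2 + l * f₅ + p * G)

variable (R : Type) [CommRing R] (f l f₃ f₅ ε) in
/-- Forms which carry the ideal of the component into the ideal of its equation. -/
def cofactor : Fin 3 → CoordRing R f := ![1, wSub R f f₃ ε, coe R f f₅]

omit [Fact p.Prime] in
theorem cofactor_mem {R : Type} [CommRing R] (i : Fin 3) :
    cofactor f f₃ f₅ ε R i ∈ grading R f (![0, 3, 5] i) := by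
  fin_cases i
  exacts [one_mem_grading, wSub_mem, coe_mem _ _ f₅]

omit [Fact p.Prime] in
theorem patch_le_cofactor {R : Type} [CommRing R] (a : Fin 4 × Fin 3) : patch R f l f₃ f₅ ε a ≤
    Proj.basicOpen (grading R f) (cofactor f f₃ f₅ ε R (patchClass a.1)) := by
  refine (patch_le_patchForm a).trans ?_
  generalize a.1 = i
  fin_cases i
  · exact le_top.trans_eq (Proj.basicOpen_one _).symm
  · exact le_top.trans_eq (Proj.basicOpen_one _).symm
  · exact (Proj.basicOpen_mul _ _ _).le.trans inf_le_right
  · exact le_rfl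

omit [Fact p.Prime] in
include h in
theorem cofactor_mul_mem (i : Fin 3) {x : CoordRing (ZMod p) f}
    (hx : x ∈ Ideal.span {coe (ZMod p) f l, wAdd (ZMod p) f f₃ ε}) :
    cofactor f f₃ f₅ ε (ZMod p) i * x ∈ Ideal.span {eqnForm (ZMod p) f l f₃ ε i} := by
  have hw := wAdd_mul_wSub (R := ZMod p) (ε := ε) h
  rw [natCast_eq_zero, zero_mul, add_zero] at hw
  obtain ⟨α, β, rfl⟩ := Ideal.mem_span_pair.mp hx
  rw [Ideal.mem_span_singleton']
  fin_cases i
  · exact ⟨_, mul_one _⟩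
  · refine ⟨α * wSub (ZMod p) f f₃ ε + β * coe (ZMod p) f f₅, ?_⟩
    simp [cofactor, eqnForm]
    linear_combination -β * hw
  · refine ⟨α * wSub (ZMod p) f f₃ ε + β * coe (ZMod p) f f₅, ?_⟩
    simp [cofactor, eqnForm]
    linear_combination α * hw

/-- The ideal is a homogeneous prime, so it is itself a point of the locus, its generic point. -/
theorem mem_span_of_vanish (hl : intMap (ZMod p) l ≠ 0)
    (h : (f : MvPolynomial (Fin 3) ℤ) = f₃ ^ 2 + l * f₅ + p * G) {x : CoordRing (ZMod p) f}
    (hx : ∀ y ∈ vanish (ZMod p) f (coe (ZMod p) f l) (wAdd (ZMod p) f f₃ ε),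
      x ∈ y.asHomogeneousIdeal) :
    x ∈ Ideal.span {coe (ZMod p) f l, wAdd (ZMod p) f f₃ ε} := by
  obtain ⟨hprime, ⟨i, hi⟩, -⟩ := isPrime_span_pair hl h ε
  have hhom : (Ideal.span {coe (ZMod p) f l, wAdd (ZMod p) f f₃ ε}).IsHomogeneous
      (grading (ZMod p) f) := Ideal.homogeneous_span _ _ (by
    rintro _ (rfl | rfl)
    exacts [⟨1, coe_mem _ _ l⟩, ⟨3, wAdd_mem⟩])
  let y : ProjectiveSpectrum (grading (ZMod p) f) := ⟨⟨_, hhom⟩, hprime, fun h =>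
    hi (h (HomogeneousIdeal.mem_irrelevant_of_mem _ one_pos (base_mem (isHomogeneous_X _ _))))⟩
  exact hx y (mem_vanish.mpr ⟨Ideal.subset_span (by simp), Ideal.subset_span (by simp)⟩)

omit [Fact p.Prime] in
theorem eqnForm_mem_of_mem_vanish {R : Type} [CommRing R] {a : Fin 4 × Fin 3} {y : surface R f}
    (hy : y ∈ vanish R f (coe R f l) (wAdd R f f₃ ε)) (hya : y ∈ patch R f l f₃ f₅ ε a) :
    eqnForm R f l f₃ ε (patchClass a.1) ∈ y.asHomogeneousIdeal := by
  obtain ⟨h0, h1⟩ := mem_vanish.mp hy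
  have hy' := patch_le_patchForm a hya
  clear hya
  generalize a.1 = i at *
  fin_cases i
  · exact absurd h0 hy'
  · exact absurd (Ideal.mul_mem_left _ _ h1) hy'
  · exact h0
  · exact h1

section

variable (f l f₃ f₅ ε) in
/-- The function `G / (ℓ f₅)`, where it is needed for the cocycle. -/
def liftingCocycle (R : Type) [CommRing R] (G : Form 6) (O : (surface R f).Opens) (n : ℤ)
    (hO : n ≠ 0 → O ≤ Proj.basicOpen (grading R f) (coe R f l * coe R f f₅)) :
    Γ(surface R f, O) :=
  open Classical in
  if hn : n ≠ 0 then n • fr (grading R f) (coe R f G) (coe R f l * coe R f f₅) (coe_mem R f G)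
    (SetLike.mul_mem_graded (coe_mem R f l) (coe_mem R f f₅)) (hO hn)
  else 0

end

section

variable {a b e : Fin 4 × Fin 3}

variable (p f l f₃ f₅ ε) in
/-- The numerators of the transition functions of the sheaf. -/
abbrev transNum (R : Type) [CommRing R] (a b : Fin 4 × Fin 3) : CoordRing R f :=
  transForm R f l f₃ f₅ ε (patchClass a.1) (patchClass b.1) *
    base R f (X b.2) ^ eqnDeg (patchClass b.1)

omit [Fact p.Prime] in
theorem transNum_mem {R : Type} [CommRing R] (a b : Fin 4 × Fin 3) :
    transNum f l f₃ f₅ ε R a b ∈ grading R f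
      (transDeg (patchClass a.1) (patchClass b.1) + eqnDeg (patchClass b.1)) :=
  transForm_mul_mem _ _ _

omit [Fact p.Prime] in
theorem transNum_mem' {R : Type} [CommRing R] (a b : Fin 4 × Fin 3) :
    transNum f l f₃ f₅ ε R b a ∈ grading R f
      (transDeg (patchClass a.1) (patchClass b.1) + eqnDeg (patchClass b.1)) :=
  mem_of_eq (transForm_mul_mem _ _ _) (transDeg_add _ _)

omit [Fact p.Prime] in
include h in
theorem le_transNum {O : (surface (ZMod (p ^ 2)) f).Opens}
    (ha : O ≤ patch (ZMod (p ^ 2)) f l f₃ f₅ ε a) (hb : O ≤ patch (ZMod (p ^ 2)) f l f₃ f₅ ε b) :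
    O ≤ Proj.basicOpen (grading (ZMod (p ^ 2)) f) (transNum f l f₃ f₅ ε (ZMod (p ^ 2)) a b) :=
  le_basicOpen_mul (le_transForm h natCast_sq_eq_zero ha hb)
    (le_basicOpen_pow (hb.trans (patch_le_X b)) _)

variable (a b) in
/-- The transition functions. -/
def transition {O : (surface (ZMod (p ^ 2)) f).Opens}
    (ha : O ≤ patch (ZMod (p ^ 2)) f l f₃ f₅ ε a) (hb : O ≤ patch (ZMod (p ^ 2)) f l f₃ f₅ ε b) :
    Γ(surface (ZMod (p ^ 2)) f, O)ˣ :=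
  frUnit (transNum_mem a b) (transNum_mem' a b) (le_transNum h hb ha) (le_transNum h ha hb)

omit [Fact p.Prime] in
theorem transition_mul {O : (surface (ZMod (p ^ 2)) f).Opens}
    (ha : O ≤ patch (ZMod (p ^ 2)) f l f₃ f₅ ε a) (hb : O ≤ patch (ZMod (p ^ 2)) f l f₃ f₅ ε b)
    (he : O ≤ patch (ZMod (p ^ 2)) f l f₃ f₅ ε e) :
    (transition h a b ha hb : Γ(surface (ZMod (p ^ 2)) f, O)) * transition h b e hb he =
      transition h a e ha he * (1 + (p : Γ(surface (ZMod (p ^ 2)) f, O)) *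
        liftingCocycle f l f₅ (ZMod (p ^ 2)) G O
          (triSign (patchClass a.1) (patchClass b.1) (patchClass e.1))
          (le_coe_mul_coe h natCast_sq_eq_zero ha hb he)) := by
  change fr _ _ _ (transNum_mem a b) (transNum_mem' a b) (le_transNum h hb ha) *
    fr _ _ _ (transNum_mem b e) (transNum_mem' b e) (le_transNum h he hb) =
    fr _ _ _ (transNum_mem a e) (transNum_mem' a e) (le_transNum h he ha) * _
  by_cases hs : triSign (patchClass a.1) (patchClass b.1) (patchClass e.1) = 0
  · rw [liftingCocycle, dif_neg (not_not.mpr hs), mul_zero, add_zero, mul_one, fr_mul]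
    refine fr_eq _ _ _ _ _ _ ?_
    have := transForm_cocycle_of_eq_zero (R := ZMod (p ^ 2)) (f := f) (l := l) (f₃ := f₃)
      (f₅ := f₅) (ε := ε) hs
    linear_combination (base _ f (X b.2) ^ eqnDeg (patchClass b.1) *
      base _ f (X e.2) ^ eqnDeg (patchClass e.1) * base _ f (X a.2) ^ eqnDeg (patchClass a.1)) * this
  · have hlf := SetLike.mul_mem_graded (coe_mem (ZMod (p ^ 2)) f l) (coe_mem (ZMod (p ^ 2)) f f₅)
    have hG := zsmul_mem (coe_mem (ZMod (p ^ 2)) f G)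
      (triSign (patchClass a.1) (patchClass b.1) (patchClass e.1))
    rw [liftingCocycle, dif_pos hs, fr_zsmul, natCast_mul_fr p _ _ _ (natCast_mul_mem p hG),
      ← fr_self hlf (le_coe_mul_coe h natCast_sq_eq_zero ha hb he hs), fr_add, fr_mul, fr_mul]
    refine fr_eq _ _ _ _ _ _ ?_
    have := transForm_cocycle (R := ZMod (p ^ 2)) (ε := ε) h natCast_sq_eq_zero (patchClass a.1)
      (patchClass b.1) (patchClass e.1)
    linear_combination (base _ f (X b.2) ^ eqnDeg (patchClass b.1) *
      base _ f (X e.2) ^ eqnDeg (patchClass e.1) * base _ f (X a.2) ^ eqnDeg (patchClass a.1)) * this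

end

variable (p f l f₃ f₅ ε) in
/-- The members of the covering of the surface over `ℤ/p²`. -/
abbrev thickPatch (a : Fin 4 × Fin 3) : (surface (ZMod (p ^ 2)) f).Opens :=
  patch (ZMod (p ^ 2)) f l f₃ f₅ ε a

variable (p f l f₃ f₅ ε) in
/-- The local equations of the component. -/
def localEqn (a : Fin 4 × Fin 3) {U : (surface (ZMod p) f).Opens}
    (hU : U ≤ patch (ZMod p) f l f₃ f₅ ε a) : Γ(surface (ZMod p) f, U) :=
  fr (grading (ZMod p) f) (eqnForm (ZMod p) f l f₃ ε (patchClass a.1))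
    (base (ZMod p) f (X a.2) ^ eqnDeg (patchClass a.1)) (eqnForm_mem _) (base_X_pow_mem _ _)
    (le_basicOpen_pow (hU.trans (patch_le_X a)) _)

include h in
theorem span_localEqn (hl : intMap (ZMod p) l ≠ 0) (a : Fin 4 × Fin 3)
    {U : (surface (ZMod p) f).Opens} (hU : U ≤ patch (ZMod p) f l f₃ f₅ ε a)
    (hU' : patch (ZMod p) f l f₃ f₅ ε a ≤ U) (hUa : IsAffineOpen U) :
    Ideal.span {localEqn p f l f₃ f₅ ε a hU} = (Scheme.IdealSheafData.vanishingIdeal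
      (vanish (ZMod p) f (coe (ZMod p) f l) (wAdd (ZMod p) f f₃ ε))).ideal ⟨U, hUa⟩ :=
  span_fr_eq_ideal (patch_mem a) (Nat.succ_pos _) hU hU' hUa
    (fun _ => mem_span_of_vanish hl h) (cofactor_mem _) (hU.trans (patch_le_cofactor a)) _ _ _
    (fun _ hy hya => eqnForm_mem_of_mem_vanish hy (hU hya)) (fun _ => cofactor_mul_mem h _)

include h in
theorem localEqn_mem_nonZeroDivisors
    (H : IsCompleteIntersection (intMap (ZMod p) l) (intMap (ZMod p) f₃) (intMap (ZMod p) f₅))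
    (a : Fin 4 × Fin 3) {U : (surface (ZMod p) f).Opens}
    (hU : U ≤ patch (ZMod p) f l f₃ f₅ ε a) (hU' : patch (ZMod p) f l f₃ f₅ ε a ≤ U) :
    localEqn p f l f₃ f₅ ε a hU ∈ nonZeroDivisors Γ(surface (ZMod p) f, U) :=
  fr_mem_nonZeroDivisors (patch_mem a) (Nat.succ_pos _) hU hU' _ _ _
    (eqnForm_mem_nonZeroDivisors H h _)

theorem pull_transition_mul (a b : Fin 4 × Fin 3) {O : (surface (ZMod (p ^ 2)) f).Opens}
    {U : (surface (ZMod p) f).Opens} (e : U ≤ reductionIncl p f ⁻¹ᵁ O)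
    (ha : O ≤ patch (ZMod (p ^ 2)) f l f₃ f₅ ε a) (hb : O ≤ patch (ZMod (p ^ 2)) f l f₃ f₅ ε b)
    (ha' : U ≤ patch (ZMod p) f l f₃ f₅ ε a) (hb' : U ≤ patch (ZMod p) f l f₃ f₅ ε b) :
    pull (reductionIncl p f) e (transition h a b ha hb) * localEqn p f l f₃ f₅ ε b hb' =
      localEqn p f l f₃ f₅ ε a ha' := by
  have hpull := pull_fr e (transNum_mem (l := l) (f₃ := f₃) (f₅ := f₅) (ε := ε) a b)
    (transNum_mem' a b) (le_transNum h hb ha)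
  refine ((congrArg (· * _) hpull).trans (fr_mul _ _ _ _ _ _)).trans ?_
  refine fr_eq _ _ _ _ _ _ ?_
  have := transForm_mul_eqnForm (R := ZMod p) (ε := ε) h natCast_eq_zero (patchClass a.1)
    (patchClass b.1)
  simp only [map_mul, map_pow, coeffMap_transForm, coeffMap_base, map_X]
  linear_combination (base _ f (X b.2) ^ eqnDeg (patchClass b.1) *
    base _ f (X a.2) ^ eqnDeg (patchClass a.1)) * this

end DoublePlane

end

/-! ### Assembly of the lifting datum. -/

noncomputable section

namespace DoublePlane

open Cech ProjFraction TernaryForms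

variable {p : ℕ} [Fact p.Prime] {f : Form 6} {l : Form 1} {f₃ : Form 3} {f₅ : Form 5} {G : Form 6}

theorem res_localEqn (a : Fin 4 × Fin 3) {ε : ℤˣ} {U U' : (surface (ZMod p) f).Opens}
    (hU : U ≤ patch (ZMod p) f l f₃ f₅ ε a) (hU' : U' ≤ U) :
    res (surface (ZMod p) f) hU' (localEqn p f l f₃ f₅ ε a hU) =
      localEqn p f l f₃ f₅ ε a (hU'.trans hU) := res_fr _ _ _ _

omit [Fact p.Prime] in
theorem res_transition {ε : ℤˣ} (h : (f : MvPolynomial (Fin 3) ℤ) = f₃ ^ 2 + l * f₅ + p * G)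
    (a b : Fin 4 × Fin 3) {O O' : (surface (ZMod (p ^ 2)) f).Opens}
    (ha : O ≤ patch (ZMod (p ^ 2)) f l f₃ f₅ ε a) (hb : O ≤ patch (ZMod (p ^ 2)) f l f₃ f₅ ε b)
    (hO : O' ≤ O) : res (surface (ZMod (p ^ 2)) f) hO (transition h a b ha hb) =
      transition h a b (hO.trans ha) (hO.trans hb) :=
  res_fr (transNum_mem a b) (transNum_mem' a b) (le_transNum h hb ha) hO

theorem isAffineOpen_preimage (a : Fin 4 × Fin 3) {ε : ℤˣ} :
    IsAffineOpen (reductionIncl p f ⁻¹ᵁ thickPatch p f l f₃ f₅ ε a) := by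
  rw [preimage_patch]
  exact isAffineOpen_patch a

theorem iSup_preimage (hp : p ≠ 2)
    (H : IsCompleteIntersection (intMap (ZMod p) l) (intMap (ZMod p) f₃) (intMap (ZMod p) f₅))
    (ε : ℤˣ) : ⨆ a, reductionIncl p f ⁻¹ᵁ thickPatch p f l f₃ f₅ ε a = ⊤ := by
  simp only [preimage_patch]
  exact iSup_patch H hp

theorem pull_transition_mul_res (h : (f : MvPolynomial (Fin 3) ℤ) = f₃ ^ 2 + l * f₅ + p * G)
    {ε : ℤˣ} (a b : Fin 4 × Fin 3) :
    ((reductionIncl p f).appLE (thickPatch p f l f₃ f₅ ε a ⊓ thickPatch p f l f₃ f₅ ε b)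
      (reductionIncl p f ⁻¹ᵁ thickPatch p f l f₃ f₅ ε a ⊓
        reductionIncl p f ⁻¹ᵁ thickPatch p f l f₃ f₅ ε b) le_rfl).hom
      (transition (ε := ε) h a b inf_le_left inf_le_right) *
      res (surface (ZMod p) f) inf_le_right (localEqn p f l f₃ f₅ ε b (preimage_patch b).le) =
      res (surface (ZMod p) f) inf_le_left (localEqn p f l f₃ f₅ ε a (preimage_patch a).le) := by
  rw [res_localEqn, res_localEqn]
  exact pull_transition_mul h a b _ _ _ _ _

omit [Fact p.Prime] in
theorem transition_mul_res (h : (f : MvPolynomial (Fin 3) ℤ) = f₃ ^ 2 + l * f₅ + p * G)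
    {ε : ℤˣ} (a b e : Fin 4 × Fin 3) :
    res (surface (ZMod (p ^ 2)) f) (inf_le_left : thickPatch p f l f₃ f₅ ε a ⊓
        thickPatch p f l f₃ f₅ ε b ⊓ thickPatch p f l f₃ f₅ ε e ≤ _)
        (transition (ε := ε) h a b inf_le_left inf_le_right) *
      res (surface (ZMod (p ^ 2)) f) (le_inf (inf_le_left.trans inf_le_right) inf_le_right)
        (transition (ε := ε) h b e (O := thickPatch p f l f₃ f₅ ε b ⊓ thickPatch p f l f₃ f₅ ε e)
          inf_le_left inf_le_right) =
      res (surface (ZMod (p ^ 2)) f) (le_inf (inf_le_left.trans inf_le_left) inf_le_right)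
        (transition (ε := ε) h a e (O := thickPatch p f l f₃ f₅ ε a ⊓ thickPatch p f l f₃ f₅ ε e)
          inf_le_left inf_le_right) *
        (1 + (p : Γ(surface (ZMod (p ^ 2)) f, _)) * liftingCocycle f l f₅ (ZMod (p ^ 2)) G
          (thickPatch p f l f₃ f₅ ε a ⊓ thickPatch p f l f₃ f₅ ε b ⊓ thickPatch p f l f₃ f₅ ε e)
          (triSign (patchClass a.1) (patchClass b.1) (patchClass e.1))
          (le_coe_mul_coe h natCast_sq_eq_zero (inf_le_left.trans inf_le_left)
            (inf_le_left.trans inf_le_right) inf_le_right)) := by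
  rw [res_transition, res_transition, res_transition]
  exact transition_mul h _ _ _

/-- The lifting datum. -/
def liftingDatum (hp : p ≠ 2)
    (H : IsCompleteIntersection (intMap (ZMod p) l) (intMap (ZMod p) f₃) (intMap (ZMod p) f₅))
    (h : (f : MvPolynomial (Fin 3) ℤ) = f₃ ^ 2 + l * f₅ + p * G) (ε : ℤˣ) :
    LiftingDatum (reductionIncl p f) p (Scheme.IdealSheafData.vanishingIdeal
      (vanish (ZMod p) f (coe (ZMod p) f l) (wAdd (ZMod p) f f₃ ε))) where
  ι := Fin 4 × Fin 3
  V := thickPatch p f l f₃ f₅ ε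
  affine a := isAffineOpen_preimage a
  cover := iSup_preimage hp H ε
  s a := localEqn p f l f₃ f₅ ε a (preimage_patch a).le
  span_s a := span_localEqn h H.ne_zero a _ (preimage_patch a).ge _
  regular a := localEqn_mem_nonZeroDivisors h H a _ (preimage_patch a).ge
  g a b := transition (ε := ε) h a b inf_le_left inf_le_right
  g_lifts a b := pull_transition_mul_res h a b
  c a b e := liftingCocycle f l f₅ (ZMod (p ^ 2)) G
    (thickPatch p f l f₃ f₅ ε a ⊓ thickPatch p f l f₃ f₅ ε b ⊓ thickPatch p f l f₃ f₅ ε e)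
    (triSign (patchClass a.1) (patchClass b.1) (patchClass e.1))
    (le_coe_mul_coe h natCast_sq_eq_zero (inf_le_left.trans inf_le_left)
      (inf_le_left.trans inf_le_right) inf_le_right)
  c_spec a b e := transition_mul_res h a b e

end DoublePlane

end

noncomputable section

/-! ### Comparison of the two cocycles -/

namespace DoublePlane

open Cech ProjFraction TernaryForms

variable {p : ℕ} {f : Form 6} {l : Form 1} {f₃ : Form 3} {f₅ : Form 5} {G : Form 6} {ε : ℤˣ}

variable (R : Type) [CommRing R] (f l f₃ f₅) in
/-- The product of the three forms. -/
abbrev tripleForm : CoordRing R f := coe R f l * coe R f f₃ * coe R f f₅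

theorem tripleForm_mem {R : Type} [CommRing R] : tripleForm f l f₃ f₅ R ∈ grading R f 9 :=
  SetLike.mul_mem_graded (SetLike.mul_mem_graded (coe_mem R f l) (coe_mem R f f₃)) (coe_mem R f f₅)

variable {O : (surface (ZMod p) f).Opens}

/-- The function `G / (ℓ f₅)`, written with the denominator `ℓ f₃ f₅`. -/
def fracBase (G : Form 6)
    (hO : O ≤ Proj.basicOpen (grading (ZMod p) f) (tripleForm f l f₃ f₅ (ZMod p))) :
    Γ(surface (ZMod p) f, O) :=
  fr (grading (ZMod p) f) (coe (ZMod p) f G * coe (ZMod p) f f₃) _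
    (SetLike.mul_mem_graded (coe_mem _ f G) (coe_mem _ f f₃)) tripleForm_mem hO

/-- The function `ε G w / (ℓ f₃ f₅)`. -/
def fracW (G : Form 6) (ε : ℤˣ)
    (hO : O ≤ Proj.basicOpen (grading (ZMod p) f) (tripleForm f l f₃ f₅ (ZMod p))) :
    Γ(surface (ZMod p) f, O) :=
  fr (grading (ZMod p) f) ((ε : ℤ) • (coe (ZMod p) f G * w (ZMod p) f)) _
    (zsmul_mem (SetLike.mul_mem_graded (coe_mem _ f G) (w_mem _ f)) _) tripleForm_mem hO

/-- The coefficients of the cochain which compares the two cocycles. -/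
abbrev cobase : Fin 4 → ℤ := ![-1, -1, 1, 0]

/-- The coefficients of the cochain which compares the two cocycles. -/
abbrev cow : Fin 4 → ℤ := ![0, 1, 1, 0]

/-- The alternating family with values `B i` at `(3, i)`. -/
def altCoeff (B : Fin 4 → ℤ) (i j : Fin 4) : ℤ :=
  (if i = 3 then B j else 0) - if j = 3 then B i else 0

/-- The member of the covering `ℓ ≠ 0`, `f₃ ≠ 0`, `f₅ ≠ 0` which contains a given patch. -/
abbrev coverIndex : Fin 4 → Fin 3 := ![0, 1, 1, 2]

/-- In the coboundary of the comparison cochain, `fracBase` must account for `-2` times the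
obstruction cocycle and `fracW` for twice the cocycle of `Φ(-G)`. A cochain supported on pairs that
involve the patch `f₅ ≠ 0` suffices. -/
theorem altCoeff_cobase : ∀ i j k : Fin 4,
    altCoeff cobase j k - altCoeff cobase i k + altCoeff cobase i j =
      -2 * triSign (patchClass i) (patchClass j) (patchClass k) := by decide

theorem altCoeff_cow : ∀ i j k : Fin 4,
    altCoeff cow j k - altCoeff cow i k + altCoeff cow i j =
      -triSign (coverIndex i) (coverIndex j) (coverIndex k) := by decide

variable (h : (f : MvPolynomial (Fin 3) ℤ) = f₃ ^ 2 + l * f₅ + p * G)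

theorem fracBase_fracW_eq (m n : ℤ) {k : ℕ} {x y : CoordRing (ZMod p) f}
    (hx : x ∈ grading (ZMod p) f k) (hy : y ∈ grading (ZMod p) f k)
    (hO : O ≤ Proj.basicOpen (grading (ZMod p) f) (tripleForm f l f₃ f₅ (ZMod p)))
    (hyO : O ≤ Proj.basicOpen (grading (ZMod p) f) y)
    (e : x * tripleForm f l f₃ f₅ (ZMod p) = ((m : CoordRing (ZMod p) f) * coe (ZMod p) f f₃ +
      n * ((ε : ℤ) : CoordRing (ZMod p) f) * w (ZMod p) f) * coe (ZMod p) f G * y) :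
    fr (grading (ZMod p) f) x y hx hy hyO = m • fracBase G hO + n • fracW G ε hO := by
  rw [fracBase, fracW, fr_zsmul, fr_zsmul, fr_add]
  refine fr_eq _ _ _ _ _ _ ?_
  rw [e]
  simp only [zsmul_eq_mul]
  ring

include h in
/-- The entries of the comparison cochain. -/
theorem exists_comparison (i : Fin 4)
    (hO : O ≤ Proj.basicOpen (grading (ZMod p) f) (patchForm (ZMod p) f l f₃ f₅ ε i))
    (h₅ : O ≤ Proj.basicOpen (grading (ZMod p) f) (coe (ZMod p) f f₅)) :
    ∃ s : Γ(surface (ZMod p) f, O), ∀ (O' : (surface (ZMod p) f).Opens) (hO' : O' ≤ O)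
      (h' : O' ≤ Proj.basicOpen (grading (ZMod p) f) (tripleForm f l f₃ f₅ (ZMod p))),
      res _ hO' s = cobase i • fracBase G h' + cow i • fracW G ε h' := by
  have hε := units_cast_sq (R := ZMod p) (f := f) (ε := ε)
  have hw := wAdd_mul_wSub (R := ZMod p) (ε := ε) h
  rw [natCast_eq_zero, zero_mul, add_zero, wAdd, wSub, zsmul_eq_mul] at hw
  suffices ∃ (k : ℕ) (x y : CoordRing (ZMod p) f) (_ : x ∈ grading (ZMod p) f k)
      (_ : y ∈ grading (ZMod p) f k) (_ : O ≤ Proj.basicOpen (grading (ZMod p) f) y),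
      x * tripleForm f l f₃ f₅ (ZMod p) = ((cobase i : CoordRing (ZMod p) f) * coe (ZMod p) f f₃ +
      cow i * ((ε : ℤ) : CoordRing (ZMod p) f) * w (ZMod p) f) * coe (ZMod p) f G * y by
    obtain ⟨k, x, y, hx, hy, hyO, e⟩ := this
    refine ⟨fr _ x y hx hy hyO, fun O' hO' h' => ?_⟩
    rw [res_fr]
    exact fracBase_fracW_eq _ _ hx hy h' _ e
  -- The sections are `-G/(ℓf₅)`, `εG/(f₃(w + εf₃))`, `εG/(f₃(w - εf₃))` and `0`; in the middle
  -- cases a factor `w ∓ εf₃` has been cancelled against `ℓf₅ = (w + εf₃)(w - εf₃)`.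
  fin_cases i
  · refine ⟨6, -coe (ZMod p) f G, coe (ZMod p) f l * coe (ZMod p) f f₅, neg_mem (coe_mem _ f G),
      SetLike.mul_mem_graded (coe_mem _ f l) (coe_mem _ f f₅), le_basicOpen_mul hO h₅, ?_⟩
    simp
    ring
  · refine ⟨6, (ε : ℤ) • coe (ZMod p) f G, _, zsmul_mem (coe_mem _ f G) _, patchForm_mem 1, hO, ?_⟩
    simp [patchForm, wAdd]
    linear_combination (-((ε : ℤ) : CoordRing (ZMod p) f) * coe (ZMod p) f G * coe (ZMod p) f f₃) * hw -
      (((ε : ℤ) : CoordRing (ZMod p) f) * coe (ZMod p) f G * coe (ZMod p) f f₃ ^ 3 +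
        coe (ZMod p) f G * coe (ZMod p) f f₃ ^ 2 * w (ZMod p) f) * hε
  · refine ⟨6, (ε : ℤ) • coe (ZMod p) f G, _, zsmul_mem (coe_mem _ f G) _, patchForm_mem 2, hO, ?_⟩
    simp [patchForm, wSub]
    linear_combination (-((ε : ℤ) : CoordRing (ZMod p) f) * coe (ZMod p) f G * coe (ZMod p) f f₃) * hw -
      (((ε : ℤ) : CoordRing (ZMod p) f) * coe (ZMod p) f G * coe (ZMod p) f f₃ ^ 3 -
        coe (ZMod p) f G * coe (ZMod p) f f₃ ^ 2 * w (ZMod p) f) * hε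
  · exact ⟨0, 0, 1, zero_mem _, one_mem_grading, by simp, by simp⟩

variable [Fact p.Prime]

theorem res_pull_liftingCocycle {V : (surface (ZMod (p ^ 2)) f).Opens} (n : ℤ)
    (hV : n ≠ 0 → V ≤ Proj.basicOpen (grading (ZMod (p ^ 2)) f)
      (coe (ZMod (p ^ 2)) f l * coe (ZMod (p ^ 2)) f f₅)) (e : O ≤ reductionIncl p f ⁻¹ᵁ V)
    {O' : (surface (ZMod p) f).Opens} (hO' : O' ≤ O)
    (h' : O' ≤ Proj.basicOpen (grading (ZMod p) f) (tripleForm f l f₃ f₅ (ZMod p))) :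
    res _ hO' (pull (reductionIncl p f) e (liftingCocycle f l f₅ (ZMod (p ^ 2)) G V n hV)) =
      n • fracBase G h' := by
  by_cases hn : n = 0
  · rw [liftingCocycle, dif_neg (not_not.mpr hn), map_zero, map_zero, hn, zero_smul]
  · rw [liftingCocycle, dif_pos hn, res_pull, map_zsmul, pull_fr, fracBase]
    congr 1
    refine fr_eq _ _ _ _ _ _ ?_
    rw [map_mul, coeffMap_coe, coeffMap_coe, coeffMap_coe]
    ring

section

variable (H : IsCompleteIntersection (intMap (ZMod p) l) (intMap (ZMod p) f₃)
  (intMap (ZMod p) f₅))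

include H

theorem tripleForm_mem_nonZeroDivisors :
    tripleForm f l f₃ f₅ (ZMod p) ∈ nonZeroDivisors (CoordRing (ZMod p) f) := by
  obtain ⟨h0, h3, h5⟩ := coe_mem_nonZeroDivisors (f := f) H
  exact mul_mem (mul_mem h0 h3) h5

/-- Functions on a triple intersection are determined where `ℓ f₃ f₅` does not vanish. -/
theorem eq_of_res_tripleForm {a b e : Fin 4 × Fin 3} {U : Fin 3 → (surface (ZMod p) f).Opens}
    (h0 : U 0 = patch (ZMod p) f l f₃ f₅ ε a) (h1 : U 1 = patch (ZMod p) f l f₃ f₅ ε b)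
    (h2 : U 2 = patch (ZMod p) f l f₃ f₅ ε e) {s t : Γ(surface (ZMod p) f, U 0 ⊓ U 1 ⊓ U 2)}
    (hst : ∀ (O' : (surface (ZMod p) f).Opens) (hO' : O' ≤ U 0 ⊓ U 1 ⊓ U 2)
      (_ : O' ≤ Proj.basicOpen (grading (ZMod p) f) (tripleForm f l f₃ f₅ (ZMod p))),
      res _ hO' s = res _ hO' t) : s = t := by
  have hU : U 0 ⊓ U 1 ⊓ U 2 = Proj.basicOpen (grading (ZMod p) f)
      (patchForm (ZMod p) f l f₃ f₅ ε a.1 * base (ZMod p) f (X a.2) *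
        (patchForm (ZMod p) f l f₃ f₅ ε b.1 * base (ZMod p) f (X b.2)) *
        (patchForm (ZMod p) f l f₃ f₅ ε e.1 * base (ZMod p) f (X e.2))) := by
    rw [h0, h1, h2, Proj.basicOpen_mul _ (_ * _ * (_ * _)), Proj.basicOpen_mul _ (_ * _) (_ * _)]
    rfl
  rw [← sub_eq_zero]
  refine eq_zero_of_res_eq_zero (SetLike.mul_mem_graded (SetLike.mul_mem_graded (patch_mem a)
    (patch_mem b)) (patch_mem e)) (Nat.succ_pos _) hU.le hU.ge tripleForm_mem
    (inf_le_left : U 0 ⊓ U 1 ⊓ U 2 ⊓ Proj.basicOpen _ _ ≤ _) le_rfl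
    (tripleForm_mem_nonZeroDivisors H) ?_
  rw [map_sub, hst _ _ inf_le_right, sub_self]

include h in
/-- Twice the difference of the two cocycles is a coboundary. -/
theorem two_nsmul_sub_mem_range
    {U : Fin 4 × Fin 3 → (surface (ZMod p) f).Opens}
    (hU : ∀ a, U a = patch (ZMod p) f l f₃ f₅ ε a) {t c : C2 (surface (ZMod p) f) U}
    (ht : ∀ a b e (O' : (surface (ZMod p) f).Opens) (hO' : O' ≤ U a ⊓ U b ⊓ U e)
      (h' : O' ≤ Proj.basicOpen (grading (ZMod p) f) (tripleForm f l f₃ f₅ (ZMod p))),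
      2 • res _ hO' (t a b e) = -(triSign (coverIndex a.1) (coverIndex b.1) (coverIndex e.1) •
        fracW G ε h'))
    (hc : ∀ a b e (O' : (surface (ZMod p) f).Opens) (hO' : O' ≤ U a ⊓ U b ⊓ U e)
      (h' : O' ≤ Proj.basicOpen (grading (ZMod p) f) (tripleForm f l f₃ f₅ (ZMod p))),
      res _ hO' (c a b e) = triSign (patchClass a.1) (patchClass b.1) (patchClass e.1) •
        fracBase G h') : 2 • (t - c) ∈ (d1 (surface (ZMod p) f) U).range := by
  have hβ (a b) : ∃ s : Γ(surface (ZMod p) f, U a ⊓ U b),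
      ∀ (O' : (surface (ZMod p) f).Opens) (hO' : O' ≤ U a ⊓ U b)
      (h' : O' ≤ Proj.basicOpen (grading (ZMod p) f) (tripleForm f l f₃ f₅ (ZMod p))),
      res _ hO' s = altCoeff cobase a.1 b.1 • fracBase G h' +
        altCoeff cow a.1 b.1 • fracW G ε h' := by
    have hle a : U a ≤ Proj.basicOpen (grading (ZMod p) f) (patchForm (ZMod p) f l f₃ f₅ ε a.1) :=
      (hU a).le.trans (patch_le_patchForm a)
    have h₅ {a} (ha : a.1 = 3) : U a ≤ Proj.basicOpen (grading (ZMod p) f) (coe (ZMod p) f f₅) :=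
      (hle a).trans (by rw [ha]; exact le_rfl)
    have h1 : ∃ s : Γ(surface (ZMod p) f, U a ⊓ U b),
        ∀ (O' : (surface (ZMod p) f).Opens) (hO' : O' ≤ U a ⊓ U b)
        (h' : O' ≤ Proj.basicOpen (grading (ZMod p) f) (tripleForm f l f₃ f₅ (ZMod p))),
        res _ hO' s = (if a.1 = 3 then cobase b.1 else 0) • fracBase G h' +
          (if a.1 = 3 then cow b.1 else 0) • fracW G ε h' := by
      by_cases ha : a.1 = 3
      · simpa only [if_pos ha] using exists_comparison h b.1 (inf_le_right.trans (hle b))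
          (inf_le_left.trans (h₅ ha))
      · exact ⟨0, by simp [ha]⟩
    have h2 : ∃ s : Γ(surface (ZMod p) f, U a ⊓ U b),
        ∀ (O' : (surface (ZMod p) f).Opens) (hO' : O' ≤ U a ⊓ U b)
        (h' : O' ≤ Proj.basicOpen (grading (ZMod p) f) (tripleForm f l f₃ f₅ (ZMod p))),
        res _ hO' s = (if b.1 = 3 then cobase a.1 else 0) • fracBase G h' +
          (if b.1 = 3 then cow a.1 else 0) • fracW G ε h' := by
      by_cases hb : b.1 = 3
      · simpa only [if_pos hb] using exists_comparison h a.1 (inf_le_left.trans (hle a))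
          (inf_le_right.trans (h₅ hb))
      · exact ⟨0, by simp [hb]⟩
    obtain ⟨s, hs⟩ := h1
    obtain ⟨s', hs'⟩ := h2
    refine ⟨s - s', fun O' hO' h' => ?_⟩
    rw [map_sub, hs _ _ h', hs' _ _ h', altCoeff, altCoeff, sub_smul, sub_smul]
    abel
  choose β hβ using hβ
  refine mem_range_d1.mpr ⟨β, fun a b e => ?_⟩
  -- It is enough to compare where `ℓf₃f₅ ≠ 0`; there all terms are integral combinations of
  -- `fracBase` and `fracW`.
  refine eq_of_res_tripleForm (U := ![U a, U b, U e]) H (hU a) (hU b) (hU e) fun O' hO' h' => ?_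
  have hO : O' ≤ U a ⊓ U b ⊓ U e := hO'
  have e1 : res _ hO ((2 • (t - c)) a b e) =
      2 • res _ hO (t a b e) - 2 • res _ hO (c a b e) := by
    change res _ hO (2 • (t a b e - c a b e)) = _
    rw [map_nsmul, map_sub, smul_sub]
  refine e1.trans ?_
  rw [ht a b e _ hO h', hc a b e _ hO h']
  have e2 : res _ hO (res _ leI (β b e) - res _ leI (β a e) + res _ leI (β a b)) =
      (altCoeff cobase b.1 e.1 - altCoeff cobase a.1 e.1 + altCoeff cobase a.1 b.1) •
        fracBase G h' + (altCoeff cow b.1 e.1 - altCoeff cow a.1 e.1 + altCoeff cow a.1 b.1) •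
        fracW G ε h' := by
    rw [map_add, map_sub, res_res, res_res, res_res, hβ _ _ _ _ h', hβ _ _ _ _ h', hβ _ _ _ _ h']
    simp only [add_smul, sub_smul]
    abel
  refine Eq.trans ?_ e2.symm
  rw [altCoeff_cobase, altCoeff_cow, neg_mul, neg_smul, neg_smul, mul_smul, ofNat_zsmul]
  abel

end

end DoublePlane

end

noncomputable section

/-! ### The obstruction -/

namespace DoublePlane

open Cech ProjFraction TernaryForms

variable {p : ℕ} [Fact p.Prime] {f : Form 6} {l : Form 1} {f₃ : Form 3} {f₅ : Form 5} {G : Form 6}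
  {ε : ℤˣ}

omit [Fact p.Prime] in
theorem patch_le_cover (a : Fin 4 × Fin 3) :
    patch (ZMod p) f l f₃ f₅ ε a ≤ cover p f l f₃ f₅ (coverIndex a.1) := by
  refine (patch_le_patchForm a).trans ?_
  generalize a.1 = i
  fin_cases i
  · exact le_rfl
  · exact (Proj.basicOpen_mul _ _ _).le.trans inf_le_left
  · exact (Proj.basicOpen_mul _ _ _).le.trans inf_le_left
  · exact le_rfl

theorem res_cechHom_neg {O : (surface (ZMod p) f).Opens}
    (hO : O ≤ (cover p f l f₃ f₅ 0 : (surface (ZMod p) f).Opens) ⊓ cover p f l f₃ f₅ 1 ⊓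
      cover p f l f₃ f₅ 2)
    (h' : O ≤ Proj.basicOpen (grading (ZMod p) f) (tripleForm f l f₃ f₅ (ZMod p))) :
    res _ hO ((ε : ℤ) • cechHom p f l f₃ f₅ (-G)) = -fracW G ε h' := by
  rw [map_neg, smul_neg, map_neg, map_zsmul]
  exact congrArg Neg.neg (fr_zsmul _ _ tripleForm_mem h')

/-- All cochains are killed by the odd number `p`, so 2 is invertible on them. -/
theorem mem_of_two_nsmul_mem (hp : p ≠ 2) {U : Fin 4 × Fin 3 → (surface (ZMod p) f).Opens}
    {S : AddSubgroup (C2 (surface (ZMod p) f) U)} {z : C2 (surface (ZMod p) f) U}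
    (hz : 2 • z ∈ S) : z ∈ S := by
  obtain ⟨m, hm⟩ := (Fact.out : p.Prime).odd_of_ne_two hp
  have hpz : p • z = 0 := by
    funext a b e
    exact p_nsmul_section _
  have e : p • z = m • 2 • z + z := by
    rw [smul_smul, mul_comm, ← succ_nsmul, ← hm]
  rw [e] at hpz
  rw [← neg_eq_of_add_eq_zero_right hpz]
  exact neg_mem (nsmul_mem hz m)

theorem two_nsmul_res_alternating {t : Γ(surface (ZMod p) f, (cover p f l f₃ f₅ 0 :
      (surface (ZMod p) f).Opens) ⊓ cover p f l f₃ f₅ 1 ⊓ cover p f l f₃ f₅ 2)}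
    (ht : 2 • t = (ε : ℤ) • cechHom p f l f₃ f₅ (-G)) {i j k : Fin 3}
    {V O : (surface (ZMod p) f).Opens} (hV : V ≤ (cover p f l f₃ f₅ i :
      (surface (ZMod p) f).Opens) ⊓ cover p f l f₃ f₅ j ⊓ cover p f l f₃ f₅ k) (hO : O ≤ V)
    (h' : O ≤ Proj.basicOpen (grading (ZMod p) f) (tripleForm f l f₃ f₅ (ZMod p))) :
    2 • res _ hO (res _ hV (alternating
      (fun i => (cover p f l f₃ f₅ i : (surface (ZMod p) f).Opens)) t i j k)) =
      -(triSign i j k • fracW G ε h') := by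
  have hcov : O ≤ (cover p f l f₃ f₅ 0 : (surface (ZMod p) f).Opens) ⊓ cover p f l f₃ f₅ 1 ⊓
    cover p f l f₃ f₅ 2 := h'.trans inf_cover_eq.ge
  rw [res_res]
  refine (congrArg (2 • ·) (res_alternating
    (U := fun i => (cover p f l f₃ f₅ i : (surface (ZMod p) f).Opens)) t _ hcov)).trans ?_
  rw [smul_comm, ← map_nsmul, ht, res_cechHom_neg _ h', smul_neg]

/-- The alternating cocycle for `ℓ, f₃, f₅` is pulled back to the twelve patches of the lifting
datum, where twice its difference from the obstruction cocycle is a coboundary. -/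
theorem isObstruction_of_represents (hp : p ≠ 2)
    (H : IsCompleteIntersection (intMap (ZMod p) l) (intMap (ZMod p) f₃) (intMap (ZMod p) f₅))
    (h : (f : MvPolynomial (Fin 3) ℤ) = f₃ ^ 2 + l * f₅ + p * G)
    {z : C2 (surface (ZMod p) f) (aff _)} {θ : H2 (surface (ZMod p) f)} (hz : Represents z θ)
    (h2 : 2 • z (cover p f l f₃ f₅ 0) (cover p f l f₃ f₅ 1) (cover p f l f₃ f₅ 2) =
      (ε : ℤ) • cechHom p f l f₃ f₅ (-G)) :
    IsObstruction (reductionIncl p f) p (Scheme.IdealSheafData.vanishingIdeal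
      (vanish (ZMod p) f (coe (ZMod p) f l) (wAdd (ZMod p) f f₃ ε))) θ := by
  rw [isObstruction_iff]
  refine ⟨liftingDatum hp H h ε, ?_⟩
  have hU (a : Fin 4 × Fin 3) := preimage_patch (p := p) (f := f) (l := l) (f₃ := f₃) (f₅ := f₅)
    (ε := ε) a
  have r := (hz.representsOn_alternating (U := cover p f l f₃ f₅)).refine
    (liftingDatum hp H h ε).U (fun a : Fin 4 × Fin 3 => coverIndex a.1)
    (fun a => (hU a).le.trans (patch_le_cover a))
  refine r.congr (mem_of_two_nsmul_mem hp (two_nsmul_sub_mem_range (ε := ε) h H hU ?_ ?_))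
  · intro a b e O' hO' h'
    exact two_nsmul_res_alternating h2 _ hO' h'
  · intro a b e O' hO' h'
    exact res_pull_liftingCocycle _ _ _ hO' h'

end DoublePlane

end

theorem mainTheorem6 (p : ℕ) [Fact p.Prime] (hp : p ≠ 2) (f₆ : Form 6)
    (hf : NonsingularMod p f₆) (l : Form 1) (hl : IsTritangentMod p f₆ l)
    (Z : TopologicalSpace.Closeds (surface (ZMod p) f₆))
    (hZ : IsComponentOf Z (Proj.basicOpen (grading (ZMod p) f₆) (coe (ZMod p) f₆ l)).compl)
    (hZ' : Z ≠ (Proj.basicOpen (grading (ZMod p) f₆) (coe (ZMod p) f₆ l)).compl) :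
    (∃ (f₃ : Form 3) (f₅ : Form 5) (G : Form 6),
      (f₆ : MvPolynomial (Fin 3) ℤ) = f₃ ^ 2 + l * f₅ + p * G) ∧
    ∀ (f₃ : Form 3) (f₅ : Form 5) (G : Form 6),
      (f₆ : MvPolynomial (Fin 3) ℤ) = f₃ ^ 2 + l * f₅ + p * G →
      (openOf (ZMod p) f₆ one_pos l : (surface (ZMod p) f₆).Opens) ⊔
          openOf (ZMod p) f₆ three_pos f₃ ⊔ openOf (ZMod p) f₆ (Nat.succ_pos 4) f₅ = ⊤ ∧
      ∃ ε : ℤˣ,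
        Z = vanish (ZMod p) f₆ (coe (ZMod p) f₆ l)
          (w (ZMod p) f₆ + (ε : ℤ) • coe (ZMod p) f₆ f₃) ∧
        ∃ Φ : (Form 6 ⧸ sexticIdeal p l f₃ f₅) ≃+ Cech.H2 (surface (ZMod p) f₆),
          (∀ q : Form 6, ∃ z, Cech.Represents z (Φ (QuotientAddGroup.mk q)) ∧
            2 • z (openOf (ZMod p) f₆ one_pos l) (openOf (ZMod p) f₆ three_pos f₃)
                (openOf (ZMod p) f₆ (Nat.succ_pos 4) f₅) =
              (ε : ℤ) • cechFraction (ZMod p) f₆ l f₃ f₅ q) ∧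
          ∀ θ : Cech.H2 (surface (ZMod p) f₆),
            IsObstruction (reductionIncl p f₆) p
                (Scheme.IdealSheafData.vanishingIdeal Z) θ ↔
              θ = Φ (QuotientAddGroup.mk (-G)) := by
  have hl' : intMap (ZMod p) l ≠ 0 := hl.1
  refine ⟨exists_forms hl' hZ hZ', fun f₃ f₅ G h => ?_⟩
  have H := isCompleteIntersection hf hl' h
  refine ⟨sup_openOf_eq_top H, ?_⟩
  obtain ⟨ε, hε⟩ := exists_sign hl' h hZ
  obtain ⟨Φ, hΦ⟩ := exists_equiv_H2 (f := f₆) H hp ε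
  refine ⟨ε, hε, Φ, hΦ, fun θ => ?_⟩
  obtain ⟨z, hz, h2⟩ := hΦ (-G)
  have hob := isObstruction_of_represents hp H h hz h2
  rw [hε]
  refine ⟨fun hθ => hθ.unique (isThickening p f₆) hob, ?_⟩
  rintro rfl
  exact hob
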